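/- Let $R$ be a commutative ring with unit and $h,t\in R$. Let $(\mathcal G_n)_{n\in\mathbb Z}$ be additive subgroups of $R$ with $1\in\mathcal G_0$, $\mathcal G_a\mathcal G_b\subseteq\mathcal G_{a+b}$, $h\in\mathcal G_{-2}$ and $t\in\mathcal G_{-4}$. The two main cases are a grading of the ring $R$ with $\deg h=-2$, $\deg t=-4$, and, for an arbitrary ungraded $R$ with arbitrary $h,t$, the family $\mathcal G_n=R$ for $n\le 0$, $\mathcal G_n=0$ for $n>0$. Let $A=R[X]/(X^2-hX-t)$ be the Frobenius algebra with counit $\epsilon(1)=0$, $\epsilon(X)=1$, and let $U\colon A\to A$ be multiplication by $2X-h$. Elements of $A$ have homological degree $0$, and the part of $A$ of quantum degree $q$ is $\{r+sX : r\in\mathcal G_q,\ s\in\mathcal G_{q+2}\}$; so $1$ has degree $0$, $X$ has degree $-2$, and $U\colon A\to q^2A$ preserves the quantum degree. Write $t^aq^b$ for the shift that raises the (homological, quantum) bidegree by $(a,b)$. For an oriented link diagram $D$ with $n_+$ positive and $n_-$ negative crossings let $\mathit{CKh}(D)$ be the Khovanov complex of $D$ for $A$. It is the free $R$-module on the enhanced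 states of $D$ (a smoothing of every crossing together with a label $1$ or $X$ on every circle) with the usual cube differential built from the multiplication and the comultiplication of $A$. A state with $r$ one-smoothings has homological degree $r-n_-$ and quantum degree $\#\{\text{labels }1\}-\#\{\text{labels }X\}+r+n_+-2n_-$. The part of $\mathit{CKh}(D)$ of bidegree $(p,q)$ consists of the combinations of states of homological degree $p$ in which the coefficient of a state of quantum degree $q'$ lies in $\mathcal G_{q-q'}$. (In the two cases above the parts of degree $q$ are the graded pieces for the quantum grading, and the steps "quantum degree $\ge q$" of the quantum filtration, respectively.) Let $k>0$ and let $T^*_{2,2k+1}$ be the negative $(2,2k+1)$-torus knot, given by its standard diagram, the closure of the $2$-strand braid with $2k+1$ negative crossings. Then $\mathit{CKh}(T^*_{2,2k+1})$ is a complex (its differential squares to zero, and has bidegree $(1,0)$), and there is a chain homotopy equivalence $$\mathit{CKh}(T^*_{2,2k+1})\ \simeq\ \bigoplus_{i=1}^{k} t^{-2i-1}q^{-2k-4i-1}\Bigl(A\xrightarrow{\ U\ }t\,q^{2}A\Bigr)\ \oplus\ q^{-2k+1}A ,$$ in which the last summand lies in homological degree $0$. The chain maps in both directions are $R$-linear of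 bidegree $(0,0)$, and both homotopies are $R$-linear of bidegree $(-1,0)$. -/

import Mathlib

open scoped Polynomial

universe u

namespace Khovanov

/-! ### Bigraded modules and complexes

Quantum degrees are recorded relative to a family `𝒢 : ℤ → AddSubgroup R` with `1 ∈ 𝒢 0` and
`𝒢 a * 𝒢 b ⊆ 𝒢 (a + b)` (`SetLike.GradedMonoid 𝒢`).  If `𝒢` is a grading of the ring `R`, the
pieces defined below are the homogeneous pieces of bigraded `R`-modules.  If `R` is ungraded one
takes `𝒢 n = R` for `n ≤ 0` and `𝒢 n = 0` for `n > 0`; then they are the steps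
"quantum degree at least `q`" of the quantum filtration. -/

/-- An `R`-module together with its pieces of bidegree `(p, q)`
(`p` homological, `q` quantum degree). -/
structure BigradedModule (R : Type u) [CommRing R] where
  carrier : Type u
  [addCommGroup : AddCommGroup carrier]
  [module : Module R carrier]
  piece : ℤ → ℤ → AddSubgroup carrier

attribute [instance] BigradedModule.addCommGroup BigradedModule.module

/-- A bigraded module with an endomorphism `d`; see `BigradedComplex.IsComplex` for the
conditions that make it a cochain complex. -/
structure BigradedComplex (R : Type u) [CommRing R] extends BigradedModule R where
  d : carrier →ₗ[R] carrier

section Algebra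

variable {R : Type u} [CommRing R]

/-- `f` sends the piece of bidegree `(p, q)` into the piece of bidegree `(p + a, q + b)`. -/
def HasBidegree (M N : BigradedModule R) (f : M.carrier →ₗ[R] N.carrier) (a b : ℤ) : Prop :=
  ∀ p q : ℤ, ∀ x ∈ M.piece p q, f x ∈ N.piece (p + a) (q + b)

/-- `d` squares to zero, raises the homological degree by one and preserves the quantum degree. -/
def BigradedComplex.IsComplex (C : BigradedComplex R) : Prop :=
  C.d ∘ₗ C.d = 0 ∧ HasBidegree C.toBigradedModule C.toBigradedModule C.d 1 0

/-- Chain homotopy equivalence of complexes, through chain maps of bidegree `(0, 0)` and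
homotopies of bidegree `(-1, 0)`. -/
def HomotopyEquivalent (C D : BigradedComplex R) : Prop :=
  C.IsComplex ∧ D.IsComplex ∧
  ∃ (f : C.carrier →ₗ[R] D.carrier) (g : D.carrier →ₗ[R] C.carrier)
    (H : C.carrier →ₗ[R] C.carrier) (K : D.carrier →ₗ[R] D.carrier),
    HasBidegree C.toBigradedModule D.toBigradedModule f 0 0 ∧
    HasBidegree D.toBigradedModule C.toBigradedModule g 0 0 ∧
    HasBidegree C.toBigradedModule C.toBigradedModule H (-1) 0 ∧
    HasBidegree D.toBigradedModule D.toBigradedModule K (-1) 0 ∧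
    f ∘ₗ C.d = D.d ∘ₗ f ∧
    g ∘ₗ D.d = C.d ∘ₗ g ∧
    g ∘ₗ f - LinearMap.id = C.d ∘ₗ H + H ∘ₗ C.d ∧
    f ∘ₗ g - LinearMap.id = D.d ∘ₗ K + K ∘ₗ D.d

/-- The shift `t^a q^b M`: bidegrees are raised by `(a, b)`. -/
abbrev BigradedModule.shift (a b : ℤ) (M : BigradedModule R) : BigradedModule R where
  carrier := M.carrier
  piece p q := M.piece (p - a) (q - b)

/-- The shift `t^a q^b C` of a complex, with the same map `d`. -/
abbrev BigradedComplex.shift (a b : ℤ) (C : BigradedComplex R) : BigradedComplex R where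
  toBigradedModule := C.toBigradedModule.shift a b
  d := C.d

/-- A bigraded module regarded as a complex with zero differential. -/
abbrev BigradedModule.toComplex (M : BigradedModule R) : BigradedComplex R where
  toBigradedModule := M
  d := 0

/-- The two-term complex `M → N` given by `f`; its differential is `(x, y) ↦ (0, f x)`. -/
abbrev twoTerm (M N : BigradedModule R) (f : M.carrier →ₗ[R] N.carrier) : BigradedComplex R where
  carrier := M.carrier × N.carrier
  piece p q := (M.piece p q).prod (N.piece p q)
  d := LinearMap.inr R M.carrier N.carrier ∘ₗ f ∘ₗ LinearMap.fst R M.carrier N.carrier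

/-- The direct sum of two complexes. -/
abbrev BigradedComplex.sum (C D : BigradedComplex R) : BigradedComplex R where
  carrier := C.carrier × D.carrier
  piece p q := (C.piece p q).prod (D.piece p q)
  d := LinearMap.prodMap C.d D.d

/-- The direct sum of a finite family of complexes. -/
abbrev finiteSum {ι : Type} [Finite ι] (C : ι → BigradedComplex R) : BigradedComplex R where
  carrier := (i : ι) → (C i).carrier
  piece p q := AddSubgroup.pi Set.univ fun i => (C i).piece p q
  d := LinearMap.pi fun i => (C i).d ∘ₗ LinearMap.proj i

/-! ### The Frobenius algebra -/

/-- The algebra `A = R[X] / (X² - hX - t)`. -/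
abbrev FrobeniusAlgebra (h t : R) : Type u :=
  AdjoinRoot (Polynomial.X ^ 2 - Polynomial.C h * Polynomial.X - Polynomial.C t : R[X])

/-- The class of `X` in `A`. -/
noncomputable def genX (h t : R) : FrobeniusAlgebra h t :=
  AdjoinRoot.root _

/-- The elements `r + s X` of `A` of quantum degree `q`, where `1` has degree `0` and `X` has
degree `-2`. -/
noncomputable def frobeniusPiece (𝒢 : ℤ → AddSubgroup R) (h t : R) (q : ℤ) :
    AddSubgroup (FrobeniusAlgebra h t) where
  carrier := {a | ∃ r ∈ 𝒢 q, ∃ s ∈ 𝒢 (q + 2), a = r • 1 + s • genX h t}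
  zero_mem' := ⟨0, zero_mem _, 0, zero_mem _, by simp⟩
  add_mem' := by
    rintro _ _ ⟨r, hr, s, hs, rfl⟩ ⟨r', hr', s', hs', rfl⟩
    exact ⟨r + r', add_mem hr hr', s + s', add_mem hs hs', by rw [add_smul, add_smul]; abel⟩
  neg_mem' := by
    rintro _ ⟨r, hr, s, hs, rfl⟩
    exact ⟨-r, neg_mem hr, -s, neg_mem hs, by rw [neg_smul, neg_smul]; abel⟩

/-- `A` as a bigraded module in homological degree `0`. -/
noncomputable abbrev frobeniusModule (𝒢 : ℤ → AddSubgroup R) (h t : R) : BigradedModule R where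
  carrier := FrobeniusAlgebra h t
  piece p q := if p = 0 then frobeniusPiece 𝒢 h t q else ⊥

/-- The map `U : A → A`, multiplication by `2X - h`. -/
noncomputable def mapU (h t : R) : FrobeniusAlgebra h t →ₗ[R] FrobeniusAlgebra h t :=
  LinearMap.mulLeft R (2 * genX h t - algebraMap R (FrobeniusAlgebra h t) h)

/-- Structure constants of the multiplication of `A` in the basis `1, X`
(`false` stands for `1`, `true` for `X`): `mulCoeff h t i j k` is the coefficient of the basis
element `k` in the product of `i` and `j`, where `X * X = h X + t`. -/
def mulCoeff (h t : R) : Bool → Bool → Bool → R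
  | false, false, false => 1
  | false, false, true => 0
  | false, true, false => 0
  | false, true, true => 1
  | true, false, false => 0
  | true, false, true => 1
  | true, true, false => t
  | true, true, true => h

/-- Structure constants of the comultiplication of `A` in the basis `1, X`:
`comulCoeff h t i j k` is the coefficient of `j ⊗ k` in `Δ i`.  This is the comultiplication for
which `ε 1 = 0`, `ε X = 1` is the counit, that is
`Δ 1 = 1 ⊗ X + X ⊗ 1 - h (1 ⊗ 1)` and `Δ X = X ⊗ X + t (1 ⊗ 1)`. -/
def comulCoeff (h t : R) : Bool → Bool → Bool → R
  | false, false, false => -h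
  | false, false, true => 1
  | false, true, false => 1
  | false, true, true => 0
  | true, false, false => t
  | true, false, true => 0
  | true, true, false => 0
  | true, true, true => 1

end Algebra

/-! ### Link diagrams -/

/-- The combinatorial data of an oriented link diagram: its edges (arcs between consecutive
crossings), and at each crossing the edges on which the lower and the upper strand enter and leave
it, and its sign.  An edge that meets no crossing is a crossingless circle. -/
structure LinkDiagram where
  numCrossings : ℕ
  Edge : Type
  [finiteEdge : Finite Edge]
  underIn : Fin numCrossings → Edge
  underOut : Fin numCrossings → Edge
  overIn : Fin numCrossings → Edge
  overOut : Fin numCrossings → Edge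
  positive : Fin numCrossings → Bool
  in_injective : Function.Injective (Sum.elim underIn overIn)
  out_injective : Function.Injective (Sum.elim underOut overOut)
  range_in_eq_range_out :
    Set.range (Sum.elim underIn overIn) = Set.range (Sum.elim underOut overOut)

attribute [instance] LinkDiagram.finiteEdge

namespace LinkDiagram

variable (D : LinkDiagram)

/-- A choice of the `0`-smoothing (`false`) or the `1`-smoothing (`true`) at every crossing. -/
abbrev Vertex : Type := Fin D.numCrossings → Bool

/-- Two edges are joined by one of the two arcs of the smoothing `v` at some crossing.
The smoothing that respects the orientation is the `0`-smoothing of a positive crossing and the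
`1`-smoothing of a negative one; the other smoothing joins the two incoming edges to each other
and the two outgoing edges to each other. -/
def Joined (v : D.Vertex) (e e' : D.Edge) : Prop :=
  ∃ x : Fin D.numCrossings,
    if v x = !D.positive x then
      (e = D.underIn x ∧ e' = D.overOut x) ∨ (e = D.overIn x ∧ e' = D.underOut x)
    else
      (e = D.underIn x ∧ e' = D.overIn x) ∨ (e = D.underOut x ∧ e' = D.overOut x)

/-- The circles of the smoothed diagram: classes of edges under the equivalence relation generated
by `Joined`. -/
abbrev Circle (v : D.Vertex) : Type := Quot (D.Joined v)

/-- The circle of the smoothed diagram that contains the edge `e`. -/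
def circle (v : D.Vertex) (e : D.Edge) : D.Circle v := Quot.mk _ e

/-- Enhanced states: a vertex of the cube and a label `1` (`false`) or `X` (`true`) on every
circle.  For fixed `v` they are the standard basis of the tensor power of `A` over the circles. -/
abbrev State : Type := (v : D.Vertex) × (D.Circle v → Bool)

noncomputable instance (v : D.Vertex) : Fintype (D.Circle v) := Fintype.ofFinite _

noncomputable instance : Fintype D.State := Fintype.ofFinite _

/-- The number of `1`-smoothings. -/
def height (v : D.Vertex) : ℕ := (Finset.univ.filter fun x => v x = true).card

/-- The number of positive crossings. -/
def nPos : ℕ := (Finset.univ.filter fun x => D.positive x = true).card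

/-- The number of negative crossings. -/
def nNeg : ℕ := (Finset.univ.filter fun x => D.positive x = false).card

/-- Homological degree of an enhanced state. -/
def homDegree (s : D.State) : ℤ := (D.height s.1 : ℤ) - D.nNeg

/-- Quantum degree of an enhanced state: a label `1` counts `+1` and a label `X` counts `-1`. -/
noncomputable def quantumDegree (s : D.State) : ℤ :=
  (∑ c : D.Circle s.1, if s.2 c = true then (-1 : ℤ) else 1) +
    D.height s.1 + D.nPos - 2 * D.nNeg

section Complex

variable {R : Type u} [CommRing R] (h t : R)

open Classical in
/-- Matrix coefficient, from `s` to `s'`, of the map induced by the saddle at the crossing `x`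
(where the smoothing of `s'` is that of `s` with `x` switched from `0` to `1`).  In both
smoothings `underIn x` and `underOut x` lie on the two different arcs at `x`.  Labels of circles
that do not meet `x` are kept; if two circles are merged their labels are multiplied, if a circle
is split its label is comultiplied. -/
noncomputable def saddleCoeff (x : Fin D.numCrossings) (s s' : D.State) : R :=
  if ∀ e : D.Edge, D.circle s.1 e ≠ D.circle s.1 (D.underIn x) →
      D.circle s.1 e ≠ D.circle s.1 (D.underOut x) →
      s.2 (D.circle s.1 e) = s'.2 (D.circle s'.1 e) then
    if D.circle s.1 (D.underIn x) ≠ D.circle s.1 (D.underOut x) then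
      mulCoeff h t (s.2 (D.circle s.1 (D.underIn x))) (s.2 (D.circle s.1 (D.underOut x)))
        (s'.2 (D.circle s'.1 (D.underIn x)))
    else if D.circle s'.1 (D.underIn x) ≠ D.circle s'.1 (D.underOut x) then
      comulCoeff h t (s.2 (D.circle s.1 (D.underIn x)))
        (s'.2 (D.circle s'.1 (D.underIn x))) (s'.2 (D.circle s'.1 (D.underOut x)))
    else 0
  else 0

/-- The sign of the cube edge that switches the crossing `x` at the vertex `v`. -/
def edgeSign (v : D.Vertex) (x : Fin D.numCrossings) : ℤ :=
  (-1) ^ (Finset.univ.filter fun y => y < x ∧ v y = true).card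

/-- Matrix coefficient of the Khovanov differential from `s` to `s'`. -/
noncomputable def diffCoeff (s s' : D.State) : R :=
  ∑ x : Fin D.numCrossings,
    if s.1 x = false ∧ s'.1 = Function.update s.1 x true then
      (D.edgeSign s.1 x : R) * D.saddleCoeff h t x s s'
    else 0

/-- The Khovanov complex of `D` for `A = R[X] / (X² - hX - t)`: the free `R`-module on the
enhanced states, an element being given by its coordinates. -/
noncomputable abbrev khovanovComplex (𝒢 : ℤ → AddSubgroup R) : BigradedComplex R where
  carrier := D.State → R
  piece p q := AddSubgroup.pi Set.univ fun s =>
    if D.homDegree s = p then 𝒢 (q - D.quantumDegree s) else ⊥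
  d := Matrix.mulVecLin (Matrix.of fun s' s => D.diffCoeff h t s s')

end Complex

end LinkDiagram

/-- The standard diagram of the negative torus knot `T*(2, 2k+1)`: the closure of the 2-strand
braid with `2k+1` negative crossings.  The strands run upwards; `(j, false)` and `(j, true)` are
the left and the right edge below the `j`-th crossing, indices being taken modulo `2k+1`.  At each
crossing the upper strand runs from the lower right to the upper left. -/
abbrev negativeTorusKnot (k : ℕ) : LinkDiagram where
  numCrossings := 2 * k + 1
  Edge := Fin (2 * k + 1) × Bool
  underIn j := (j, false)
  underOut j := (j + 1, true)
  overIn j := (j, true)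
  overOut j := (j + 1, false)
  positive _ := false
  in_injective := by
    rintro (a | a) (b | b) hab <;> simp_all
  out_injective := by
    rintro (a | a) (b | b) hab <;> simp_all
  range_in_eq_range_out := by
    ext ⟨j, b⟩
    have hj : (j - 1) + 1 = j := sub_add_cancel j 1
    constructor
    · intro _
      cases b
      · exact ⟨Sum.inr (j - 1), by simp⟩
      · exact ⟨Sum.inl (j - 1), by simp⟩
    · intro _
      cases b
      · exact ⟨Sum.inl j, rfl⟩
      · exact ⟨Sum.inr j, rfl⟩

end Khovanov

/-! At a smoothing other than the oriented one, the circles correspond to the `0`-smoothed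
crossings: each consists of the edges lying between two cyclically consecutive ones. The chains
there are a quotient of the polynomial ring with one variable `X_i` per crossing, in which variables
on the same circle are identified and `X_i² = h X_i + t`. In this language every edge of the cube
sends a polynomial to the same polynomial up to sign (`torusDiff_polyChain`): a merge only
identifies variables, and the only splits, those into the oriented smoothing, are absorbed by
reading the coordinates there through the comultiplication.

Let `v_j` be the smoothing `1…10…0` with `j` ones, and put `κ_j = ∏_{j < i ≤ 2k} (X_i - X_{i+1})`
with `X_{2k+1} = X_0`. A merge at a crossing `i > j` kills the factor `X_i - X_{i+1}`, so on the
copy `κ_j · A` of `A` at `v_j` only the edge to `v_{j+1}` survives. There `κ_j = (X_{j+1} - X_{j+2})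
κ_{j+1}` and `X_{j+1} = X_0`. The quadratic relations give `(X_i - X_{i+1})(X_i + X_{i+1} - h) = 0`,
so `X_{j+2}` moves through the factors of `κ_{j+1}`, is replaced by its conjugate under `X ↦ h - X`
once per factor, and ends as `X_0` or `h - X_0` according to parity. Hence the differential from
`κ_j A` to `κ_{j+1} A` is `2X - h` for even `j` and `0` for odd `j < 2k` (`torusDiff_minimalChain`).
The pairs `j = 2k - 2i`, `j + 1` are the two-term summands; the chains `a ⊗ 1` at the oriented
smoothing are the last summand.

The rest is contracted by discrete Morse theory (`homotopyEquivalent_of_matching`). After the first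
`0` of a smoothing, look for the first crossing that is not a `0` with label `X`. If it is a `0`
labelled `1`, merging that circle into the next is multiplication by the unit, hence an invertible
coefficient; this pairs the state with one having a `1` there. The single circle at `v_{2k}` is
paired with the term `a ⊗ X` of its comultiplication. A lexicographic rank shows that the matching
is acyclic (`Matched.vertexRank_lt`). The unmatched states are the `v_j` with `j < 2k` and all
circles but the first labelled `X`, and the oriented smoothing with right label `1`
(`unmatched_cases`). At these states the chains `κ_j a` and `a ⊗ 1` have exactly the coordinates of
`a` (`polyCoord_kernelPoly`), so they form a subcomplex that projects isomorphically to the span of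
the unmatched states. -/

namespace Khovanov

/-! ### Homotopy equivalences from contractions -/

section Contraction

variable {R : Type u} [CommRing R]

theorem HasBidegree.comp {L M N : BigradedModule R} {f : L.carrier →ₗ[R] M.carrier}
    {g : M.carrier →ₗ[R] N.carrier} {a b a' b' a'' b'' : ℤ} (hg : HasBidegree M N g a' b')
    (hf : HasBidegree L M f a b) (ha : a + a' = a'') (hb : b + b' = b'') :
    HasBidegree L N (g ∘ₗ f) a'' b'' := by
  intro p q x hx
  have := hg _ _ _ (hf p q x hx)
  rwa [add_assoc, add_assoc, ha, hb] at this

theorem HasBidegree.add {M N : BigradedModule R} {f g : M.carrier →ₗ[R] N.carrier} {a b : ℤ}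
    (hf : HasBidegree M N f a b) (hg : HasBidegree M N g a b) : HasBidegree M N (f + g) a b :=
  fun p q x hx => add_mem (hf p q x hx) (hg p q x hx)

/-- A chain map `g` with a left inverse `π` and a homotopy `H` that contracts a complement of its
image is a homotopy equivalence. -/
theorem homotopyEquivalent_of_contraction {C D : BigradedComplex R} (hC : C.IsComplex)
    (g : D.carrier →ₗ[R] C.carrier) (π : C.carrier →ₗ[R] D.carrier)
    (H : C.carrier →ₗ[R] C.carrier)
    (hg : HasBidegree D.toBigradedModule C.toBigradedModule g 0 0)
    (hπ : HasBidegree C.toBigradedModule D.toBigradedModule π 0 0)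
    (hH : HasBidegree C.toBigradedModule C.toBigradedModule H (-1) 0)
    (hgd : ∀ x, g (D.d x) = C.d (g x)) (hπg : ∀ x, π (g x) = x) (hπH : ∀ x, π (H x) = 0)
    (hHg : ∀ x, H (g x) = 0)
    (hHH : ∀ x, H (H x) = 0) (hHdH : ∀ x, H (C.d (H x)) = -H x)
    (hker : ∀ x, H x = 0 → H (C.d x) = 0 → x = g (π x)) :
    HomotopyEquivalent C D := by
  have hdd : ∀ x, C.d (C.d x) = 0 := fun x => LinearMap.congr_fun hC.1 x
  have hinj : ∀ x y, g x = g y → x = y := fun x y hxy => by rw [← hπg x, hxy, hπg]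
  have hdD : D.d = π ∘ₗ C.d ∘ₗ g := by
    ext x; simp [← hgd, hπg]
  -- The vector `x + dHx + Hdx` is killed by `H` and by `Hd`, because `HdH = -H`, `HH = 0` and `dd =
  -- 0`; so `hker` places it in the image of `g`. The term `Hdx` is invisible to `π`.
  have hgf : ∀ x, g (π (x + C.d (H x))) = x + C.d (H x) + H (C.d x) := by
    intro x
    have key := hker (x + C.d (H x) + H (C.d x)) (by simp [hHdH, hHH])
      (by simp [hdd, hHdH])
    rw [key]; simp [hπH]
  -- The projection `π` need not be a chain map; its perturbation `π(1 + dH)` is one. Since `Hg =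
  -- 0`, it is still a strict left inverse of `g`, so the second homotopy is zero.
  refine ⟨hC, ⟨?_, ?_⟩, π ∘ₗ (LinearMap.id + C.d ∘ₗ H), g, H, 0, ?_, hg, hH, ?_, ?_, ?_, ?_, ?_⟩
  · ext x
    apply hinj
    simp [hgd, hdd]
  · rw [hdD]
    exact hπ.comp (hC.2.comp hg (zero_add _) (zero_add _)) (add_zero _) (add_zero _)
  · refine hπ.comp (HasBidegree.add ?_ (hC.2.comp hH (a'' := 0) (b'' := 0) (by simp) (by simp)))
      (a := 0) (b := 0) (by simp) (by simp)
    intro p q x hx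
    simpa using hx
  · intro p q x hx
    simp
  · ext x
    apply hinj
    simp only [LinearMap.comp_apply, LinearMap.add_apply, LinearMap.id_apply, hgd, hgf]
    simp [hdd]
  · ext x; simp [hgd]
  · ext x
    simp only [LinearMap.comp_apply, LinearMap.add_apply, LinearMap.id_apply, LinearMap.sub_apply,
      hgf]
    abel
  · ext x
    simp [hHg, hπg]

end Contraction

/-! ### Algebraic discrete Morse theory -/

section Matching

variable {R : Type u} [CommRing R] {S : Type} [Fintype S]

/-- The complex of functions on a finite set of generators of bidegrees `(hd s, qd s)`, with
differential given by the matrix coefficients `c s s'` from `s` to `s'`. -/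
noncomputable abbrev basedComplex (𝒢 : ℤ → AddSubgroup R) (hd qd : S → ℤ) (c : S → S → R) :
    BigradedComplex R where
  carrier := S → R
  piece p q := AddSubgroup.pi Set.univ fun s => if hd s = p then 𝒢 (q - qd s) else ⊥
  d := Matrix.mulVecLin (Matrix.of fun s' s => c s s')

theorem mem_basedComplex_piece {𝒢 : ℤ → AddSubgroup R} {hd qd : S → ℤ} {c : S → S → R}
    {p q : ℤ} {x : S → R} : x ∈ (basedComplex 𝒢 hd qd c).piece p q ↔
      ∀ s, (hd s = p → x s ∈ 𝒢 (q - qd s)) ∧ (hd s ≠ p → x s = 0) := by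
  simp only [AddSubgroup.mem_pi, Set.mem_univ, forall_true_left]
  refine forall_congr' fun s => ?_
  by_cases hs : hd s = p <;> simp [hs]

/-- Reduces a bidegree condition on a linear map to its nonzero matrix coefficients. -/
theorem hasBidegree_mulVecLin (𝒢 : ℤ → AddSubgroup R) [SetLike.GradedMonoid 𝒢] (hd qd : S → ℤ)
    (c c' : S → S → R) (a b : ℤ)
    (hc : ∀ s s', c' s s' ≠ 0 → hd s' = hd s + a ∧ c' s s' ∈ 𝒢 (qd s + b - qd s')) :
    HasBidegree (basedComplex 𝒢 hd qd c).toBigradedModule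
      (basedComplex 𝒢 hd qd c).toBigradedModule
      (Matrix.mulVecLin (Matrix.of fun s' s => c' s s')) a b := by
  intro p q x hx
  rw [mem_basedComplex_piece] at hx ⊢
  intro s'
  simp only [Matrix.mulVecLin_apply, Matrix.mulVec, dotProduct, Matrix.of_apply]
  constructor
  · intro hs'
    refine sum_mem fun s _ => ?_
    by_cases h0 : c' s s' = 0
    · simp [h0]
    · obtain ⟨h1, h2⟩ := hc s s' h0
      have := SetLike.mul_mem_graded h2 ((hx s).1 (by omega))
      convert this using 2
      ring
  · intro hs'
    refine Finset.sum_eq_zero fun s _ => ?_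
    by_cases h0 : c' s s' = 0
    · simp [h0]
    · obtain ⟨h1, h2⟩ := hc s s' h0
      rw [(hx s).2 (by omega), mul_zero]

variable (M : S → S → Prop) (c : S → S → R)

open Classical in
/-- The projection to the generators that are targets of the matching `M`. -/
noncomputable def targetProj : (S → R) →ₗ[R] (S → R) :=
  Matrix.mulVecLin (Matrix.of fun s' s => if s = s' ∧ ∃ u, M u s then 1 else 0)

open Classical in
/-- The map sending the target of each matched pair to minus the source, with the sign of the
pair. -/
noncomputable def matchLift : (S → R) →ₗ[R] (S → R) :=
  Matrix.mulVecLin (Matrix.of fun u s => if M u s then -c u s else 0)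

/-- The failure of `matchLift` to be a contraction on the targets. -/
noncomputable def matchDefect : (S → R) →ₗ[R] (S → R) :=
  targetProj M +
    targetProj M ∘ₗ Matrix.mulVecLin (Matrix.of fun s' s => c s s') ∘ₗ matchLift M c

/-- The contraction of the matched generators: a finite geometric series in `matchDefect`. -/
noncomputable def matchHomotopy (N : ℕ) : (S → R) →ₗ[R] (S → R) :=
  matchLift M c ∘ₗ (∑ m ∈ Finset.range N, matchDefect M c ^ m) ∘ₗ targetProj M

variable {M c}

open Classical in
theorem targetProj_apply (x : S → R) (s : S) :
    targetProj M x s = if ∃ u, M u s then x s else 0 := by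
  simp only [targetProj, Matrix.mulVecLin_apply, Matrix.mulVec, dotProduct, Matrix.of_apply]
  rw [Finset.sum_eq_single s]
  · simp
  · intro b _ hb
    simp [hb]
  · simp

theorem targetProj_of {x : S → R} {u s : S} (hus : M u s) : targetProj M x s = x s := by
  rw [targetProj_apply, if_pos ⟨u, hus⟩]

theorem targetProj_of_not {x : S → R} {s : S} (hs : ¬∃ u, M u s) : targetProj M x s = 0 := by
  rw [targetProj_apply, if_neg hs]

theorem targetProj_targetProj (x : S → R) : targetProj M (targetProj M x) = targetProj M x := by
  ext s
  by_cases hs : ∃ u, M u s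
  · obtain ⟨u, hu⟩ := hs
    rw [targetProj_of hu]
  · rw [targetProj_of_not hs, targetProj_of_not hs]

theorem matchLift_of (hM : ∀ u s s', M u s → M u s' → s = s') {x : S → R} {u s : S}
    (hus : M u s) : matchLift M c x u = -c u s * x s := by
  simp only [matchLift, Matrix.mulVecLin_apply, Matrix.mulVec, dotProduct, Matrix.of_apply]
  rw [Finset.sum_eq_single s]
  · simp [hus]
  · intro b _ hb
    rw [if_neg, zero_mul]
    exact fun h => hb (hM _ _ _ h hus)
  · simp

theorem matchLift_of_not {x : S → R} {u : S} (hu : ¬∃ s, M u s) : matchLift M c x u = 0 := by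
  simp only [matchLift, Matrix.mulVecLin_apply, Matrix.mulVec, dotProduct, Matrix.of_apply]
  refine Finset.sum_eq_zero fun s _ => ?_
  rw [if_neg fun h => hu ⟨s, h⟩, zero_mul]

theorem matchLift_targetProj (hM : ∀ u s s', M u s → M u s' → s = s') (x : S → R) :
    matchLift M c (targetProj M x) = matchLift M c x := by
  ext u
  by_cases hu : ∃ s, M u s
  · obtain ⟨s, hs⟩ := hu
    rw [matchLift_of hM hs, matchLift_of hM hs, targetProj_of hs]
  · rw [matchLift_of_not hu, matchLift_of_not hu]

theorem targetProj_matchLift (hMM : ∀ u s w, M u s → ¬M s w) (x : S → R) :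
    targetProj M (matchLift M c x) = 0 := by
  ext s
  by_cases hs : ∃ u, M u s
  · obtain ⟨u, hu⟩ := hs
    rw [targetProj_of hu, matchLift_of_not fun ⟨w, hw⟩ => hMM _ _ _ hu hw, Pi.zero_apply]
  · rw [targetProj_of_not hs, Pi.zero_apply]

theorem matchDefect_apply (x : S → R) : matchDefect M c x = targetProj M x +
    targetProj M (Matrix.mulVecLin (Matrix.of fun s' s => c s s') (matchLift M c x)) := rfl

theorem targetProj_matchDefect (x : S → R) :
    targetProj M (matchDefect M c x) = matchDefect M c x := by
  rw [matchDefect_apply, map_add, targetProj_targetProj, targetProj_targetProj]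

/-- At a target `s` with source `u`, the diagonal contribution of `d ∘ matchLift` is `-(c u s)² x s
= -x s` and cancels the projection. What remains comes from targets of strictly smaller rank, so the
defect pushes the support up by one step of the rank filtration and is nilpotent. -/
theorem matchDefect_vanish (hM : ∀ u s s', M u s → M u s' → s = s')
    (hM' : ∀ u u' s, M u s → M u' s → u = u') (hunit : ∀ u s, M u s → c u s * c u s = 1)
    (r : S → ℕ) (hr : ∀ u s w s', M u s → M w s' → s ≠ s' → c u s' ≠ 0 → r s < r s')
    (m : ℕ) (x : S → R) (hx : ∀ s, r s < m → x s = 0) (s : S) (hs : r s < m + 1) :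
    matchDefect M c x s = 0 := by
  by_cases hV : ∃ u, M u s
  · obtain ⟨u, hu⟩ := hV
    rw [matchDefect_apply, Pi.add_apply, targetProj_of hu, targetProj_of hu]
    simp only [Matrix.mulVecLin_apply, Matrix.mulVec, dotProduct, Matrix.of_apply]
    rw [Finset.sum_eq_single u]
    · rw [matchLift_of hM hu]
      linear_combination (-x s) * hunit u s hu
    · intro w _ hw
      by_cases hwU : ∃ s', M w s'
      · obtain ⟨s', hs'⟩ := hwU
        rw [matchLift_of hM hs']
        by_cases h0 : c w s = 0
        · rw [h0, zero_mul]
        · have hne : s' ≠ s := fun h => hw (hM' _ _ _ (h ▸ hs') hu)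
          have := hr w s' u s hs' hu hne h0
          rw [hx s' (by omega), mul_zero, mul_zero]
      · rw [matchLift_of_not hwU, mul_zero]
    · simp
  · rw [matchDefect_apply, Pi.add_apply, targetProj_of_not hV, targetProj_of_not hV, add_zero]

theorem matchDefect_pow_eq_zero (hM : ∀ u s s', M u s → M u s' → s = s')
    (hM' : ∀ u u' s, M u s → M u' s → u = u') (hunit : ∀ u s, M u s → c u s * c u s = 1)
    (r : S → ℕ) (hr : ∀ u s w s', M u s → M w s' → s ≠ s' → c u s' ≠ 0 → r s < r s')
    (N : ℕ) (hN : ∀ s, r s < N) : matchDefect M c ^ N = 0 := by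
  have key : ∀ (m : ℕ) (x : S → R) (s : S), r s < m → (matchDefect M c ^ m) x s = 0 := by
    intro m
    induction m with
    | zero => intro x s hs; omega
    | succ m ih =>
      intro x s hs
      rw [pow_succ', Module.End.mul_apply]
      exact matchDefect_vanish hM hM' hunit r hr m _ (ih x) s hs
  ext1 x
  ext1 s
  exact key N x s (hN s)

theorem HasBidegree.sum {M N : BigradedModule R} {ι : Type*} (I : Finset ι)
    (f : ι → M.carrier →ₗ[R] N.carrier) {a b : ℤ}
    (hf : ∀ i ∈ I, HasBidegree M N (f i) a b) : HasBidegree M N (∑ i ∈ I, f i) a b := by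
  intro p q x hx
  rw [LinearMap.sum_apply]
  exact sum_mem fun i hi => hf i hi p q x hx

/-- Algebraic discrete Morse theory, in the case where the Morse complex is a subcomplex: a complex
with a basis and an acyclic matching `M` is homotopy equivalent to a subcomplex `g` that projects
isomorphically to the span of the unmatched generators. -/
theorem homotopyEquivalent_of_matching (𝒢 : ℤ → AddSubgroup R) [SetLike.GradedMonoid 𝒢]
    (hd qd : S → ℤ) (hC : (basedComplex 𝒢 hd qd c).IsComplex)
    (hM : ∀ u s s', M u s → M u s' → s = s') (hM' : ∀ u u' s, M u s → M u' s → u = u')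
    (hMM : ∀ u s w, M u s → ¬M s w) (hunit : ∀ u s, M u s → c u s = 1 ∨ c u s = -1)
    (hdeg : ∀ u s, M u s → hd s = hd u + 1 ∧ qd s = qd u)
    (r : S → ℕ) (hr : ∀ u s w s', M u s → M w s' → s ≠ s' → c u s' ≠ 0 → r s < r s')
    {D : BigradedComplex R} (g : D.carrier →ₗ[R] (S → R)) (π : (S → R) →ₗ[R] D.carrier)
    (hg : HasBidegree D.toBigradedModule (basedComplex 𝒢 hd qd c).toBigradedModule g 0 0)
    (hπ : HasBidegree (basedComplex 𝒢 hd qd c).toBigradedModule D.toBigradedModule π 0 0)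
    (hgd : ∀ x, g (D.d x) = (basedComplex 𝒢 hd qd c).d (g x)) (hπg : ∀ x, π (g x) = x)
    (hgM : ∀ x u s, M u s → g x s = 0)
    (hπM : ∀ y : S → R, (∀ s, (∀ w, ¬M s w) → y s = 0) → π y = 0)
    (hdec : ∀ y : S → R, (∀ u s, M u s → y s = 0) → π y = 0 → ∀ s, (∀ w, ¬M s w) → y s = 0) :
    HomotopyEquivalent (basedComplex 𝒢 hd qd c) D := by
  classical
  have hunit' : ∀ u s, M u s → c u s * c u s = 1 := by
    intro u s hus
    rcases hunit u s hus with h | h <;> simp [h]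
  -- Any bound on the ranks serves as the length of the geometric series.
  obtain ⟨N, hN⟩ : ∃ N, ∀ s, r s < N :=
    ⟨(∑ s, r s) + 1, fun s => Nat.lt_succ_of_le
      (Finset.single_le_sum (f := r) (fun _ _ => Nat.zero_le _) (Finset.mem_univ s))⟩
  have hnil := matchDefect_pow_eq_zero hM hM' hunit' r hr N hN
  have hone : HasBidegree (basedComplex 𝒢 hd qd c).toBigradedModule
      (basedComplex 𝒢 hd qd c).toBigradedModule (targetProj M) 0 0 := by
    refine hasBidegree_mulVecLin 𝒢 hd qd c _ 0 0 fun s s' hss => ?_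
    rw [ne_eq, ite_eq_right_iff, Classical.not_imp] at hss
    obtain ⟨⟨rfl, hs⟩, -⟩ := hss
    rw [if_pos ⟨rfl, hs⟩]
    simpa using SetLike.one_mem_graded 𝒢
  have hlift : HasBidegree (basedComplex 𝒢 hd qd c).toBigradedModule
      (basedComplex 𝒢 hd qd c).toBigradedModule (matchLift M c) (-1) 0 := by
    refine hasBidegree_mulVecLin 𝒢 hd qd c _ (-1) 0 fun s s' hss => ?_
    rw [ne_eq, ite_eq_right_iff, Classical.not_imp] at hss
    have hM := hss.1
    rw [if_pos hM]
    obtain ⟨h1, h2⟩ := hdeg _ _ hM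
    refine ⟨by omega, ?_⟩
    rw [h2, add_zero, sub_self]
    have h1 := SetLike.one_mem_graded 𝒢
    rcases hunit _ _ hM with h | h <;> rw [h]
    · exact neg_mem h1
    · simpa using h1
  have hdefect : HasBidegree (basedComplex 𝒢 hd qd c).toBigradedModule
      (basedComplex 𝒢 hd qd c).toBigradedModule (matchDefect M c) 0 0 :=
    hone.add (hone.comp (hC.2.comp hlift (neg_add_cancel 1) (add_zero 0)) (add_zero 0)
      (add_zero 0))
  have hpow : ∀ m : ℕ, HasBidegree (basedComplex 𝒢 hd qd c).toBigradedModule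
      (basedComplex 𝒢 hd qd c).toBigradedModule (matchDefect M c ^ m) 0 0 := by
    intro m
    induction m with
    | zero => intro p q x hx; simpa using hx
    | succ m ih => exact ih.comp hdefect (add_zero 0) (add_zero 0)
  set T : (S → R) →ₗ[R] (S → R) := ∑ m ∈ Finset.range N, matchDefect M c ^ m with hT
  set d : (S → R) →ₗ[R] (S → R) := Matrix.mulVecLin (Matrix.of fun s' s => c s s')
  -- By nilpotence `T` is the two-sided inverse of `1 - matchDefect`; this identity and the next
  -- express the two sides.
  have hgeom : ∀ x, matchDefect M c (T x) = T x - x := by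
    intro x
    have := LinearMap.congr_fun (mul_geom_sum (matchDefect M c) N) x
    rw [hnil, zero_sub, sub_mul, one_mul] at this
    rw [LinearMap.sub_apply, LinearMap.neg_apply, Module.End.mul_apply, Module.End.one_apply] at this
    rw [hT, ← sub_eq_zero]
    rw [← sub_eq_zero] at this
    rw [← this]
    abel
  have hgeom' : ∀ x, T (matchDefect M c x) = T x - x := by
    intro x
    have := LinearMap.congr_fun (geom_sum_mul (matchDefect M c) N) x
    rw [hnil, zero_sub, mul_sub, mul_one] at this
    rw [LinearMap.sub_apply, LinearMap.neg_apply, Module.End.mul_apply, Module.End.one_apply] at this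
    rw [hT, ← sub_eq_zero]
    rw [← sub_eq_zero] at this
    rw [← this]
    abel
  have hPT : ∀ x, targetProj M (T (targetProj M x)) = T (targetProj M x) := by
    intro x
    have := hgeom (targetProj M x)
    rw [eq_sub_iff_add_eq] at this
    rw [← this, map_add, targetProj_matchDefect, targetProj_targetProj]
  have hHd : ∀ x, matchHomotopy M c N x = matchLift M c (T (targetProj M x)) := fun x => rfl
  have hPM : ∀ x, targetProj M (matchLift M c x) = 0 := targetProj_matchLift hMM
  have hPdM : ∀ x, targetProj M (d (matchLift M c x)) = matchDefect M c x - targetProj M x := by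
    intro x
    rw [matchDefect_apply, add_sub_cancel_left]
  -- On the span of the targets `matchLift` is injective, its coefficients being units, and `T` is
  -- invertible.
  have hzero : ∀ x, matchHomotopy M c N x = 0 → targetProj M x = 0 := by
    intro x hx
    have h1 : targetProj M (T (targetProj M x)) = 0 := by
      ext s
      by_cases hs : ∃ u, M u s
      · obtain ⟨u, hu⟩ := hs
        have h2 := congrFun hx u
        rw [hHd, matchLift_of hM hu, Pi.zero_apply] at h2
        rw [targetProj_of hu, Pi.zero_apply]
        linear_combination (-c u s) * h2 - (T (targetProj M x) s) * hunit' u s hu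
      · rw [targetProj_of_not hs, Pi.zero_apply]
    rw [hPT] at h1
    have h2 := hgeom (targetProj M x)
    rw [h1, map_zero, zero_sub, eq_comm, neg_eq_zero] at h2
    exact h2
  refine homotopyEquivalent_of_contraction hC g π (matchHomotopy M c N) hg hπ ?_ hgd hπg
    ?_ ?_ ?_ ?_ ?_
  · exact hlift.comp (HasBidegree.comp (HasBidegree.sum _ _ fun m _ => hpow m) hone (add_zero 0)
      (add_zero 0)) (zero_add _) (add_zero 0)
  · intro x
    refine hπM _ fun s hs => ?_
    rw [hHd, matchLift_of_not fun ⟨w, hw⟩ => hs w hw]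
  · intro x
    have : targetProj M (g x) = 0 := by
      ext s
      by_cases hs : ∃ u, M u s
      · obtain ⟨u, hu⟩ := hs
        rw [targetProj_of hu, hgM _ _ _ hu, Pi.zero_apply]
      · rw [targetProj_of_not hs, Pi.zero_apply]
    rw [hHd, this, map_zero, map_zero]
  · intro x
    rw [hHd, hHd x, hPM, map_zero, map_zero]
  · intro x
    change matchHomotopy M c N (d (matchHomotopy M c N x)) = _
    -- With `L`, `P`, `F` for lift, projection and defect, `PdL = F - P`. Hence `HdH = L T (F - P) T
    -- P = L (T F - T) T P = -L T P = -H`.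
    rw [hHd, hHd x, hPdM, map_sub, hgeom', hPT, ← map_neg]
    rw [sub_sub_cancel_left, map_neg]
  · intro x h1 h2
    have h3 := hzero _ h1
    have h4 := hzero _ h2
    -- The difference `w` vanishes at the targets, and by `hdec` at the unmatched generators, so it
    -- lives on the sources. There it has the form `matchLift y`; as `dw` has no target component,
    -- `y` is fixed by the nilpotent defect and is zero.
    set w := x - g (π x) with hw
    have hPg : ∀ z, targetProj M (g z) = 0 := by
      intro z
      ext s
      by_cases hs : ∃ u, M u s
      · obtain ⟨u, hu⟩ := hs
        rw [targetProj_of hu, hgM _ _ _ hu, Pi.zero_apply]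
      · rw [targetProj_of_not hs, Pi.zero_apply]
    have hPw : targetProj M w = 0 := by rw [hw, map_sub, h3, hPg, sub_zero]
    have hPdw : targetProj M (d w) = 0 := by
      rw [hw, map_sub, map_sub]
      have := hgd (π x)
      change _ = d (g (π x)) at this
      rw [← this, hPg, sub_zero]
      exact h4
    have hπw : π w = 0 := by rw [hw, map_sub, hπg, sub_self]
    have hwV : ∀ u s, M u s → w s = 0 := by
      intro u s hus
      rw [← targetProj_of (x := w) hus, hPw, Pi.zero_apply]
    have hwU := hdec w hwV hπw
    -- The preimage of `w` under `matchLift`: a coefficient `±1` is its own inverse.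
    let y : S → R := fun s => if hs : ∃ u, M u s then -c hs.choose s * w hs.choose else 0
    have hy : ∀ u s, M u s → y s = -c u s * w u := by
      intro u s hus
      have hs : ∃ u, M u s := ⟨u, hus⟩
      have := hM' _ _ _ hs.choose_spec hus
      simp only [y, dif_pos hs, this]
    have hwy : w = matchLift M c y := by
      ext u
      by_cases hu : ∃ s, M u s
      · obtain ⟨s, hs⟩ := hu
        rw [matchLift_of hM hs, hy u s hs]
        linear_combination (-w u) * hunit' u s hs
      · rw [matchLift_of_not hu, hwU u fun v hv => hu ⟨v, hv⟩]
    have hPy : targetProj M y = y := by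
      ext s
      by_cases hs : ∃ u, M u s
      · obtain ⟨u, hu⟩ := hs
        rw [targetProj_of hu]
      · rw [targetProj_of_not hs]
        simp only [y, dif_neg hs]
    rw [hwy, hPdM, hPy, sub_eq_zero] at hPdw
    have hy0 : y = 0 := by
      have := hgeom' y
      rw [hPdw, eq_comm, sub_eq_self] at this
      exact this
    rw [hy0, map_zero] at hwy
    rwa [← sub_eq_zero]

end Matching

/-! ### Cyclic blocks of a 0-1 sequence -/

section NextZero

variable {n : ℕ} [NeZero n]

open Classical in
/-- The first position `z` at or after `i`, cyclically, with `v z = false`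
(`i` itself if there is none). -/
noncomputable def nextZero (v : Fin n → Bool) (i : Fin n) : Fin n :=
  if hm : ∃ m : ℕ, v (i + Fin.ofNat n m) = false then i + Fin.ofNat n (Nat.find hm) else i

theorem exists_add_ofNat (i z : Fin n) : ∃ m : ℕ, i + Fin.ofNat n m = z := by
  refine ⟨(z - i).val, ?_⟩
  rw [Fin.ofNat_val_eq_self]
  abel

theorem nextZero_of_false {v : Fin n → Bool} {i : Fin n} (hi : v i = false) :
    nextZero v i = i := by
  classical
  have hm : ∃ m : ℕ, v (i + Fin.ofNat n m) = false := ⟨0, by simpa [Fin.ofNat] using hi⟩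
  have h0 : Nat.find hm = 0 := by
    rw [Nat.find_eq_zero]
    simpa [Fin.ofNat] using hi
  rw [nextZero, dif_pos hm, h0]
  simp [Fin.ofNat]

theorem ofNat_succ (m : ℕ) : Fin.ofNat n (m + 1) = 1 + Fin.ofNat n m := by
  ext
  simp [Fin.ofNat, Fin.val_add, add_comm]

theorem nextZero_of_true {v : Fin n → Bool} (hv : ∃ z, v z = false) {i : Fin n}
    (hi : v i = true) : nextZero v i = nextZero v (i + 1) := by
  classical
  have hm : ∀ i, ∃ m : ℕ, v (i + Fin.ofNat n m) = false := by
    intro i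
    obtain ⟨z, hz⟩ := hv
    obtain ⟨m, hm⟩ := exists_add_ofNat i z
    exact ⟨m, by rw [hm, hz]⟩
  have h0 : Nat.find (hm i) = Nat.find (hm (i + 1)) + 1 := by
    rw [Nat.find_eq_iff]
    constructor
    · rw [ofNat_succ, ← add_assoc]
      exact Nat.find_spec (hm (i + 1))
    · intro m hlt
      cases m with
      | zero => simp [Fin.ofNat, hi]
      | succ m =>
        rw [ofNat_succ, ← add_assoc]
        exact Nat.find_min (hm (i + 1)) (by omega)
  rw [nextZero, dif_pos (hm i), nextZero, dif_pos (hm (i + 1)), h0, ofNat_succ, add_assoc]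

/-- Induction along the positions from `i` to `nextZero v i`. -/
theorem nextZero_induction {v : Fin n → Bool} (hv : ∃ z, v z = false) {p : Fin n → Prop}
    (hzero : ∀ i, v i = false → p i) (hstep : ∀ i, v i = true → p (i + 1) → p i) (i : Fin n) :
    p i := by
  have key : ∀ (m : ℕ) (i : Fin n), v (i + Fin.ofNat n m) = false → p i := by
    intro m
    induction m with
    | zero => intro i hi; exact hzero i (by simpa [Fin.ofNat] using hi)
    | succ m ih =>
      intro i hi
      rw [ofNat_succ, ← add_assoc] at hi
      cases h : v i
      · exact hzero i h
      · exact hstep i h (ih _ hi)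
  obtain ⟨z, hz⟩ := hv
  obtain ⟨m, hm⟩ := exists_add_ofNat i z
  exact key m i (by rw [hm, hz])

theorem nextZero_spec {v : Fin n → Bool} (hv : ∃ z, v z = false) (i : Fin n) :
    v (nextZero v i) = false := by
  refine nextZero_induction hv (p := fun i => v (nextZero v i) = false) ?_ ?_ i
  · intro i hi; rwa [nextZero_of_false hi]
  · intro i hi h; rwa [nextZero_of_true hv hi]

theorem nextZero_mem {v : Fin n → Bool} (hv : ∃ z, v z = false) {p : Fin n → Prop}
    (hp : ∀ i, v i = true → p i → p (i + 1)) (i : Fin n) (hi : p i) : p (nextZero v i) := by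
  revert hi
  refine nextZero_induction hv (p := fun i => p i → p (nextZero v i)) ?_ ?_ i
  · intro i hi; rw [nextZero_of_false hi]; exact id
  · intro i hi h h'; rw [nextZero_of_true hv hi]; exact h (hp i hi h')

/-- The recursion determines `nextZero` as soon as there is a zero; this is how its values are
computed after a change of `v`. -/
theorem eq_nextZero {v : Fin n → Bool} (hv : ∃ z, v z = false) {f : Fin n → Fin n}
    (h1 : ∀ i, v i = false → f i = i) (h2 : ∀ i, v i = true → f i = f (i + 1)) (i : Fin n) :
    f i = nextZero v i := by
  refine nextZero_induction hv (p := fun i => f i = nextZero v i) ?_ ?_ i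
  · intro i hi; rw [nextZero_of_false hi, h1 i hi]
  · intro i hi h; rw [nextZero_of_true hv hi, h2 i hi, h]

/-- Turning the zero at `x` into a one joins the block that ends at `x` to the block that follows
it. This is the combinatorics of a merge of two circles. -/
theorem nextZero_update {v : Fin n → Bool} {x : Fin n}
    (hv : ∃ z, Function.update v x true z = false) (i : Fin n) :
    nextZero (Function.update v x true) i =
      if nextZero v i = x then nextZero v (x + 1) else nextZero v i := by
  have hv' : ∃ z, v z = false := by
    obtain ⟨z, hz⟩ := hv
    refine ⟨z, ?_⟩
    by_cases h : z = x
    · subst h; simp at hz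
    · rwa [Function.update_of_ne h] at hz
  symm
  refine eq_nextZero (f := fun i => if nextZero v i = x then nextZero v (x + 1) else nextZero v i)
    hv ?_ ?_ i
  · intro i hi
    by_cases h : i = x
    · subst h; simp at hi
    · rw [Function.update_of_ne h] at hi
      simp only [nextZero_of_false hi, if_neg h]
  · intro i hi
    by_cases h : i = x
    · subst h
      by_cases h' : v i = false
      · simp only [nextZero_of_false h', if_true, ite_self]
      · simp only [nextZero_of_true hv' (Bool.eq_true_of_not_eq_false h')]
    · rw [Function.update_of_ne h] at hi
      simp only [nextZero_of_true hv' hi]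

/-- Otherwise `x` would be the only zero, and none would survive the update. So the saddle at `x`
joins two different circles unless it leads to the oriented smoothing. -/
theorem nextZero_succ_ne {v : Fin n → Bool} {x : Fin n} (hx : v x = false)
    (hv : ∃ z, Function.update v x true z = false) : nextZero v (x + 1) ≠ x := by
  intro h
  have h1 := nextZero_spec hv x
  rw [nextZero_update hv, nextZero_of_false hx, if_pos rfl, h] at h1
  simp at h1

/-- More ones give coarser blocks: the block of `i` in `w` is already determined by the end of its
block in `v`. -/
theorem nextZero_congr_of_le {v w : Fin n → Bool} (hw : ∃ z, w z = false)
    (hvw : ∀ i, v i = true → w i = true) {i j : Fin n} (hij : nextZero v i = nextZero v j) :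
    nextZero w i = nextZero w j := by
  have hv : ∃ z, v z = false := by
    obtain ⟨z, hz⟩ := hw
    refine ⟨z, ?_⟩
    cases h : v z
    · rfl
    · rw [hvw z h] at hz; exact hz
  have key : ∀ i, nextZero w i = nextZero w (nextZero v i) := by
    intro i
    refine nextZero_induction hv (p := fun i => nextZero w i = nextZero w (nextZero v i)) ?_ ?_ i
    · intro i hi; rw [nextZero_of_false hi]
    · intro i hi h; rw [nextZero_of_true hw (hvw i hi), nextZero_of_true hv hi, h]
  rw [key i, key j, hij]

end NextZero

/-! ### Circles and enhanced states of the torus knot diagram -/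

section TorusStates

variable {k : ℕ}

/-- States of the standard diagram of the negative torus knot `T*(2, 2k+1)`. -/
abbrev TorusState (k : ℕ) : Type := (negativeTorusKnot k).State

noncomputable instance instFintypeTorusCircle (v : (negativeTorusKnot k).Vertex) :
    Fintype ((negativeTorusKnot k).Circle v) :=
  LinkDiagram.instFintypeCircle (negativeTorusKnot k) v

noncomputable instance instFintypeTorusState : Fintype (TorusState k) :=
  LinkDiagram.instFintypeState (negativeTorusKnot k)

/-- The label of a state on the circle through the edge `(i, b)`. -/
def edgeLabel (s : TorusState k) (i : Fin (2 * k + 1)) (b : Bool) : Bool :=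
  s.2 ((negativeTorusKnot k).circle s.1 (i, b))

/-- The label of a state on the circle through the left edge `(i, false)`. -/
abbrev label (s : TorusState k) (i : Fin (2 * k + 1)) : Bool := edgeLabel s i false

theorem circle_eq_of_joined {v : (negativeTorusKnot k).Vertex} {e e' : Fin (2 * k + 1) × Bool}
    (h : (negativeTorusKnot k).Joined v e e') :
    (negativeTorusKnot k).circle v e = (negativeTorusKnot k).circle v e' := Quot.sound h

/-- All crossings are negative, so the oriented smoothing is the `1`-smoothing. It continues left
edges to left edges and right to right, while the `0`-smoothing caps off the two edges below and the
two edges above. -/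
theorem joined_iff {v : (negativeTorusKnot k).Vertex} {e e' : Fin (2 * k + 1) × Bool} :
    (negativeTorusKnot k).Joined v e e' ↔ ∃ x : Fin (2 * k + 1),
      (v x = true ∧ ((e = (x, false) ∧ e' = (x + 1, false)) ∨
        (e = (x, true) ∧ e' = (x + 1, true)))) ∨
      (v x = false ∧ ((e = (x, false) ∧ e' = (x, true)) ∨
        (e = (x + 1, true) ∧ e' = (x + 1, false)))) := by
  refine exists_congr fun x => ?_
  cases v x <;> simp

theorem circle_of_true {v : (negativeTorusKnot k).Vertex} {x : Fin (2 * k + 1)} (hx : v x = true)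
    (b : Bool) : (negativeTorusKnot k).circle v (x, b) =
      (negativeTorusKnot k).circle v (x + 1, b) := by
  apply circle_eq_of_joined
  rw [joined_iff]
  cases b
  · exact ⟨x, Or.inl ⟨hx, Or.inl ⟨rfl, rfl⟩⟩⟩
  · exact ⟨x, Or.inl ⟨hx, Or.inr ⟨rfl, rfl⟩⟩⟩

theorem circle_of_false {v : (negativeTorusKnot k).Vertex} {x : Fin (2 * k + 1)}
    (hx : v x = false) (b : Bool) : (negativeTorusKnot k).circle v (x, b) =
      (negativeTorusKnot k).circle v (x, false) := by
  cases b
  · rfl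
  · symm
    apply circle_eq_of_joined
    rw [joined_iff]
    exact ⟨x, Or.inr ⟨hx, Or.inl ⟨rfl, rfl⟩⟩⟩

/-- Going upwards from any edge one stays on the same side until the first `0`-smoothing, whose
lower cap joins the two sides. -/
theorem circle_eq_nextZero {v : (negativeTorusKnot k).Vertex} (hv : ∃ z, v z = false)
    (i : Fin (2 * k + 1)) (b : Bool) : (negativeTorusKnot k).circle v (i, b) =
      (negativeTorusKnot k).circle v (nextZero v i, false) := by
  refine nextZero_induction hv (p := fun i => (negativeTorusKnot k).circle v (i, b) =
      (negativeTorusKnot k).circle v (nextZero v i, false)) ?_ ?_ i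
  · intro i hi; rw [nextZero_of_false hi, circle_of_false hi]
  · intro i hi h; rw [nextZero_of_true hv hi, circle_of_true hi, h]

/-- The position of the crossing that closes a circle of a smoothing other than the oriented
one. -/
noncomputable def circleIndex {v : (negativeTorusKnot k).Vertex} (hv : ∃ z, v z = false) :
    (negativeTorusKnot k).Circle v → Fin (2 * k + 1) :=
  Quot.lift (fun e : Fin (2 * k + 1) × Bool => nextZero v e.1) (by
    rintro ⟨i, b⟩ ⟨j, b'⟩ h
    rw [joined_iff] at h
    obtain ⟨x, ⟨hx, h⟩ | ⟨hx, h⟩⟩ := h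
    · rcases h with ⟨h1, h2⟩ | ⟨h1, h2⟩ <;> cases h1 <;> cases h2 <;>
        exact nextZero_of_true hv hx
    · rcases h with ⟨h1, h2⟩ | ⟨h1, h2⟩ <;> cases h1 <;> cases h2 <;> rfl)

theorem circle_eq_iff {v : (negativeTorusKnot k).Vertex} (hv : ∃ z, v z = false)
    {i j : Fin (2 * k + 1)} {b b' : Bool} : (negativeTorusKnot k).circle v (i, b) =
      (negativeTorusKnot k).circle v (j, b') ↔ nextZero v i = nextZero v j := by
  constructor
  · intro h
    exact congrArg (circleIndex hv) h
  · intro h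
    rw [circle_eq_nextZero hv i b, circle_eq_nextZero hv j b', h]

/-- Whether a circle of the oriented smoothing is the right one. -/
def circleSide {v : (negativeTorusKnot k).Vertex} (hv : ∀ z, v z = true) :
    (negativeTorusKnot k).Circle v → Bool :=
  Quot.lift (fun e : Fin (2 * k + 1) × Bool => e.2) (by
    rintro ⟨i, b⟩ ⟨j, b'⟩ h
    rw [joined_iff] at h
    obtain ⟨x, ⟨hx, h⟩ | ⟨hx, h⟩⟩ := h
    · rcases h with ⟨h1, h2⟩ | ⟨h1, h2⟩ <;> cases h1 <;> cases h2 <;> rfl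
    · rw [hv x] at hx; cases hx)

theorem circle_eq_zero {v : (negativeTorusKnot k).Vertex} (hv : ∀ z, v z = true)
    (i : Fin (2 * k + 1)) (b : Bool) : (negativeTorusKnot k).circle v (i, b) =
      (negativeTorusKnot k).circle v (0, b) := by
  have key : ∀ m : ℕ, (negativeTorusKnot k).circle v (Fin.ofNat (2 * k + 1) m, b) =
      (negativeTorusKnot k).circle v (0, b) := by
    intro m
    induction m with
    | zero => rfl
    | succ m ih => rw [ofNat_succ, add_comm (1 : Fin (2 * k + 1)), ← circle_of_true (hv _), ih]
  obtain ⟨m, hm⟩ := exists_add_ofNat 0 i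
  rw [← hm, zero_add, key m]

theorem circle_eq_iff_top {v : (negativeTorusKnot k).Vertex} (hv : ∀ z, v z = true)
    {i j : Fin (2 * k + 1)} {b b' : Bool} : (negativeTorusKnot k).circle v (i, b) =
      (negativeTorusKnot k).circle v (j, b') ↔ b = b' := by
  constructor
  · intro h
    exact congrArg (circleSide hv) h
  · rintro rfl
    rw [circle_eq_zero hv i b, circle_eq_zero hv j b]

theorem edgeLabel_eq {s : TorusState k} (hv : ∃ z, s.1 z = false) (i : Fin (2 * k + 1))
    (b : Bool) : edgeLabel s i b = label s (nextZero s.1 i) := by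
  rw [edgeLabel, circle_eq_nextZero hv]; rfl

theorem edgeLabel_eq_top {s : TorusState k} (hv : ∀ z, s.1 z = true) (i : Fin (2 * k + 1))
    (b : Bool) : edgeLabel s i b = edgeLabel s 0 b := by
  rw [edgeLabel, circle_eq_zero hv]; rfl

theorem state_ext {s s' : TorusState k} (h : s.1 = s'.1)
    (hl : ∀ i b, edgeLabel s i b = edgeLabel s' i b) : s = s' := by
  obtain ⟨v, l⟩ := s
  obtain ⟨v', l'⟩ := s'
  obtain rfl : v = v' := h
  congr 1
  funext c
  induction c using Quot.ind with
  | _ e => exact hl e.1 e.2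

/-- Every circle is closed by a zero of the smoothing, so the labels at the zeros are all the
labels. -/
theorem state_ext_zeros {s s' : TorusState k} (hv : ∃ z, s.1 z = false) (h : s.1 = s'.1)
    (hl : ∀ i, s.1 i = false → label s i = label s' i) : s = s' := by
  refine state_ext h fun i b => ?_
  rw [edgeLabel_eq hv, edgeLabel_eq (h ▸ hv), ← h, hl _ (nextZero_spec hv i)]

theorem state_ext_top {s s' : TorusState k} (hv : ∀ z, s.1 z = true) (hv' : ∀ z, s'.1 z = true)
    (hl : ∀ b, edgeLabel s 0 b = edgeLabel s' 0 b) : s = s' := by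
  refine state_ext (funext fun z => by rw [hv, hv']) fun i b => ?_
  rw [edgeLabel_eq_top hv, edgeLabel_eq_top hv', hl]

/-- The state with the given labels on the circles closed at the zeros of `v`. -/
noncomputable def stateOf (v : Fin (2 * k + 1) → Bool) (hv : ∃ z, v z = false)
    (l : Fin (2 * k + 1) → Bool) : TorusState k :=
  ⟨v, fun c => l (circleIndex hv c)⟩

theorem label_stateOf {v : Fin (2 * k + 1) → Bool} (hv : ∃ z, v z = false)
    (l : Fin (2 * k + 1) → Bool) {i : Fin (2 * k + 1)} (hi : v i = false) :
    label (stateOf v hv l) i = l i := by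
  change l (nextZero v i) = l i
  rw [nextZero_of_false hi]

/-- The state of the oriented smoothing with labels `l false` on the left and `l true` on the
right circle. -/
def topState (k : ℕ) (l : Bool → Bool) : TorusState k :=
  ⟨fun _ => true, fun c => l (circleSide (fun _ => rfl) c)⟩

/-! ### Degrees -/

/-- The number of circles of a state that are labelled `X`. -/
noncomputable def numX (s : TorusState k) : ℕ :=
  (Finset.univ.filter fun c : (negativeTorusKnot k).Circle s.1 => s.2 c = true).card

theorem numX_eq {s : TorusState k} (hv : ∃ z, s.1 z = false) :
    numX s = (Finset.univ.filter fun i => s.1 i = false ∧ label s i = true).card := by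
  symm
  refine Finset.card_bij (fun i _ => (negativeTorusKnot k).circle s.1 (i, false)) ?_ ?_ ?_
  · intro i hi
    exact Finset.mem_filter.2 ⟨Finset.mem_univ _, (Finset.mem_filter.1 hi).2.2⟩
  · intro i hi j hj hij
    rw [circle_eq_iff hv, nextZero_of_false (Finset.mem_filter.1 hi).2.1,
      nextZero_of_false (Finset.mem_filter.1 hj).2.1] at hij
    exact hij
  · intro c hc
    induction c using Quot.ind with
    | _ e =>
      obtain ⟨i, b⟩ := e
      have h := (Finset.mem_filter.1 hc).2
      refine ⟨nextZero s.1 i, ?_, (circle_eq_nextZero hv i b).symm⟩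
      rw [Finset.mem_filter]
      refine ⟨Finset.mem_univ _, nextZero_spec hv i, ?_⟩
      rw [← edgeLabel_eq hv i b]
      exact h

theorem numX_eq_top {s : TorusState k} (hv : ∀ z, s.1 z = true) :
    numX s = (Finset.univ.filter fun b => edgeLabel s 0 b = true).card := by
  symm
  refine Finset.card_bij (fun b _ => (negativeTorusKnot k).circle s.1 (0, b)) ?_ ?_ ?_
  · intro b hb
    exact Finset.mem_filter.2 ⟨Finset.mem_univ _, (Finset.mem_filter.1 hb).2⟩
  · intro i hi j hj hij
    rwa [circle_eq_iff_top hv] at hij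
  · intro c hc
    induction c using Quot.ind with
    | _ e =>
      obtain ⟨i, b⟩ := e
      have h := (Finset.mem_filter.1 hc).2
      refine ⟨b, ?_, (circle_eq_zero hv i b).symm⟩
      rw [Finset.mem_filter]
      refine ⟨Finset.mem_univ _, ?_⟩
      rw [← edgeLabel_eq_top hv i b]
      exact h

theorem card_circle {v : (negativeTorusKnot k).Vertex} (hv : ∃ z, v z = false) :
    Fintype.card ((negativeTorusKnot k).Circle v) =
      (Finset.univ.filter fun i => v i = false).card := by
  rw [← Finset.card_univ]
  symm
  refine Finset.card_bij (fun i _ => (negativeTorusKnot k).circle v (i, false)) ?_ ?_ ?_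
  · intro i hi
    exact Finset.mem_univ _
  · intro i hi j hj hij
    rw [circle_eq_iff hv, nextZero_of_false (Finset.mem_filter.1 hi).2,
      nextZero_of_false (Finset.mem_filter.1 hj).2] at hij
    exact hij
  · intro c hc
    induction c using Quot.ind with
    | _ e =>
      obtain ⟨i, b⟩ := e
      refine ⟨nextZero v i, ?_, (circle_eq_nextZero hv i b).symm⟩
      rw [Finset.mem_filter]
      exact ⟨Finset.mem_univ _, nextZero_spec hv i⟩

theorem card_circle_top {v : (negativeTorusKnot k).Vertex} (hv : ∀ z, v z = true) :
    Fintype.card ((negativeTorusKnot k).Circle v) = 2 := by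
  rw [← Fintype.card_bool, ← Finset.card_univ, ← Finset.card_univ]
  symm
  refine Finset.card_bij (fun b _ => (negativeTorusKnot k).circle v (0, b)) ?_ ?_ ?_
  · intro i hi
    exact Finset.mem_univ _
  · intro i hi j hj hij
    rwa [circle_eq_iff_top hv] at hij
  · intro c hc
    induction c using Quot.ind with
    | _ e =>
      obtain ⟨i, b⟩ := e
      exact ⟨b, Finset.mem_univ _, (circle_eq_zero hv i b).symm⟩

theorem nNeg_eq : (negativeTorusKnot k).nNeg = 2 * k + 1 := by
  simp [LinkDiagram.nNeg]

theorem nPos_eq : (negativeTorusKnot k).nPos = 0 := by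
  simp [LinkDiagram.nPos]

theorem height_add (v : (negativeTorusKnot k).Vertex) :
    (negativeTorusKnot k).height v + (Finset.univ.filter fun i => v i = false).card =
      2 * k + 1 := by
  have := Finset.card_filter_add_card_filter_not (s := (Finset.univ : Finset (Fin (2 * k + 1))))
    (fun i => v i = true)
  simp only [Bool.not_eq_true, Finset.card_univ, Fintype.card_fin] at this
  exact this

theorem homDegree_eq (s : TorusState k) : (negativeTorusKnot k).homDegree s =
    -((Finset.univ.filter fun i => s.1 i = false).card : ℤ) := by
  have := height_add s.1
  rw [LinkDiagram.homDegree, nNeg_eq]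
  omega

theorem quantumDegree_eq_aux (s : TorusState k) : (negativeTorusKnot k).quantumDegree s =
    Fintype.card ((negativeTorusKnot k).Circle s.1) - 2 * numX s +
      (negativeTorusKnot k).height s.1 - 2 * (2 * k + 1) := by
  rw [LinkDiagram.quantumDegree, nNeg_eq, nPos_eq, numX]
  have : (∑ c : (negativeTorusKnot k).Circle s.1, if s.2 c = true then (-1 : ℤ) else 1) =
      ∑ c : (negativeTorusKnot k).Circle s.1, (1 - 2 * if s.2 c = true then (1 : ℤ) else 0) := by
    refine Finset.sum_congr rfl fun c _ => ?_
    split_ifs <;> norm_num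
  rw [this, Finset.sum_sub_distrib, ← Finset.mul_sum, Finset.sum_boole]
  simp

/-- Circles correspond to zeros and the height counts the ones, so together they contribute the
constant `2k+1`; only the number of labels `X` varies. -/
theorem quantumDegree_eq {s : TorusState k} (hv : ∃ z, s.1 z = false) :
    (negativeTorusKnot k).quantumDegree s = -(2 * k + 1) - 2 * numX s := by
  have := height_add s.1
  rw [quantumDegree_eq_aux, card_circle hv]
  omega

/-- Here there are two circles but no zeros, which accounts for the extra `2`. -/
theorem quantumDegree_eq_top {s : TorusState k} (hv : ∀ z, s.1 z = true) :
    (negativeTorusKnot k).quantumDegree s = 2 - (2 * k + 1) - 2 * numX s := by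
  have := height_add s.1
  have h0 : (Finset.univ.filter fun i => s.1 i = false).card = 0 := by
    rw [Finset.card_eq_zero, Finset.filter_eq_empty_iff]
    intro i _
    simp [hv i]
  rw [quantumDegree_eq_aux, card_circle_top hv]
  omega

end TorusStates

/-! ### Chains and saddle maps as polynomials -/

section PolynomialStates

variable {R : Type u} [CommRing R]

/-- Coordinates of the powers `X ^ e` in the basis `1, X` of `R[X] / (X² - hX - t)`. -/
def powCoeff (h t : R) : ℕ → Bool → R
  | 0, false => 1
  | 0, true => 0
  | e + 1, false => t * powCoeff h t e true
  | e + 1, true => powCoeff h t e false + h * powCoeff h t e true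

theorem powCoeff_add_two (h t : R) (e : ℕ) (l : Bool) :
    powCoeff h t (e + 2) l = h * powCoeff h t (e + 1) l + t * powCoeff h t e l := by
  cases l <;> simp only [powCoeff] <;> ring

theorem powCoeff_ite (h t : R) (a b : Bool) :
    powCoeff h t (if a = true then 1 else 0) b = if a = b then 1 else 0 := by
  cases a <;> cases b <;> simp [powCoeff]

theorem powCoeff_ite_add_ite (h t : R) (a b c : Bool) :
    powCoeff h t ((if a = true then 1 else 0) + if b = true then 1 else 0) c =
      mulCoeff h t a b c := by
  cases a <;> cases b <;> cases c <;> simp [powCoeff, mulCoeff]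

variable {k : ℕ} (h t : R)

/-- The exponent of the monomial `m` on the circle closed at `z` after identifying the variables
on each circle of the smoothing `v`. -/
noncomputable def circleExponent (v : Fin (2 * k + 1) → Bool) (m : Fin (2 * k + 1) →₀ ℕ)
    (z : Fin (2 * k + 1)) : ℕ :=
  ∑ i, if nextZero v i = z then m i else 0

open Classical in
/-- The coordinate at the state `s` of the image of a monomial in the tensor power of `A` over the
circles of `s`; for the oriented smoothing it is the image under the comultiplication. -/
noncomputable def monomialCoord (s : TorusState k) (m : Fin (2 * k + 1) →₀ ℕ) : R :=
  if ∃ z, s.1 z = false then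
    ∏ z with s.1 z = false, powCoeff h t (circleExponent s.1 m z) (label s z)
  else ∑ l : Bool, powCoeff h t (∑ i, m i) l *
    comulCoeff h t l (edgeLabel s 0 false) (edgeLabel s 0 true)

/-- The linear extension of `monomialCoord` to polynomials. -/
noncomputable def polyCoord (s : TorusState k) : MvPolynomial (Fin (2 * k + 1)) R →ₗ[R] R :=
  (MvPolynomial.basisMonomials (Fin (2 * k + 1)) R).constr R (monomialCoord h t s)

/-- The chain at the vertex `v` represented by a polynomial in one variable for each crossing. -/
noncomputable def polyChain (v : Fin (2 * k + 1) → Bool) :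
    MvPolynomial (Fin (2 * k + 1)) R →ₗ[R] (TorusState k → R) :=
  LinearMap.pi fun s => if s.1 = v then polyCoord h t s else 0

theorem polyChain_apply (v : Fin (2 * k + 1) → Bool) (p : MvPolynomial (Fin (2 * k + 1)) R)
    (s : TorusState k) : polyChain h t v p s = if s.1 = v then polyCoord h t s p else 0 := by
  rw [polyChain, LinearMap.pi_apply]
  split_ifs <;> rfl

theorem polyCoord_monomial (s : TorusState k) (m : Fin (2 * k + 1) →₀ ℕ) (r : R) :
    polyCoord h t s (MvPolynomial.monomial m r) = r * monomialCoord h t s m := by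
  have h1 : MvPolynomial.monomial m r = r • MvPolynomial.basisMonomials (Fin (2 * k + 1)) R m := by
    rw [MvPolynomial.coe_basisMonomials, MvPolynomial.smul_monomial, smul_eq_mul, mul_one]
  rw [h1, map_smul, polyCoord, Module.Basis.constr_basis, smul_eq_mul]

theorem circleExponent_add_single (v : Fin (2 * k + 1) → Bool) (m : Fin (2 * k + 1) →₀ ℕ)
    (i z : Fin (2 * k + 1)) (e : ℕ) : circleExponent v (m + Finsupp.single i e) z =
      circleExponent v m z + if nextZero v i = z then e else 0 := by
  have : ∀ j, (if nextZero v j = z then (m + Finsupp.single i e) j else 0) =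
      (if nextZero v j = z then m j else 0) +
        if i = j then (if nextZero v i = z then e else 0) else 0 := by
    intro j
    rw [Finsupp.add_apply, Finsupp.single_apply]
    by_cases hij : i = j
    · subst hij; split_ifs <;> simp
    · simp [hij]
  rw [circleExponent, Finset.sum_congr rfl fun j _ => this j, Finset.sum_add_distrib,
    Finset.sum_ite_eq]
  simp [circleExponent]

theorem sum_add_single (m : Fin (2 * k + 1) →₀ ℕ) (i : Fin (2 * k + 1)) (e : ℕ) :
    ∑ j, (m + Finsupp.single i e) j = ∑ j, m j + e := by
  simp [Finset.sum_add_distrib, Finsupp.single_apply]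

/-- Variables on the same circle are interchangeable. At the oriented smoothing all of them are,
because only the total degree enters before comultiplication; hence the conditional hypothesis. -/
theorem monomialCoord_add_single (s : TorusState k) (m : Fin (2 * k + 1) →₀ ℕ)
    {i j : Fin (2 * k + 1)} (hij : (∃ z, s.1 z = false) → nextZero s.1 i = nextZero s.1 j) :
    monomialCoord h t s (m + Finsupp.single i 1) = monomialCoord h t s (m + Finsupp.single j 1) := by
  by_cases hs : ∃ z, s.1 z = false
  · rw [monomialCoord, monomialCoord, if_pos hs, if_pos hs]
    refine Finset.prod_congr rfl fun z _ => ?_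
    rw [circleExponent_add_single, circleExponent_add_single, hij hs]
  · rw [monomialCoord, monomialCoord, if_neg hs, if_neg hs]
    simp only [sum_add_single]

theorem monomialCoord_add_two (s : TorusState k) (m : Fin (2 * k + 1) →₀ ℕ)
    (i : Fin (2 * k + 1)) : monomialCoord h t s (m + Finsupp.single i 2) =
      h * monomialCoord h t s (m + Finsupp.single i 1) + t * monomialCoord h t s m := by
  by_cases hs : ∃ z, s.1 z = false
  · have hi : nextZero s.1 i ∈ Finset.univ.filter fun z => s.1 z = false := by
      simpa using nextZero_spec hs i
    have key : ∀ e, monomialCoord h t s (m + Finsupp.single i e) =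
        powCoeff h t (circleExponent s.1 m (nextZero s.1 i) + e) (label s (nextZero s.1 i)) *
          ∏ z ∈ (Finset.univ.filter fun z => s.1 z = false).erase (nextZero s.1 i),
            powCoeff h t (circleExponent s.1 m z) (label s z) := by
      intro e
      rw [monomialCoord, if_pos hs, ← Finset.mul_prod_erase _ _ hi, circleExponent_add_single,
        if_pos rfl]
      congr 1
      refine Finset.prod_congr rfl fun z hz => ?_
      rw [circleExponent_add_single, if_neg (Finset.ne_of_mem_erase hz).symm, add_zero]
    have h0 := key 0
    rw [Finsupp.single_zero, add_zero, add_zero] at h0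
    rw [key, key, h0, powCoeff_add_two]
    ring
  · rw [monomialCoord, monomialCoord, monomialCoord, if_neg hs, if_neg hs, if_neg hs,
      sum_add_single, sum_add_single, Finset.mul_sum, Finset.mul_sum, ← Finset.sum_add_distrib]
    refine Finset.sum_congr rfl fun l _ => ?_
    rw [powCoeff_add_two]
    ring

/-- The relations that hold among the variables on the circles of the smoothing `v`. -/
noncomputable def circleIdeal (v : Fin (2 * k + 1) → Bool) :
    Ideal (MvPolynomial (Fin (2 * k + 1)) R) :=
  Ideal.span ({p | ∃ i j, nextZero v i = nextZero v j ∧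
      p = MvPolynomial.X i - MvPolynomial.X j} ∪
    {p | ∃ i, p = MvPolynomial.X i ^ 2 - MvPolynomial.C h * MvPolynomial.X i - MvPolynomial.C t})

theorem polyCoord_mul_X (s : TorusState k) (p : MvPolynomial (Fin (2 * k + 1)) R)
    {i j : Fin (2 * k + 1)} (hij : (∃ z, s.1 z = false) → nextZero s.1 i = nextZero s.1 j) :
    polyCoord h t s (p * MvPolynomial.X i) = polyCoord h t s (p * MvPolynomial.X j) := by
  induction p using MvPolynomial.induction_on' with
  | monomial m r =>
    rw [MvPolynomial.X, MvPolynomial.X, MvPolynomial.monomial_mul, MvPolynomial.monomial_mul,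
      polyCoord_monomial, polyCoord_monomial, monomialCoord_add_single h t s m hij]
  | add p q hp hq => rw [add_mul, add_mul, map_add, map_add, hp, hq]

theorem polyCoord_mul_quadratic (s : TorusState k) (p : MvPolynomial (Fin (2 * k + 1)) R)
    (i : Fin (2 * k + 1)) : polyCoord h t s (p * (MvPolynomial.X i ^ 2 -
      MvPolynomial.C h * MvPolynomial.X i - MvPolynomial.C t)) = 0 := by
  induction p using MvPolynomial.induction_on' with
  | monomial m r =>
    have h2 : (MvPolynomial.X i : MvPolynomial (Fin (2 * k + 1)) R) ^ 2 =
        MvPolynomial.monomial (Finsupp.single i 2) 1 := MvPolynomial.X_pow_eq_monomial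
    rw [h2, MvPolynomial.X, MvPolynomial.C_mul_monomial, mul_sub, mul_sub,
      MvPolynomial.monomial_mul, MvPolynomial.monomial_mul, mul_comm _ (MvPolynomial.C t),
      MvPolynomial.C_mul_monomial, map_sub, map_sub, polyCoord_monomial, polyCoord_monomial,
      polyCoord_monomial, monomialCoord_add_two]
    ring
  | add p q hp hq => rw [add_mul, map_add, hp, hq, add_zero]

/-- The relations at `v` persist at every smoothing above it: further ones only merge blocks, and at
the oriented smoothing the coordinate does not distinguish the variables at all. This makes the
passage along cube edges well defined on polynomials. -/
theorem polyCoord_eq_zero {v : Fin (2 * k + 1) → Bool} {s : TorusState k}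
    (hvs : ∀ i, v i = true → s.1 i = true) {p : MvPolynomial (Fin (2 * k + 1)) R}
    (hp : p ∈ circleIdeal h t v) : polyCoord h t s p = 0 := by
  have key : ∀ q, polyCoord h t s (q * p) = 0 := by
    refine Submodule.span_induction (p := fun p _ => ∀ q, polyCoord h t s (q * p) = 0)
      ?_ ?_ ?_ ?_ hp
    · rintro _ (⟨i, j, hij, rfl⟩ | ⟨i, rfl⟩) q
      · rw [mul_sub, map_sub, sub_eq_zero]
        exact polyCoord_mul_X h t s q fun hs => nextZero_congr_of_le hs hvs hij
      · exact polyCoord_mul_quadratic h t s q i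
    · intro q; rw [mul_zero, map_zero]
    · intro p p' _ _ hp hp' q; rw [mul_add, map_add, hp, hp', add_zero]
    · intro a p _ hp q; rw [smul_eq_mul, ← mul_assoc, hp]
  simpa using key 1

theorem polyChain_eq_zero {v w : Fin (2 * k + 1) → Bool}
    (hvw : ∀ i, v i = true → w i = true) {p : MvPolynomial (Fin (2 * k + 1)) R}
    (hp : p ∈ circleIdeal h t v) : polyChain h t w p = 0 := by
  ext s
  rw [polyChain_apply]
  split_ifs with hs
  · exact polyCoord_eq_zero h t (by rwa [hs]) hp
  · rfl

/-- The squarefree monomial on a set of positions. -/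
noncomputable def prodX (R : Type u) [CommRing R] (B : Finset (Fin (2 * k + 1))) :
    MvPolynomial (Fin (2 * k + 1)) R := ∏ i ∈ B, MvPolynomial.X i

theorem prodX_eq_monomial (B : Finset (Fin (2 * k + 1))) :
    prodX R B = MvPolynomial.monomial (∑ i ∈ B, Finsupp.single i 1) 1 := by
  rw [MvPolynomial.monomial_sum_one]; rfl

theorem sum_single_apply (B : Finset (Fin (2 * k + 1))) (i : Fin (2 * k + 1)) :
    (∑ j ∈ B, Finsupp.single j (1 : ℕ)) i = if i ∈ B then 1 else 0 := by
  simp [Finsupp.finsetSum_apply, Finsupp.single_apply]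

theorem polyCoord_prodX (s : TorusState k) (B : Finset (Fin (2 * k + 1))) :
    polyCoord h t s (prodX R B) = monomialCoord h t s (∑ i ∈ B, Finsupp.single i 1) := by
  rw [prodX_eq_monomial, polyCoord_monomial, one_mul]

/-- Modulo the relations each variable moves to the zero closing its circle, and squares reduce. The
squarefree monomials in these variables are the enhanced states at `v`, so linear identities need
only be checked there. -/
theorem span_prodX_sup_circleIdeal {v : Fin (2 * k + 1) → Bool} (hv : ∃ z, v z = false)
    (p : MvPolynomial (Fin (2 * k + 1)) R) :
    p ∈ Submodule.span R (prodX R '' {B | ∀ i ∈ B, v i = false}) ⊔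
      (circleIdeal h t v).restrictScalars R := by
  set W := Submodule.span R (prodX R '' {B | ∀ i ∈ B, v i = false}) ⊔
      (circleIdeal h t v).restrictScalars R
  have hspan : ∀ B : Finset (Fin (2 * k + 1)), (∀ i ∈ B, v i = false) → prodX R B ∈ W :=
    fun B hB => Submodule.mem_sup_left (Submodule.subset_span ⟨B, hB, rfl⟩)
  have hideal : ∀ q ∈ circleIdeal h t v, q ∈ W := fun q hq => Submodule.mem_sup_right hq
  have hmul : ∀ (i : Fin (2 * k + 1)) (q : MvPolynomial (Fin (2 * k + 1)) R), q ∈ W →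
      q * MvPolynomial.X i ∈ W := by
    intro i q hq
    obtain ⟨a, ha, b, hb, rfl⟩ := Submodule.mem_sup.1 hq
    rw [add_mul]
    refine add_mem ?_ (hideal _ (Ideal.mul_mem_right _ _ hb))
    refine Submodule.span_induction (p := fun a _ => a * MvPolynomial.X i ∈ W) ?_ ?_ ?_ ?_ ha
    · rintro _ ⟨B, hB, rfl⟩
      have h1 : prodX R B * MvPolynomial.X (nextZero v i) ∈ W := by
        by_cases hj : nextZero v i ∈ B
        -- The variable already occurs in the monomial, so its square is rewritten as `h X + t`.
        · have h2 : prodX R B * MvPolynomial.X (nextZero v i) =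
              prodX R (B.erase (nextZero v i)) * (MvPolynomial.X (nextZero v i) ^ 2 -
                MvPolynomial.C h * MvPolynomial.X (nextZero v i) - MvPolynomial.C t) +
              (h • prodX R B + t • prodX R (B.erase (nextZero v i))) := by
            rw [MvPolynomial.smul_eq_C_mul, MvPolynomial.smul_eq_C_mul, prodX, prodX,
              ← Finset.mul_prod_erase _ _ hj]
            ring
          rw [h2]
          refine add_mem (hideal _ (Ideal.mul_mem_left _ _ (Ideal.subset_span
            (Or.inr ⟨_, rfl⟩)))) (add_mem (W.smul_mem _ (hspan _ hB)) (W.smul_mem _ (hspan _ ?_)))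
          exact fun j hj => hB j (Finset.mem_of_mem_erase hj)
        · have h2 : prodX R B * MvPolynomial.X (nextZero v i) =
              prodX R (insert (nextZero v i) B) := by
            rw [prodX, prodX, Finset.prod_insert hj]
            exact mul_comm _ _
          rw [h2]
          refine hspan _ fun j hj => ?_
          rcases Finset.mem_insert.1 hj with rfl | hj
          · exact nextZero_spec hv i
          · exact hB j hj
      have h2 : prodX R B * MvPolynomial.X i = prodX R B * (MvPolynomial.X i -
          MvPolynomial.X (nextZero v i)) + prodX R B * MvPolynomial.X (nextZero v i) := by ring
      rw [h2]
      refine add_mem (hideal _ (Ideal.mul_mem_left _ _ (Ideal.subset_span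
        (Or.inl ⟨_, _, ?_, rfl⟩)))) h1
      rw [nextZero_of_false (nextZero_spec hv i)]
    · rw [zero_mul]; exact zero_mem _
    · intro a b _ _ ha hb; rw [add_mul]; exact add_mem ha hb
    · intro r a _ ha; rw [smul_mul_assoc]; exact W.smul_mem _ ha
  induction p using MvPolynomial.induction_on with
  | C a =>
    have : (MvPolynomial.C a : MvPolynomial (Fin (2 * k + 1)) R) = a • prodX R ∅ := by
      rw [prodX, Finset.prod_empty, MvPolynomial.smul_eq_C_mul, mul_one]
    rw [this]
    exact W.smul_mem _ (hspan _ (by simp))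
  | add p q hp hq => exact add_mem hp hq
  | mul_X p i hp => exact hmul i p hp

/-- The positions of the circles of a state that are labelled `X`. -/
def posX (s : TorusState k) : Finset (Fin (2 * k + 1)) :=
  Finset.univ.filter fun i => s.1 i = false ∧ label s i = true

theorem mem_posX {s : TorusState k} {i : Fin (2 * k + 1)} :
    i ∈ posX s ↔ s.1 i = false ∧ label s i = true := by
  simp [posX]

theorem circleExponent_posX {s : TorusState k} {z : Fin (2 * k + 1)} (hz : s.1 z = false) :
    circleExponent s.1 (∑ i ∈ posX s, Finsupp.single i 1) z =
      if label s z = true then 1 else 0 := by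
  rw [circleExponent, Finset.sum_eq_single z]
  · simp [nextZero_of_false hz, sum_single_apply, mem_posX, hz]
  · intro i _ hi
    simp only [sum_single_apply, mem_posX]
    by_cases h1 : s.1 i = false
    · rw [nextZero_of_false h1, if_neg hi]
    · simp [h1]
  · simp

/-- The monomials of the states at a fixed smoothing are dual to the coordinates there. -/
theorem polyCoord_posX_self {s s' : TorusState k} (hv : ∃ z, s.1 z = false) (hss : s.1 = s'.1) :
    polyCoord h t s' (prodX R (posX s)) = if s = s' then 1 else 0 := by
  have hv' : ∃ z, s'.1 z = false := hss ▸ hv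
  rw [polyCoord_prodX, monomialCoord, if_pos hv', ← hss]
  have key : ∀ z ∈ Finset.univ.filter (fun z => s.1 z = false),
      powCoeff h t (circleExponent s.1 (∑ i ∈ posX s, Finsupp.single i 1) z) (label s' z) =
        if label s z = label s' z then 1 else 0 := by
    intro z hz
    rw [circleExponent_posX (Finset.mem_filter.1 hz).2, powCoeff_ite]
  rw [Finset.prod_congr rfl key]
  split_ifs with hs
  · subst hs; simp
  · have : ∃ i, s.1 i = false ∧ label s i ≠ label s' i := by
      by_contra! hc
      exact hs (state_ext_zeros hv hss hc)
    obtain ⟨i, hi, hl⟩ := this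
    exact Finset.prod_eq_zero (Finset.mem_filter.2 ⟨Finset.mem_univ i, hi⟩) (if_neg hl)

theorem polyChain_posX {s : TorusState k} (hv : ∃ z, s.1 z = false) :
    polyChain h t s.1 (prodX R (posX s)) = fun s' => if s = s' then 1 else 0 := by
  ext s'
  rw [polyChain_apply]
  split_ifs with h1 h2 h2
  · rw [polyCoord_posX_self h t hv h1.symm, if_pos h2]
  · rw [polyCoord_posX_self h t hv h1.symm, if_neg h2]
  · exact absurd (h2 ▸ rfl) h1
  · rfl

/-- The circle closed at `x` merges into the one closed at the next zero `y`. On that circle the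
exponents of the two labels add, which is multiplication in `A`; on the others they are unchanged,
which gives Kronecker deltas. -/
theorem saddleCoeff_eq_merge {s s' : TorusState k} {x : Fin (2 * k + 1)} (hx : s.1 x = false)
    (hs' : s'.1 = Function.update s.1 x true) (hv' : ∃ z, s'.1 z = false) :
    (negativeTorusKnot k).saddleCoeff h t x s s' = polyCoord h t s' (prodX R (posX s)) := by
  have hv : ∃ z, s.1 z = false := ⟨x, hx⟩
  have hne : nextZero s.1 (x + 1) ≠ x := nextZero_succ_ne hx (hs' ▸ hv')
  have hnz : ∀ i, nextZero s'.1 i =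
      if nextZero s.1 i = x then nextZero s.1 (x + 1) else nextZero s.1 i := by
    intro i
    rw [hs']
    exact nextZero_update (hs' ▸ hv') i
  set y := nextZero s.1 (x + 1) with hy
  have hy0 : s.1 y = false := nextZero_spec hv _
  have hy' : s'.1 y = false := by rw [hs', Function.update_of_ne hne, hy0]
  have hexp : ∀ z, s'.1 z = false → z ≠ y →
      circleExponent s'.1 (∑ i ∈ posX s, Finsupp.single i 1) z =
        if label s z = true then 1 else 0 := by
    intro z hz hzy
    have hzx : z ≠ x := by rintro rfl; rw [hs'] at hz; simp at hz
    have hz0 : s.1 z = false := by rw [hs', Function.update_of_ne hzx] at hz; exact hz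
    rw [circleExponent, Finset.sum_eq_single z]
    · rw [nextZero_of_false hz, if_pos rfl, sum_single_apply]
      simp [mem_posX, hz0]
    · intro i _ hi
      simp only [sum_single_apply, mem_posX]
      by_cases h1 : s.1 i = false
      · rw [hnz, nextZero_of_false h1]
        by_cases h2 : i = x
        · rw [if_pos h2, if_neg hzy.symm]
        · rw [if_neg h2, if_neg hi]
      · simp [h1]
    · simp
  have hexpy : circleExponent s'.1 (∑ i ∈ posX s, Finsupp.single i 1) y =
      (if label s x = true then 1 else 0) + if label s y = true then 1 else 0 := by
    have : ∀ i, (if nextZero s'.1 i = y then (∑ j ∈ posX s, Finsupp.single j (1 : ℕ)) i else 0) =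
        (if i = x then if label s x = true then 1 else 0 else 0) +
          if i = y then if label s y = true then 1 else 0 else 0 := by
      intro i
      simp only [sum_single_apply, mem_posX]
      by_cases h1 : s.1 i = false
      · rw [hnz, nextZero_of_false h1]
        by_cases h2 : i = x
        · subst h2; simp [hne.symm, hx]
        · by_cases h3 : i = y
          · subst h3; simp [h2, h1]
          · simp [h2, h3]
      · have h2 : i ≠ x := by rintro rfl; exact h1 hx
        have h3 : i ≠ y := by rintro rfl; exact h1 hy0
        simp [h1, h2, h3]
    rw [circleExponent, Finset.sum_congr rfl fun i _ => this i, Finset.sum_add_distrib]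
    simp
  have hlab : ∀ b, edgeLabel s (x + 1) b = label s y := fun b => edgeLabel_eq hv _ _
  have hlab' : label s' x = label s' y := by
    rw [label, edgeLabel_eq hv', hnz, nextZero_of_false hx, if_pos rfl]
  rw [polyCoord_prodX, monomialCoord, if_pos hv',
    ← Finset.mul_prod_erase _ _ (Finset.mem_filter.2 ⟨Finset.mem_univ y, hy'⟩), hexpy,
    powCoeff_ite_add_ite]
  have hprod : ∀ z ∈ (Finset.univ.filter (fun z => s'.1 z = false)).erase y,
      powCoeff h t (circleExponent s'.1 (∑ i ∈ posX s, Finsupp.single i 1) z) (label s' z) =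
        if label s z = label s' z then 1 else 0 := by
    intro z hz
    obtain ⟨h1, h2⟩ := Finset.mem_erase.1 hz
    rw [hexp z (Finset.mem_filter.1 h2).2 h1, powCoeff_ite]
  rw [Finset.prod_congr rfl hprod]
  have hcirc : (negativeTorusKnot k).circle s.1 (x, false) ≠
      (negativeTorusKnot k).circle s.1 (x + 1, true) := by
    rw [Ne, circle_eq_iff hv, nextZero_of_false hx]
    exact hne.symm
  -- The condition in `saddleCoeff` that uninvolved circles keep their labels, expressed at the
  -- zeros other than `y`; it says that none of the Kronecker deltas vanishes.
  have hcond : (∀ e : Fin (2 * k + 1) × Bool, (negativeTorusKnot k).circle s.1 e ≠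
      (negativeTorusKnot k).circle s.1 (x, false) → (negativeTorusKnot k).circle s.1 e ≠
      (negativeTorusKnot k).circle s.1 (x + 1, true) →
      s.2 ((negativeTorusKnot k).circle s.1 e) = s'.2 ((negativeTorusKnot k).circle s'.1 e)) ↔
      ∀ z, s'.1 z = false → z ≠ y → label s z = label s' z := by
    constructor
    · intro hc z hz hzy
      have hzx : z ≠ x := by rintro rfl; rw [hs'] at hz; simp at hz
      have hz0 : s.1 z = false := by rw [hs', Function.update_of_ne hzx] at hz; exact hz
      refine hc (z, false) ?_ ?_
      · rwa [Ne, circle_eq_iff hv, nextZero_of_false hx, nextZero_of_false hz0]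
      · rwa [Ne, circle_eq_iff hv, nextZero_of_false hz0]
    · rintro hc ⟨i, b⟩ h1 h2
      rw [Ne, circle_eq_iff hv, nextZero_of_false hx] at h1
      rw [Ne, circle_eq_iff hv] at h2
      have h3 := hc (nextZero s.1 i)
        (by rw [hs', Function.update_of_ne h1, nextZero_spec hv]) h2
      have h4 : nextZero s'.1 i = nextZero s.1 i := by rw [hnz, if_neg h1]
      change edgeLabel s i b = edgeLabel s' i b
      rw [edgeLabel_eq hv, edgeLabel_eq hv', h4, h3]
  unfold LinkDiagram.saddleCoeff
  simp only [hcond]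
  rw [if_pos hcirc]
  change (if _ then mulCoeff h t (label s x) (edgeLabel s (x + 1) true) (label s' x) else 0) = _
  rw [hlab, hlab']
  split_ifs with hc
  · rw [Finset.prod_eq_one, mul_one]
    intro z hz
    obtain ⟨h1, h2⟩ := Finset.mem_erase.1 hz
    rw [if_pos (hc z (Finset.mem_filter.1 h2).2 h1)]
  · push Not at hc
    obtain ⟨z, h1, h2, h3⟩ := hc
    rw [Finset.prod_eq_zero (i := z), mul_zero]
    · exact Finset.mem_erase.2 ⟨h2, Finset.mem_filter.2 ⟨Finset.mem_univ z, h1⟩⟩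
    · rw [if_neg h3]

/-- Here `x` is the only zero of `s`, so there is one circle, and its label is the total exponent
`0` or `1` that `monomialCoord` comultiplies. -/
theorem saddleCoeff_eq_split {s s' : TorusState k} {x : Fin (2 * k + 1)} (hx : s.1 x = false)
    (hs' : s'.1 = Function.update s.1 x true) (hv' : ∀ z, s'.1 z = true) :
    (negativeTorusKnot k).saddleCoeff h t x s s' = polyCoord h t s' (prodX R (posX s)) := by
  have hv : ∃ z, s.1 z = false := ⟨x, hx⟩
  have hzero : ∀ z, s.1 z = false → z = x := by
    intro z hz
    by_contra hzx
    have := hv' z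
    rw [hs', Function.update_of_ne hzx, hz] at this
    cases this
  have hnz : ∀ i, nextZero s.1 i = x := fun i => hzero _ (nextZero_spec hv i)
  have hsum : ∑ i, (∑ j ∈ posX s, Finsupp.single j (1 : ℕ)) i =
      if label s x = true then 1 else 0 := by
    rw [Finset.sum_eq_single x]
    · simp [sum_single_apply, mem_posX, hx]
    · intro i _ hi
      have : s.1 i ≠ false := fun h => hi (hzero i h)
      simp [sum_single_apply, mem_posX, this]
    · simp
  have h1 : ∀ e, (negativeTorusKnot k).circle s.1 e =
      (negativeTorusKnot k).circle s.1 (x, false) := by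
    rintro ⟨i, b⟩
    rw [circle_eq_iff hv, hnz, hnz]
  have h2 : (negativeTorusKnot k).circle s'.1 (x, false) ≠
      (negativeTorusKnot k).circle s'.1 (x + 1, true) := by
    rw [Ne, circle_eq_iff_top hv']
    decide
  rw [polyCoord_prodX, monomialCoord, if_neg (by rintro ⟨z, hz⟩; rw [hv' z] at hz; cases hz), hsum]
  unfold LinkDiagram.saddleCoeff
  rw [if_pos (fun e h3 => absurd (h1 e) h3), if_neg (not_not.2 (h1 (x + 1, true)).symm), if_pos h2]
  change comulCoeff h t (label s x) (edgeLabel s' x false) (edgeLabel s' (x + 1) true) = _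
  rw [edgeLabel_eq_top hv', edgeLabel_eq_top hv' (x + 1)]
  simp only [powCoeff_ite, Fintype.univ_bool, Finset.mem_singleton, Bool.true_eq_false,
    not_false_eq_true, Finset.sum_insert, Finset.sum_singleton]
  cases label s x <;> simp

theorem saddleCoeff_eq {s s' : TorusState k} {x : Fin (2 * k + 1)} (hx : s.1 x = false)
    (hs' : s'.1 = Function.update s.1 x true) :
    (negativeTorusKnot k).saddleCoeff h t x s s' = polyCoord h t s' (prodX R (posX s)) := by
  by_cases hv' : ∃ z, s'.1 z = false
  · exact saddleCoeff_eq_merge h t hx hs' hv'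
  · push Not at hv'
    exact saddleCoeff_eq_split h t hx hs' fun z => by simpa using hv' z

/-- The Khovanov differential of the diagram. -/
noncomputable abbrev torusDiff (k : ℕ) : (TorusState k → R) →ₗ[R] (TorusState k → R) :=
  Matrix.mulVecLin (Matrix.of fun s' s => (negativeTorusKnot k).diffCoeff h t s s')

theorem torusDiff_apply (y : TorusState k → R) (s' : TorusState k) :
    torusDiff h t k y s' = ∑ s, (negativeTorusKnot k).diffCoeff h t s s' * y s := by
  simp [Matrix.mulVec, dotProduct]

/-- Each cube edge carries a polynomial to the same polynomial, up to sign. -/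
theorem torusDiff_polyChain (v : Fin (2 * k + 1) → Bool)
    (p : MvPolynomial (Fin (2 * k + 1)) R) :
    torusDiff h t k (polyChain h t v p) = ∑ x, if v x = false then
      ((negativeTorusKnot k).edgeSign v x : R) •
        polyChain h t (Function.update v x true) p else 0 := by
  by_cases hv : ∃ z, v z = false
  · obtain ⟨a, ha, b, hb, rfl⟩ := Submodule.mem_sup.1 (span_prodX_sup_circleIdeal h t hv p)
    have hb1 : polyChain h t v b = 0 := polyChain_eq_zero h t (fun _ => id) hb
    have hb2 : ∀ x, polyChain h t (Function.update v x true) b = 0 := fun x =>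
      polyChain_eq_zero h t (v := v) (fun i hi => by
        by_cases hix : i = x
        · subst hix; simp
        · rwa [Function.update_of_ne hix]) hb
    simp only [map_add, hb1, hb2, add_zero]
    refine Submodule.span_induction (p := fun a _ => torusDiff h t k (polyChain h t v a) =
      ∑ x, if v x = false then ((negativeTorusKnot k).edgeSign v x : R) •
        polyChain h t (Function.update v x true) a else 0) ?_ ?_ ?_ ?_ ha
    · rintro _ ⟨B, hB, rfl⟩
      obtain ⟨s, rfl, rfl⟩ : ∃ s : TorusState k, s.1 = v ∧ posX s = B := by
        refine ⟨stateOf v hv fun i => decide (i ∈ B), rfl, ?_⟩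
        ext i
        rw [mem_posX]
        constructor
        · rintro ⟨h1, h2⟩
          rw [label_stateOf hv _ h1] at h2
          simpa using h2
        · intro hi
          refine ⟨hB i hi, ?_⟩
          rw [label_stateOf hv _ (hB i hi)]
          simpa using hi
      ext s'
      rw [polyChain_posX h t hv, torusDiff_apply, Finset.sum_eq_single s]
      · rw [if_pos rfl, mul_one, LinkDiagram.diffCoeff, Finset.sum_apply]
        refine Finset.sum_congr rfl fun x _ => ?_
        by_cases hx : s.1 x = false
        · by_cases hs' : s'.1 = Function.update s.1 x true
          · rw [if_pos ⟨hx, hs'⟩, if_pos hx, Pi.smul_apply, polyChain_apply, if_pos hs',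
              saddleCoeff_eq h t hx hs', smul_eq_mul]
          · rw [if_neg fun h => hs' h.2, if_pos hx, Pi.smul_apply, polyChain_apply, if_neg hs',
              smul_zero]
        · rw [if_neg fun h => hx h.1, if_neg hx, Pi.zero_apply]
      · intro b _ hb
        rw [if_neg hb.symm, mul_zero]
      · simp
    · simp
    · intro a b _ _ ha hb
      simp only [map_add, ha, hb, ← Finset.sum_add_distrib]
      refine Finset.sum_congr rfl fun x _ => ?_
      split_ifs
      · rw [smul_add]
      · rw [add_zero]
    · intro r a _ ha
      simp only [map_smul, ha, Finset.smul_sum]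
      refine Finset.sum_congr rfl fun x _ => ?_
      split_ifs
      · rw [smul_comm]
      · rw [smul_zero]
  -- No cube edge leaves the oriented smoothing, so both sides vanish.
  · have hv' : ∀ z, v z ≠ false := by simpa using hv
    rw [Finset.sum_eq_zero fun x _ => if_neg (hv' x)]
    ext s'
    rw [torusDiff_apply]
    refine Finset.sum_eq_zero fun s _ => ?_
    rw [polyChain_apply]
    split_ifs with hs
    · rw [LinkDiagram.diffCoeff, Finset.sum_eq_zero, zero_mul]
      intro x _
      rw [if_neg]
      rintro ⟨h1, -⟩
      rw [hs] at h1
      exact hv' x h1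
    · rw [mul_zero]

end PolynomialStates

/-! ### The Khovanov differential and its bidegree -/

section Differential

variable {R : Type u} [CommRing R] {k : ℕ} (h t : R)

theorem update_update_eq_false_iff {v : Fin (2 * k + 1) → Bool} {x y : Fin (2 * k + 1)} :
    v x = false ∧ Function.update v x true y = false ↔ v x = false ∧ v y = false ∧ x ≠ y := by
  by_cases hxy : x = y
  · subst hxy; simp
  · rw [Function.update_of_ne (Ne.symm hxy)]
    simp [hxy]

theorem edgeSign_update_of_lt {v : (negativeTorusKnot k).Vertex} {x y : Fin (2 * k + 1)}
    (hx : v x = false) (hxy : x < y) : (negativeTorusKnot k).edgeSign (Function.update v x true) y =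
      -(negativeTorusKnot k).edgeSign v y := by
  rw [LinkDiagram.edgeSign, LinkDiagram.edgeSign]
  have : (Finset.univ.filter fun z => z < y ∧ Function.update v x true z = true) =
      insert x (Finset.univ.filter fun z => z < y ∧ v z = true) := by
    ext z
    by_cases hz : z = x
    · subst hz; simp [hxy]
    · simp [hz]
  rw [this, Finset.card_insert_of_notMem (by simp [hx]), pow_succ, mul_neg_one]

theorem edgeSign_update_of_gt {v : (negativeTorusKnot k).Vertex} {x y : Fin (2 * k + 1)}
    (hxy : y < x) : (negativeTorusKnot k).edgeSign (Function.update v x true) y =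
      (negativeTorusKnot k).edgeSign v y := by
  rw [LinkDiagram.edgeSign, LinkDiagram.edgeSign]
  congr 2
  refine Finset.filter_congr fun z _ => and_congr_right fun hz => ?_
  rw [Function.update_of_ne (hz.trans hxy).ne]

theorem edgeSign_anticomm {v : (negativeTorusKnot k).Vertex} {x y : Fin (2 * k + 1)}
    (hx : v x = false) (hy : v y = false) (hxy : x ≠ y) :
    (negativeTorusKnot k).edgeSign v x *
      (negativeTorusKnot k).edgeSign (Function.update v x true) y =
    -((negativeTorusKnot k).edgeSign v y *
      (negativeTorusKnot k).edgeSign (Function.update v y true) x) := by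
  rcases lt_or_gt_of_ne hxy with hlt | hlt
  · rw [edgeSign_update_of_lt hx hlt, edgeSign_update_of_gt hlt]
    ring
  · rw [edgeSign_update_of_gt hlt, edgeSign_update_of_lt hy hlt]
    ring

/-- Both ways around a face of the cube carry the polynomial `p` to itself at the same smoothing, so
commutativity of the faces is automatic and the anticommuting edge signs cancel the terms in pairs.
-/
theorem torusDiff_torusDiff_polyChain (v : Fin (2 * k + 1) → Bool)
    (p : MvPolynomial (Fin (2 * k + 1)) R) :
    torusDiff h t k (torusDiff h t k (polyChain h t v p)) = 0 := by
  classical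
  have h1 : torusDiff h t k (torusDiff h t k (polyChain h t v p)) =
      ∑ x, ∑ y, if v x = false ∧ v y = false ∧ x ≠ y then
        ((((negativeTorusKnot k).edgeSign v x *
          (negativeTorusKnot k).edgeSign (Function.update v x true) y : ℤ) : R)) •
        polyChain h t (Function.update (Function.update v x true) y true) p else 0 := by
    rw [torusDiff_polyChain, map_sum]
    refine Finset.sum_congr rfl fun x _ => ?_
    by_cases hx : v x = false
    · rw [if_pos hx, map_smul, torusDiff_polyChain, Finset.smul_sum]
      refine Finset.sum_congr rfl fun y _ => ?_
      by_cases hy : Function.update v x true y = false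
      · rw [if_pos hy, if_pos (update_update_eq_false_iff.1 ⟨hx, hy⟩), smul_smul, Int.cast_mul]
      · rw [if_neg hy, if_neg fun hc => hy (update_update_eq_false_iff.2 hc).2, smul_zero]
    · rw [if_neg hx, map_zero]
      symm
      exact Finset.sum_eq_zero fun y _ => if_neg fun hc => hx hc.1
  rw [h1, ← Finset.sum_product']
  refine Finset.sum_involution (fun z _ => (z.2, z.1)) ?_ ?_ ?_ ?_
  · rintro ⟨x, y⟩ _
    by_cases hc : v x = false ∧ v y = false ∧ x ≠ y
    · obtain ⟨hx, hy, hxy⟩ := hc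
      simp only [hx, hy, hxy, hxy.symm, Ne, not_false_eq_true, and_self, if_true]
      rw [edgeSign_anticomm hx hy hxy, Function.update_comm hxy, Int.cast_neg, neg_smul,
        neg_add_cancel]
    · have hc' : ¬(v y = false ∧ v x = false ∧ y ≠ x) := fun ⟨h1, h2, h3⟩ => hc ⟨h2, h1, h3.symm⟩
      rw [if_neg hc, if_neg hc', add_zero]
  · rintro ⟨x, y⟩ _ hne heq
    have h2 : y = x := congrArg Prod.fst heq
    refine hne (if_neg ?_)
    rintro ⟨-, -, hc⟩
    exact hc h2.symm
  · intro z _; simp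
  · intro z _; rfl

theorem torusDiff_of_top (y : TorusState k → R) (hy : ∀ s, (∃ z, s.1 z = false) → y s = 0) :
    torusDiff h t k y = 0 := by
  ext s'
  rw [torusDiff_apply]
  refine Finset.sum_eq_zero fun s _ => ?_
  by_cases hs : ∃ z, s.1 z = false
  · rw [hy s hs, mul_zero]
  · rw [LinkDiagram.diffCoeff, Finset.sum_eq_zero, zero_mul]
    intro x _
    exact if_neg fun hc => hs ⟨x, hc.1⟩

/-- A basis state off the oriented smoothing is the chain of its monomial; one on it is already
killed by the first differential. -/
theorem torusDiff_comp_self : torusDiff h t k ∘ₗ torusDiff h t k = 0 := by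
  classical
  refine LinearMap.pi_ext' fun s => LinearMap.ext_ring ?_
  change torusDiff h t k (torusDiff h t k (Pi.single s 1)) = 0
  by_cases hs : ∃ z, s.1 z = false
  · have : Pi.single s 1 = polyChain h t s.1 (prodX R (posX s)) := by
      rw [polyChain_posX h t hs]
      ext s'
      rw [Pi.single_apply]
      simp only [eq_comm]
    rw [this, torusDiff_torusDiff_polyChain]
  · have : torusDiff h t k (Pi.single s 1) = 0 := by
      refine torusDiff_of_top h t _ fun s' hs' => ?_
      have hne : s' ≠ s := by rintro rfl; exact hs hs'
      exact Pi.single_eq_of_ne hne _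
    rw [this, map_zero]

/-! ### Quantum degrees -/

variable (𝒢 : ℤ → AddSubgroup R) [SetLike.GradedMonoid 𝒢]

variable {h t}

theorem powCoeff_mem (hh : h ∈ 𝒢 (-2)) (ht : t ∈ 𝒢 (-4)) (e : ℕ) (l : Bool) :
    powCoeff h t e l ∈ 𝒢 (-2 * e + if l = true then 2 else 0) := by
  induction e generalizing l with
  | zero =>
    cases l
    · simpa [powCoeff] using SetLike.one_mem_graded 𝒢
    · simp [powCoeff]
  | succ e ih =>
    have h1 := ih true
    have h2 := ih false
    simp only [if_true, Bool.false_eq_true, if_false, add_zero] at h1 h2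
    cases l
    · have := SetLike.mul_mem_graded ht h1
      rw [powCoeff]
      convert this using 2
      push_cast; simp; ring
    · rw [powCoeff]
      refine add_mem ?_ ?_
      · convert h2 using 2
        push_cast; simp; ring
      · have := SetLike.mul_mem_graded hh h1
        convert this using 2
        push_cast; simp; ring

theorem comulCoeff_mem (hh : h ∈ 𝒢 (-2)) (ht : t ∈ 𝒢 (-4)) (l a b : Bool) :
    comulCoeff h t l a b ∈ 𝒢 ((-2 - if l = true then 2 else 0) +
      2 * ((if a = true then 1 else 0) + if b = true then 1 else 0)) := by
  have h1 := SetLike.one_mem_graded 𝒢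
  have h0 := fun i => zero_mem (𝒢 i)
  have h2 := neg_mem hh
  cases l <;> cases a <;> cases b <;> simp [comulCoeff] <;> simp_all

theorem sum_circleExponent {v : Fin (2 * k + 1) → Bool} (hv : ∃ z, v z = false)
    (m : Fin (2 * k + 1) →₀ ℕ) :
    ∑ z with v z = false, circleExponent v m z = ∑ i, m i := by
  simp only [circleExponent]
  rw [Finset.sum_comm]
  refine Finset.sum_congr rfl fun i _ => ?_
  rw [Finset.sum_ite_eq, if_pos]
  exact Finset.mem_filter.2 ⟨Finset.mem_univ _, nextZero_spec hv i⟩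

/-- A monomial of total degree `e` has quantum degree `-2e - (2k+1)` at every smoothing. At the
oriented one the degree `-2` of the comultiplication compensates the shift by `2`. Since the
differential fixes polynomials, it preserves the quantum degree. -/
theorem monomialCoord_mem (hh : h ∈ 𝒢 (-2)) (ht : t ∈ 𝒢 (-4)) (s : TorusState k)
    (m : Fin (2 * k + 1) →₀ ℕ) : monomialCoord h t s m ∈
      𝒢 (-2 * (∑ i, m i : ℕ) - (2 * k + 1) - (negativeTorusKnot k).quantumDegree s) := by
  by_cases hs : ∃ z, s.1 z = false
  · rw [monomialCoord, if_pos hs, quantumDegree_eq hs, numX_eq hs]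
    have := SetLike.prod_mem_graded 𝒢
      (fun z => -2 * (circleExponent s.1 m z : ℤ) + if label s z = true then 2 else 0)
      (fun z => powCoeff h t (circleExponent s.1 m z) (label s z))
      (F := Finset.univ.filter fun z => s.1 z = false) fun z _ => powCoeff_mem 𝒢 hh ht _ _
    convert this using 2
    rw [Finset.sum_add_distrib, ← Finset.mul_sum, ← Nat.cast_sum, sum_circleExponent hs,
      ← Finset.sum_filter, Finset.filter_filter, Finset.sum_const, nsmul_eq_mul]
    ring
  · have hs' : ∀ z, s.1 z = true := by simpa using hs
    rw [monomialCoord, if_neg hs, quantumDegree_eq_top hs', numX_eq_top hs']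
    refine sum_mem fun l _ => ?_
    have := SetLike.mul_mem_graded (powCoeff_mem 𝒢 hh ht (∑ i, m i) l)
      (comulCoeff_mem 𝒢 hh ht l (edgeLabel s 0 false) (edgeLabel s 0 true))
    convert this using 2
    have h3 : (Finset.univ.filter fun b => edgeLabel s 0 b = true).card =
        (if edgeLabel s 0 false = true then 1 else 0) +
          if edgeLabel s 0 true = true then 1 else 0 := by
      rw [Finset.card_filter, Fintype.sum_bool, add_comm]
    rw [h3]
    push_cast
    ring

theorem edgeSign_eq_or (v : (negativeTorusKnot k).Vertex) (x : Fin (2 * k + 1)) :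
    (negativeTorusKnot k).edgeSign v x = 1 ∨ (negativeTorusKnot k).edgeSign v x = -1 := by
  rw [LinkDiagram.edgeSign]
  exact neg_one_pow_eq_or _ _

theorem sum_posX (s : TorusState k) :
    ∑ i, (∑ j ∈ posX s, Finsupp.single j (1 : ℕ)) i = (posX s).card := by
  simp only [sum_single_apply]
  simp

theorem card_zeros_update {v : (negativeTorusKnot k).Vertex} {x : Fin (2 * k + 1)}
    (hx : v x = false) : (Finset.univ.filter fun i => v i = false).card =
      (Finset.univ.filter fun i => Function.update v x true i = false).card + 1 := by
  have : (Finset.univ.filter fun i => v i = false) =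
      insert x (Finset.univ.filter fun i => Function.update v x true i = false) := by
    ext i
    by_cases hi : i = x
    · subst hi; simp [hx]
    · simp [hi]
  rw [this, Finset.card_insert_of_notMem (by simp)]

theorem khovanovComplex_isComplex (hh : h ∈ 𝒢 (-2)) (ht : t ∈ 𝒢 (-4)) :
    ((negativeTorusKnot k).khovanovComplex h t 𝒢).IsComplex := by
  refine ⟨torusDiff_comp_self h t, ?_⟩
  refine hasBidegree_mulVecLin 𝒢 (negativeTorusKnot k).homDegree
    (negativeTorusKnot k).quantumDegree ((negativeTorusKnot k).diffCoeff h t) _ 1 0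
    fun s s' hne => ?_
  have hex : ∃ x, s.1 x = false ∧ s'.1 = Function.update s.1 x true := by
    by_contra hc
    exact hne (Finset.sum_eq_zero fun x _ => if_neg fun h1 => hc ⟨x, h1⟩)
  constructor
  · obtain ⟨x, hx, hs'⟩ := hex
    rw [homDegree_eq, homDegree_eq, hs', card_zeros_update hx]
    push_cast; ring
  · refine sum_mem fun x _ => ?_
    split_ifs with hx
    · rw [saddleCoeff_eq h t hx.1 hx.2, polyCoord_prodX]
      have h1 := monomialCoord_mem 𝒢 hh ht s' (∑ j ∈ posX s, Finsupp.single j (1 : ℕ))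
      rw [sum_posX] at h1
      have h2 : (negativeTorusKnot k).quantumDegree s =
          -2 * ((posX s).card : ℤ) - (2 * k + 1) := by
        rw [quantumDegree_eq ⟨x, hx.1⟩, numX_eq ⟨x, hx.1⟩, posX]; ring
      rw [← h2] at h1
      rw [add_zero]
      rcases edgeSign_eq_or s.1 x with h3 | h3
      · rw [h3]; simpa using h1
      · rw [h3]; simpa using neg_mem h1
    · exact zero_mem _

/-- Polynomials whose value is homogeneous of quantum degree `q` when every variable has quantum
degree `-2`. -/
noncomputable def polyPiece (k : ℕ) (q : ℤ) : AddSubgroup (MvPolynomial (Fin (2 * k + 1)) R) :=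
  AddSubgroup.closure {p | ∃ (m : Fin (2 * k + 1) →₀ ℕ) (r : R),
    r ∈ 𝒢 (q + 2 * (∑ i, m i : ℕ)) ∧ p = MvPolynomial.monomial m r}

theorem polyCoord_mem (hh : h ∈ 𝒢 (-2)) (ht : t ∈ 𝒢 (-4)) (s : TorusState k) {q : ℤ}
    {p : MvPolynomial (Fin (2 * k + 1)) R} (hp : p ∈ polyPiece 𝒢 k q) :
    polyCoord h t s p ∈ 𝒢 (q - (2 * k + 1) - (negativeTorusKnot k).quantumDegree s) := by
  refine AddSubgroup.closure_induction (p := fun p _ => polyCoord h t s p ∈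
    𝒢 (q - (2 * k + 1) - (negativeTorusKnot k).quantumDegree s)) ?_ ?_ ?_ ?_ hp
  · rintro _ ⟨m, r, hr, rfl⟩
    rw [polyCoord_monomial]
    have := SetLike.mul_mem_graded hr (monomialCoord_mem 𝒢 hh ht s m)
    convert this using 2
    ring
  · rw [map_zero]; exact zero_mem _
  · intro p p' _ _ h1 h2; rw [map_add]; exact add_mem h1 h2
  · intro p _ h1; rw [map_neg]; exact neg_mem h1

omit [SetLike.GradedMonoid 𝒢] in
theorem X_mul_mem_polyPiece {q : ℤ} {p : MvPolynomial (Fin (2 * k + 1)) R}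
    (hp : p ∈ polyPiece 𝒢 k q) (i : Fin (2 * k + 1)) :
    MvPolynomial.X i * p ∈ polyPiece 𝒢 k (q - 2) := by
  refine AddSubgroup.closure_induction (p := fun p _ => MvPolynomial.X i * p ∈
    polyPiece 𝒢 k (q - 2)) ?_ ?_ ?_ ?_ hp
  · rintro _ ⟨m, r, hr, rfl⟩
    refine AddSubgroup.subset_closure ⟨m + Finsupp.single i 1, r, ?_, ?_⟩
    · rw [sum_add_single]
      convert hr using 2
      push_cast; ring
    · rw [MvPolynomial.X, MvPolynomial.monomial_mul, one_mul,
        add_comm (Finsupp.single i 1) m]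
  · rw [mul_zero]; exact zero_mem _
  · intro p p' _ _ h1 h2; rw [mul_add]; exact add_mem h1 h2
  · intro p _ h1; rw [mul_neg]; exact neg_mem h1

omit [SetLike.GradedMonoid 𝒢] in
theorem C_mem_polyPiece {q : ℤ} {r : R} (hr : r ∈ 𝒢 q) :
    (MvPolynomial.C r : MvPolynomial (Fin (2 * k + 1)) R) ∈ polyPiece 𝒢 k q :=
  AddSubgroup.subset_closure ⟨0, r, by simpa using hr, rfl⟩

omit [SetLike.GradedMonoid 𝒢] in
theorem prod_mul_mem_polyPiece {q : ℤ} {p : MvPolynomial (Fin (2 * k + 1)) R}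
    (hp : p ∈ polyPiece 𝒢 k q) (f g : ℕ → Fin (2 * k + 1)) (I : Finset ℕ) :
    (∏ i ∈ I, (MvPolynomial.X (f i) - MvPolynomial.X (g i))) * p ∈
      polyPiece 𝒢 k (q - 2 * I.card) := by
  induction I using Finset.induction_on with
  | empty => simpa using hp
  | insert i I hi ih =>
    rw [Finset.prod_insert hi, Finset.card_insert_of_notMem hi, mul_assoc, sub_mul]
    have : q - 2 * ((I.card + 1 : ℕ) : ℤ) = q - 2 * I.card - 2 := by push_cast; ring
    rw [this]
    exact sub_mem (X_mul_mem_polyPiece 𝒢 ih _) (X_mul_mem_polyPiece 𝒢 ih _)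

end Differential

/-! ### The acyclic matching of enhanced states -/

section TorusMatching

variable {R : Type u} [CommRing R] {k : ℕ} (h t : R)

/-- The smoothing is oriented before `j` but not at `j`, and between `j` and `x` no crossing is
smoothed in the oriented way and all circles closed there are labelled `X`. -/
def IsPrefix (s : TorusState k) (j x : Fin (2 * k + 1)) : Prop :=
  (∀ y, y < j → s.1 y = true) ∧ s.1 j = false ∧ j < x ∧
    ∀ y, j < y → y < x → s.1 y = false ∧ label s y = true

/-- The state determines both positions: `j` is its first zero and `x` the first later position that
is not a zero labelled `X`. -/
theorem IsPrefix.unique {s : TorusState k} {j x j' x' : Fin (2 * k + 1)} (hs : IsPrefix s j x)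
    (hs' : IsPrefix s j' x') (hx : ¬(s.1 x = false ∧ label s x = true))
    (hx' : ¬(s.1 x' = false ∧ label s x' = true)) : j = j' ∧ x = x' := by
  have hj : j = j' := by
    rcases lt_trichotomy j j' with h1 | h1 | h1
    · have := hs'.1 j h1
      rw [hs.2.1] at this; cases this
    · exact h1
    · have := hs.1 j' h1
      rw [hs'.2.1] at this; cases this
  subst hj
  refine ⟨rfl, ?_⟩
  rcases lt_trichotomy x x' with h1 | h1 | h1
  · exact absurd (hs'.2.2.2 x hs.2.2.1 h1) hx
  · exact h1
  · exact absurd (hs.2.2.2 x' hs'.2.2.1 h1) hx'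

/-- The states `u` and `s` differ at the first position `x` of `IsPrefix`, where `u` closes a
circle labelled `1` and `s` does not. -/
def MatchedAt (u s : TorusState k) (j x : Fin (2 * k + 1)) : Prop :=
  IsPrefix u j x ∧ u.1 x = false ∧ label u x = false ∧ s.1 = Function.update u.1 x true ∧
    ∀ i, s.1 i = false → label s i = label u i

/-- The state `u` has one circle, closed at the last crossing, and `s` is obtained by splitting it
into a left circle with the same label and a right circle labelled `X`. -/
def MatchedTop (u s : TorusState k) : Prop :=
  (∀ y, u.1 y = false ↔ y = Fin.last (2 * k)) ∧ (∀ z, s.1 z = true) ∧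
    edgeLabel s 0 true = true ∧ edgeLabel s 0 false = label u (Fin.last (2 * k))

/-- The matching of states that cancels the Khovanov complex down to its minimal model. -/
def Matched (u s : TorusState k) : Prop := (∃ j x, MatchedAt u s j x) ∨ MatchedTop u s

theorem MatchedAt.eq_false {u s : TorusState k} {j x i : Fin (2 * k + 1)}
    (hm : MatchedAt u s j x) (hi : i ≠ x) : s.1 i = u.1 i := by
  rw [hm.2.2.2.1, Function.update_of_ne hi]

theorem MatchedAt.eq_true {u s : TorusState k} {j x : Fin (2 * k + 1)}
    (hm : MatchedAt u s j x) : s.1 x = true := by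
  rw [hm.2.2.2.1, Function.update_self]

/-- Source and target have the same pair `(j, x)`, so each determines the other, and the value at
`x` tells which of the two a state is. -/
theorem MatchedAt.isPrefix {u s : TorusState k} {j x : Fin (2 * k + 1)}
    (hm : MatchedAt u s j x) : IsPrefix s j x := by
  obtain ⟨h1, h2, h3, h4⟩ := hm.1
  refine ⟨fun y hy => ?_, ?_, h3, fun y hy hy' => ?_⟩
  · rw [hm.eq_false (hy.trans h3).ne, h1 y hy]
  · rw [hm.eq_false h3.ne, h2]
  · have h5 : s.1 y = false := by rw [hm.eq_false hy'.ne, (h4 y hy hy').1]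
    exact ⟨h5, by rw [hm.2.2.2.2 y h5, (h4 y hy hy').2]⟩

theorem not_matchedTop_of_isPrefix {u s : TorusState k} {j x : Fin (2 * k + 1)}
    (hu : IsPrefix u j x) : ¬MatchedTop u s := by
  intro hm
  have h1 := (hm.1 j).1 hu.2.1
  exact absurd (Fin.le_last x) (not_le.2 (h1 ▸ hu.2.2.1))

theorem not_matchedTop_of_isPrefix' {u s : TorusState k} {j x : Fin (2 * k + 1)}
    (hs : IsPrefix s j x) : ¬MatchedTop u s := by
  intro hm
  have := hm.2.1 j
  rw [hs.2.1] at this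
  cases this

theorem MatchedAt.unique_right {u s s' : TorusState k} {j x j' x' : Fin (2 * k + 1)}
    (hm : MatchedAt u s j x) (hm' : MatchedAt u s' j' x') : s = s' := by
  obtain ⟨rfl, rfl⟩ := hm.1.unique hm'.1 (by simp [hm.2.2.1]) (by simp [hm'.2.2.1])
  have h1 : s.1 = s'.1 := by rw [hm.2.2.2.1, hm'.2.2.2.1]
  refine state_ext_zeros ⟨j, hm.isPrefix.2.1⟩ h1 fun i hi => ?_
  rw [hm.2.2.2.2 i hi, hm'.2.2.2.2 i (h1 ▸ hi)]

theorem MatchedAt.unique_left {u u' s : TorusState k} {j x j' x' : Fin (2 * k + 1)}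
    (hm : MatchedAt u s j x) (hm' : MatchedAt u' s j' x') : u = u' := by
  obtain ⟨rfl, rfl⟩ := hm.isPrefix.unique hm'.isPrefix (by simp [hm.eq_true])
    (by simp [hm'.eq_true])
  have h1 : u.1 = u'.1 := by
    funext i
    by_cases hi : i = x
    · subst hi; rw [hm.2.1, hm'.2.1]
    · rw [← hm.eq_false hi, hm'.eq_false hi]
  refine state_ext_zeros ⟨j, hm.1.2.1⟩ h1 fun i hi => ?_
  by_cases hix : i = x
  · subst hix; rw [hm.2.2.1, hm'.2.2.1]
  · have h2 : s.1 i = false := by rw [hm.eq_false hix, hi]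
    rw [← hm.2.2.2.2 i h2, hm'.2.2.2.2 i h2]

theorem Matched.unique_right {u s s' : TorusState k} (hm : Matched u s) (hm' : Matched u s') :
    s = s' := by
  rcases hm with ⟨j, x, hm⟩ | hm <;> rcases hm' with ⟨j', x', hm'⟩ | hm'
  · exact hm.unique_right hm'
  · exact absurd hm' (not_matchedTop_of_isPrefix hm.1)
  · exact absurd hm (not_matchedTop_of_isPrefix hm'.1)
  · refine state_ext_top hm.2.1 hm'.2.1 fun b => ?_
    cases b
    · rw [hm.2.2.2, hm'.2.2.2]
    · rw [hm.2.2.1, hm'.2.2.1]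

theorem Matched.unique_left {u u' s : TorusState k} (hm : Matched u s) (hm' : Matched u' s) :
    u = u' := by
  rcases hm with ⟨j, x, hm⟩ | hm <;> rcases hm' with ⟨j', x', hm'⟩ | hm'
  · exact hm.unique_left hm'
  · exact absurd hm' (not_matchedTop_of_isPrefix' hm.isPrefix)
  · exact absurd hm (not_matchedTop_of_isPrefix' hm'.isPrefix)
  · refine state_ext_zeros ⟨_, (hm.1 _).2 rfl⟩ ?_ fun i hi => ?_
    · funext i
      have := (hm.1 i).trans (hm'.1 i).symm
      revert this
      cases u.1 i <;> cases u'.1 i <;> simp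
    · rw [(hm.1 i).1 hi, ← hm.2.2.2, hm'.2.2.2]

theorem Matched.not_matched {u s w : TorusState k} (hm : Matched u s) : ¬Matched s w := by
  intro hm'
  rcases hm with ⟨j, x, hm⟩ | hm <;> rcases hm' with ⟨j', x', hm'⟩ | hm'
  · obtain ⟨rfl, rfl⟩ := hm.isPrefix.unique hm'.1 (by simp [hm.eq_true]) (by simp [hm'.2.2.1])
    have := hm.eq_true
    rw [hm'.2.1] at this
    cases this
  · exact not_matchedTop_of_isPrefix hm.isPrefix hm'
  · have := hm.2.1 j'
    rw [hm'.1.2.1] at this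
    cases this
  · have := hm.2.1 (Fin.last _)
    rw [(hm'.1 _).2 rfl] at this
    cases this

theorem exists_matched_of_isPrefix_of_false {s : TorusState k} {j x : Fin (2 * k + 1)}
    (hs : IsPrefix s j x) (hx : s.1 x = false) (hl : label s x = false) : ∃ w, Matched s w := by
  have hv : ∃ z, Function.update s.1 x true z = false :=
    ⟨j, by rw [Function.update_of_ne hs.2.2.1.ne, hs.2.1]⟩
  exact ⟨stateOf _ hv (label s), Or.inl ⟨j, x, hs, hx, hl, rfl,
    fun i hi => label_stateOf hv _ hi⟩⟩

theorem exists_matched_of_isPrefix_of_true {s : TorusState k} {j x : Fin (2 * k + 1)}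
    (hs : IsPrefix s j x) (hx : s.1 x = true) : ∃ u, Matched u s := by
  have hv : ∃ z, Function.update s.1 x false z = false := ⟨x, Function.update_self ..⟩
  have hne : ∀ i, s.1 i = false → i ≠ x := by
    rintro i hi rfl; rw [hx] at hi; cases hi
  have hlab : ∀ i, i ≠ x → s.1 i = false →
      label (stateOf _ hv fun i => if i = x then false else label s i) i = label s i := by
    intro i hi hi'
    rw [label_stateOf hv _ (by rw [Function.update_of_ne hi, hi']), if_neg hi]
  refine ⟨stateOf _ hv fun i => if i = x then false else label s i, Or.inl ⟨j, x,
    ⟨fun y hy => ?_, ?_, hs.2.2.1, fun y hy hy' => ⟨?_, ?_⟩⟩, ?_, ?_, ?_, ?_⟩⟩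
  · change Function.update s.1 x false y = true
    rw [Function.update_of_ne (hy.trans hs.2.2.1).ne, hs.1 y hy]
  · change Function.update s.1 x false j = false
    rw [Function.update_of_ne hs.2.2.1.ne, hs.2.1]
  · change Function.update s.1 x false y = false
    rw [Function.update_of_ne hy'.ne, (hs.2.2.2 y hy hy').1]
  · rw [hlab y hy'.ne (hs.2.2.2 y hy hy').1, (hs.2.2.2 y hy hy').2]
  · exact Function.update_self ..
  · rw [label_stateOf hv _ (Function.update_self ..), if_pos rfl]
  · change _ = Function.update (Function.update s.1 x false) x true
    rw [Function.update_idem, ← hx, Function.update_eq_self]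
  · intro i hi
    rw [hlab i (hne i hi) hi]

theorem exists_matched_of_last {s : TorusState k}
    (hs : ∀ y, s.1 y = false ↔ y = Fin.last (2 * k)) : ∃ w, Matched s w :=
  ⟨topState k fun b => if b = true then true else label s (Fin.last (2 * k)),
    Or.inr ⟨hs, fun _ => rfl, rfl, rfl⟩⟩

theorem exists_matched_of_top {s : TorusState k} (hs : ∀ z, s.1 z = true)
    (hl : edgeLabel s 0 true = true) : ∃ u, Matched u s := by
  have hv : ∃ z, (fun z : Fin (2 * k + 1) => decide (z ≠ Fin.last (2 * k))) z = false :=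
    ⟨Fin.last _, by simp⟩
  refine ⟨stateOf _ hv fun _ => edgeLabel s 0 false, Or.inr ⟨fun y => ?_, hs, hl, ?_⟩⟩
  · change decide (y ≠ Fin.last (2 * k)) = false ↔ _
    simp
  · rw [label_stateOf hv _ (by simp)]

/-! ### Coefficients of the differential -/

theorem diffCoeff_eq {s s' : TorusState k} {x : Fin (2 * k + 1)} (hx : s.1 x = false)
    (hs' : s'.1 = Function.update s.1 x true) : (negativeTorusKnot k).diffCoeff h t s s' =
      ((negativeTorusKnot k).edgeSign s.1 x : R) *
        (negativeTorusKnot k).saddleCoeff h t x s s' := by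
  rw [LinkDiagram.diffCoeff, Finset.sum_eq_single x]
  · rw [if_pos ⟨hx, hs'⟩]
  · intro y _ hy
    refine if_neg ?_
    rintro ⟨h1, h2⟩
    have : s'.1 y = true := by rw [h2, Function.update_self]
    rw [hs', Function.update_of_ne hy, h1] at this
    cases this
  · simp

/-- The circle that disappears carries the unit `1`, so both states have the same monomial. This
yields the coefficient `±1` and the equality of quantum degrees. -/
theorem MatchedAt.posX_eq {u s : TorusState k} {j x : Fin (2 * k + 1)} (hm : MatchedAt u s j x) :
    posX u = posX s := by
  ext i
  rw [mem_posX, mem_posX]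
  by_cases hi : i = x
  · subst hi; simp [hm.2.2.1, hm.eq_true]
  · rw [hm.eq_false hi]
    refine and_congr_right fun h1 => ?_
    rw [hm.2.2.2.2 i (by rw [hm.eq_false hi, h1])]

theorem posX_of_last {u : TorusState k} (hu : ∀ y, u.1 y = false ↔ y = Fin.last (2 * k)) :
    (posX u).card = if label u (Fin.last (2 * k)) = true then 1 else 0 := by
  have : posX u = if label u (Fin.last (2 * k)) = true then {Fin.last (2 * k)} else ∅ := by
    ext i
    rw [mem_posX, hu]
    split_ifs with h1
    · rw [Finset.mem_singleton]
      exact ⟨fun h => h.1, fun h => ⟨h, h ▸ h1⟩⟩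
    · simp only [Finset.notMem_empty, iff_false, not_and]
      rintro rfl; exact h1
  rw [this]
  split_ifs <;> simp

/-- Among the terms of `Δ 1` and `Δ X` whose right factor is `X`, there is only `1 ⊗ X` and `X ⊗ X`
respectively, each with coefficient `1`. -/
theorem saddleCoeff_of_last {u s : TorusState k} (hu : ∀ y, u.1 y = false ↔ y = Fin.last (2 * k))
    (hus : s.1 = Function.update u.1 (Fin.last (2 * k)) true) (hs : ∀ z, s.1 z = true)
    (hl : edgeLabel s 0 true = true) :
    (negativeTorusKnot k).saddleCoeff h t (Fin.last (2 * k)) u s =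
      if edgeLabel s 0 false = label u (Fin.last (2 * k)) then 1 else 0 := by
  rw [saddleCoeff_eq h t ((hu _).2 rfl) hus, polyCoord_prodX, monomialCoord,
    if_neg (by rintro ⟨z, hz⟩; rw [hs z] at hz; cases hz), sum_posX, posX_of_last hu, hl]
  simp only [powCoeff_ite, Fintype.univ_bool, Finset.mem_singleton, Bool.true_eq_false,
    not_false_eq_true, Finset.sum_insert, Finset.sum_singleton]
  cases label u (Fin.last (2 * k)) <;> cases edgeLabel s 0 false <;> simp [comulCoeff]

theorem MatchedTop.update_eq {u s : TorusState k} (hm : MatchedTop u s) :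
    s.1 = Function.update u.1 (Fin.last (2 * k)) true := by
  funext i
  rw [hm.2.1 i]
  by_cases hi : i = Fin.last (2 * k)
  · subst hi; rw [Function.update_self]
  · rw [Function.update_of_ne hi]
    cases h1 : u.1 i
    · exact absurd ((hm.1 i).1 h1) hi
    · rfl

theorem Matched.diffCoeff_eq_or {u s : TorusState k} (hm : Matched u s) :
    (negativeTorusKnot k).diffCoeff h t u s = 1 ∨
      (negativeTorusKnot k).diffCoeff h t u s = -1 := by
  have key : ∃ x, (negativeTorusKnot k).diffCoeff h t u s =
      ((negativeTorusKnot k).edgeSign u.1 x : R) := by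
    rcases hm with ⟨j, x, hm⟩ | hm
    · refine ⟨x, ?_⟩
      rw [diffCoeff_eq h t hm.2.1 hm.2.2.2.1, saddleCoeff_eq h t hm.2.1 hm.2.2.2.1, hm.posX_eq,
        polyCoord_posX_self h t ⟨j, hm.isPrefix.2.1⟩ rfl, if_pos rfl, mul_one]
    · refine ⟨Fin.last (2 * k), ?_⟩
      rw [diffCoeff_eq h t ((hm.1 _).2 rfl) hm.update_eq,
        saddleCoeff_of_last h t hm.1 hm.update_eq hm.2.1 hm.2.2.1, if_pos hm.2.2.2, mul_one]
  obtain ⟨x, hx⟩ := key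
  rw [hx]
  rcases edgeSign_eq_or u.1 x with h1 | h1 <;> rw [h1] <;> simp

theorem Matched.homDegree_eq {u s : TorusState k} (hm : Matched u s) :
    (negativeTorusKnot k).homDegree s = (negativeTorusKnot k).homDegree u + 1 := by
  obtain ⟨x, hx, hs⟩ : ∃ x, u.1 x = false ∧ s.1 = Function.update u.1 x true := by
    rcases hm with ⟨j, x, hm⟩ | hm
    · exact ⟨x, hm.2.1, hm.2.2.2.1⟩
    · exact ⟨_, (hm.1 _).2 rfl, hm.update_eq⟩
  rw [Khovanov.homDegree_eq, Khovanov.homDegree_eq, hs, card_zeros_update hx]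
  push_cast; ring

theorem Matched.quantumDegree_eq {u s : TorusState k} (hm : Matched u s) :
    (negativeTorusKnot k).quantumDegree s = (negativeTorusKnot k).quantumDegree u := by
  rcases hm with ⟨j, x, hm⟩ | hm
  · have hv : ∃ z, u.1 z = false := ⟨x, hm.2.1⟩
    have hv' : ∃ z, s.1 z = false := ⟨j, hm.isPrefix.2.1⟩
    have := congrArg Finset.card hm.posX_eq
    rw [posX, posX] at this
    rw [Khovanov.quantumDegree_eq hv, Khovanov.quantumDegree_eq hv', numX_eq hv, numX_eq hv', this]
  · have hv : ∃ z, u.1 z = false := ⟨_, (hm.1 _).2 rfl⟩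
    have := posX_of_last hm.1
    rw [posX] at this
    rw [Khovanov.quantumDegree_eq hv, quantumDegree_eq_top hm.2.1, numX_eq hv, numX_eq_top hm.2.1,
      this, Finset.card_filter, Fintype.sum_bool, hm.2.2.1, hm.2.2.2]
    cases label u (Fin.last (2 * k)) <;> simp <;> ring

/-! ### Acyclicity -/

/-- A rank that orders smoothings lexicographically. -/
def vertexRank (v : Fin (2 * k + 1) → Bool) : ℕ :=
  ∑ z, if v z = true then 2 ^ (2 * k + 1 - z.val) else 0

theorem vertexRank_update {v : Fin (2 * k + 1) → Bool} {x : Fin (2 * k + 1)} (hx : v x = false) :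
    vertexRank (Function.update v x true) = vertexRank v + 2 ^ (2 * k + 1 - x.val) := by
  have : ∀ z, (if Function.update v x true z = true then 2 ^ (2 * k + 1 - z.val) else 0) =
      (if v z = true then 2 ^ (2 * k + 1 - z.val) else 0) +
        if z = x then 2 ^ (2 * k + 1 - x.val) else 0 := by
    intro z
    by_cases hz : z = x
    · subst hz; simp [hx]
    · simp [hz]
  rw [vertexRank, Finset.sum_congr rfl fun z _ => this z, Finset.sum_add_distrib]
  simp [vertexRank]

theorem vertexRank_update_lt {v : Fin (2 * k + 1) → Bool} {x y : Fin (2 * k + 1)}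
    (hx : v x = false) (hy : v y = false) (hxy : y < x) :
    vertexRank (Function.update v x true) < vertexRank (Function.update v y true) := by
  rw [vertexRank_update hx, vertexRank_update hy]
  have : 2 ^ (2 * k + 1 - x.val) < 2 ^ (2 * k + 1 - y.val) :=
    Nat.pow_lt_pow_right (by norm_num) (by omega)
  omega

theorem label_eq_of_saddleCoeff_ne_zero {s s' : TorusState k} {y i : Fin (2 * k + 1)}
    (hy : s.1 y = false) (hne : (negativeTorusKnot k).saddleCoeff h t y s s' ≠ 0)
    (hi : nextZero s.1 i ≠ y) (hi' : nextZero s.1 i ≠ nextZero s.1 (y + 1)) :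
    label s i = label s' i := by
  unfold LinkDiagram.saddleCoeff at hne
  have hv : ∃ z, s.1 z = false := ⟨y, hy⟩
  by_cases hc : ∀ e : Fin (2 * k + 1) × Bool, (negativeTorusKnot k).circle s.1 e ≠
      (negativeTorusKnot k).circle s.1 (y, false) → (negativeTorusKnot k).circle s.1 e ≠
      (negativeTorusKnot k).circle s.1 (y + 1, true) →
      s.2 ((negativeTorusKnot k).circle s.1 e) = s'.2 ((negativeTorusKnot k).circle s'.1 e)
  · refine hc (i, false) ?_ ?_
    · rwa [Ne, circle_eq_iff hv, nextZero_of_false hy]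
    · rwa [Ne, circle_eq_iff hv]
  · exact absurd (if_neg hc) hne

/-- The search for a zero starts beyond `y` and, if it wraps around, stops at `j` at the latest. So
a merge at `y` does not touch circles closed strictly between `j` and `y`. -/
theorem nextZero_succ_ne_of_lt {v : Fin (2 * k + 1) → Bool} {j i y : Fin (2 * k + 1)}
    (hj : v j = false) (hji : j < i) (hiy : i < y) : nextZero v (y + 1) ≠ i := by
  have h1 := nextZero_mem (v := v) ⟨j, hj⟩ (p := fun z => z ≤ j ∨ y < z) ?_ (y + 1) ?_
  · rintro rfl
    rcases h1 with h1 | h1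
    · exact absurd hji (not_lt.2 h1)
    · exact absurd hiy (not_lt.2 h1.le)
  · intro z hz hp
    have hzj : z ≠ j := by rintro rfl; rw [hj] at hz; cases hz
    have h2 := Fin.val_add_one z
    have h3 : z.val ≠ j.val := fun h => hzj (Fin.ext h)
    rw [Fin.le_def, Fin.lt_def] at hp ⊢
    split_ifs at h2 with h4 <;> omega
  · have h2 := Fin.val_add_one y
    rw [Fin.le_def, Fin.lt_def]
    split_ifs at h2 with h4 <;> omega

/-- Suppose `s'` arises from `u` by switching `y`, where `s` arises by switching `x`. If `y < x`,
the lexicographic rank of `s'` is larger. If `y = x`, multiplication by the unit leaves only `s' =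
s`. If `y > x`, then `s'` inherits the prefix of `u` up to `x`, so it is a source and cannot be a
target. -/
theorem Matched.vertexRank_lt {u s w s' : TorusState k} (hm : Matched u s) (hm' : Matched w s')
    (hss : s ≠ s') (hne : (negativeTorusKnot k).diffCoeff h t u s' ≠ 0) :
    vertexRank s.1 < vertexRank s'.1 := by
  obtain ⟨y, hy, hs'⟩ : ∃ y, u.1 y = false ∧ s'.1 = Function.update u.1 y true := by
    by_contra hc
    exact hne (Finset.sum_eq_zero fun x _ => if_neg fun h1 => hc ⟨x, h1⟩)
  rw [diffCoeff_eq h t hy hs'] at hne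
  have hsad := right_ne_zero_of_mul hne
  rcases hm with ⟨j, x, hm⟩ | hm
  · rcases lt_trichotomy y x with hlt | heq | hlt
    · rw [hs', hm.2.2.2.1]
      exact vertexRank_update_lt hm.2.1 hy hlt
    · subst heq
      rw [saddleCoeff_eq h t hy hs', hm.posX_eq, polyCoord_posX_self h t ⟨j, hm.isPrefix.2.1⟩
        (by rw [hs', hm.2.2.2.1]), if_neg hss] at hsad
      exact absurd rfl hsad
    · exfalso
      have hlab : ∀ i, j < i → i ≤ x → u.1 i = false → label u i = label s' i := by
        intro i hji hix hi
        refine label_eq_of_saddleCoeff_ne_zero h t hy hsad ?_ ?_ <;> rw [nextZero_of_false hi]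
        · exact (hix.trans_lt hlt).ne
        · exact (nextZero_succ_ne_of_lt hm.1.2.1 hji (hix.trans_lt hlt)).symm
      have hjx := hm.1.2.2.1
      have hv : ∀ i, i ≤ x → s'.1 i = u.1 i := fun i hi => by
        rw [hs', Function.update_of_ne (hi.trans_lt hlt).ne]
      have hpre : IsPrefix s' j x := by
        refine ⟨fun i hi => ?_, ?_, hjx, fun i hi hi' => ?_⟩
        · rw [hv i (hi.trans hjx).le, hm.1.1 i hi]
        · rw [hv j hjx.le, hm.1.2.1]
        · obtain ⟨h1, h2⟩ := hm.1.2.2.2 i hi hi'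
          exact ⟨by rw [hv i hi'.le, h1], by rw [← hlab i hi hi'.le h1, h2]⟩
      have hx1 : s'.1 x = false := by rw [hv x le_rfl, hm.2.1]
      have hx2 : label s' x = false := by rw [← hlab x hjx le_rfl hm.2.1, hm.2.2.1]
      exact hm'.not_matched (exists_matched_of_isPrefix_of_false hpre hx1 hx2).choose_spec
  · exfalso
    -- From the single circle only the split at the last crossing is possible, and a target at the
    -- oriented smoothing has right label `X`; this leaves only the matched partner.
    obtain rfl := (hm.1 y).1 hy
    have htop : ∀ z, s'.1 z = true := by
      intro z; rw [hs', ← hm.update_eq, hm.2.1]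
    rcases hm' with ⟨j, x, hm'⟩ | hm'
    · have := htop j
      rw [hm'.isPrefix.2.1] at this
      cases this
    · rw [saddleCoeff_of_last h t hm.1 hs' htop hm'.2.2.1] at hsad
      have h1 : edgeLabel s' 0 false = label u (Fin.last (2 * k)) := by
        by_contra hc
        exact hsad (if_neg hc)
      refine hss (state_ext_top hm.2.1 htop fun b => ?_)
      cases b
      · rw [hm.2.2.2, h1]
      · rw [hm.2.2.1, hm'.2.2.1]

/-- The smoothing that is oriented exactly before the crossing `j`. -/
def initVertex (k j : ℕ) : Fin (2 * k + 1) → Bool := fun i => decide (i.val < j)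

/-- The unmatched states. -/
theorem unmatched_cases (s : TorusState k) :
    (∃ w, Matched s w) ∨ (∃ u, Matched u s) ∨
    (∃ j : Fin (2 * k + 1), j.val < 2 * k ∧ s.1 = initVertex k j ∧ ∀ y, j < y → label s y = true) ∨
    ((∀ z, s.1 z = true) ∧ edgeLabel s 0 true = false) := by
  by_cases hs : ∃ z, s.1 z = false
  · obtain ⟨j, hj, hjmin⟩ : ∃ j, s.1 j = false ∧ ∀ y, y < j → s.1 y = true := by
      obtain ⟨j, hj, hmin⟩ := WellFounded.has_min (wellFounded_lt (α := Fin (2 * k + 1)))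
        {z | s.1 z = false} hs
      refine ⟨j, hj, fun y hy => ?_⟩
      by_contra hc
      exact hmin y (Bool.eq_false_of_not_eq_true hc) hy
    by_cases hbad : ∃ x, j < x ∧ ¬(s.1 x = false ∧ label s x = true)
    · obtain ⟨x, hx, hxmin⟩ : ∃ x, (j < x ∧ ¬(s.1 x = false ∧ label s x = true)) ∧
          ∀ y, y < x → ¬(j < y ∧ ¬(s.1 y = false ∧ label s y = true)) := by
        obtain ⟨x, hx, hmin⟩ := WellFounded.has_min (wellFounded_lt (α := Fin (2 * k + 1)))
          {x | j < x ∧ ¬(s.1 x = false ∧ label s x = true)} hbad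
        exact ⟨x, hx, fun y hy hc => hmin y hc hy⟩
      have hpre : IsPrefix s j x := ⟨hjmin, hj, hx.1, fun y hy hy' => by
        by_contra hc
        exact hxmin y hy' ⟨hy, hc⟩⟩
      cases hsx : s.1 x
      · left
        refine exists_matched_of_isPrefix_of_false hpre hsx ?_
        simpa [hsx] using hx.2
      · right; left
        exact exists_matched_of_isPrefix_of_true hpre hsx
    · push Not at hbad
      have hv : s.1 = initVertex k j := by
        funext i
        rw [initVertex]
        rcases lt_trichotomy i j with hij | hij | hij
        · rw [hjmin i hij]; simpa using hij
        · rw [hij, hj]; simp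
        · rw [(hbad i hij).1]; simpa using hij.le
      -- For `j = 2k` there is one circle, and its states are sources of the top matching; only `j <
      -- 2k` gives unmatched states.
      by_cases hjk : j.val < 2 * k
      · exact Or.inr (Or.inr (Or.inl ⟨j, hjk, hv, fun y hy => (hbad y hy).2⟩))
      · left
        refine exists_matched_of_last fun y => ?_
        have hy : y.val < 2 * k + 1 := y.isLt
        have hj' : j.val < 2 * k + 1 := j.isLt
        rw [hv, initVertex, decide_eq_false_iff_not, Fin.ext_iff, Fin.val_last]
        omega
  · have hs' : ∀ z, s.1 z = true := by simpa using hs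
    cases hl : edgeLabel s 0 true
    · exact Or.inr (Or.inr (Or.inr ⟨hs', rfl⟩))
    · exact Or.inr (Or.inl (exists_matched_of_top hs' hl))

end TorusMatching

/-! ### The basis `1, X` of the Frobenius algebra -/

section Coordinates

variable {R : Type u} [CommRing R] (h t : R)

theorem frobenius_monic :
    (Polynomial.X ^ 2 - Polynomial.C h * Polynomial.X - Polynomial.C t : R[X]).Monic := by
  monicity!

theorem frobenius_natDegree [Nontrivial R] :
    (Polynomial.X ^ 2 - Polynomial.C h * Polynomial.X - Polynomial.C t : R[X]).natDegree = 2 := by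
  compute_degree!

/-- The coordinates of an element of `A` in the basis `1, X`. -/
noncomputable def frobeniusCoord (l : Bool) : FrobeniusAlgebra h t →ₗ[R] R :=
  Polynomial.lcoeff R (if l = true then 1 else 0) ∘ₗ
    AdjoinRoot.modByMonicHom (frobenius_monic h t)

theorem frobeniusCoord_smul_add (r s : R) (l : Bool) :
    frobeniusCoord h t l (r • 1 + s • genX h t) = if l = true then s else r := by
  nontriviality R
  have h1 : (r • 1 + s • genX h t : FrobeniusAlgebra h t) =
      AdjoinRoot.mk _ (Polynomial.C s * Polynomial.X + Polynomial.C r) := by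
    rw [genX, Algebra.smul_def, Algebra.smul_def, map_add, map_mul, AdjoinRoot.mk_X,
      AdjoinRoot.mk_C, AdjoinRoot.mk_C, mul_one, add_comm]
    rfl
  rw [frobeniusCoord, LinearMap.comp_apply, h1, AdjoinRoot.modByMonicHom_mk,
    (Polynomial.modByMonic_eq_self_iff (frobenius_monic h t)).2]
  · cases l <;> simp
  · rw [Polynomial.degree_eq_natDegree (frobenius_monic h t).ne_zero, frobenius_natDegree]
    exact lt_of_le_of_lt Polynomial.degree_linear_le (by norm_num)

/-- Division with remainder by the monic quadratic leaves a linear polynomial. -/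
theorem frobeniusCoord_spec (a : FrobeniusAlgebra h t) :
    a = frobeniusCoord h t false a • 1 + frobeniusCoord h t true a • genX h t := by
  -- Over the zero ring the quadratic does not have degree `2`, but then `A` is trivial.
  rcases subsingleton_or_nontrivial R with hR | hR
  · have := Module.subsingleton R (FrobeniusAlgebra h t)
    exact Subsingleton.elim _ _
  induction a using AdjoinRoot.induction_on with
  | ih p =>
    have h1 : p %ₘ (Polynomial.X ^ 2 - Polynomial.C h * Polynomial.X - Polynomial.C t : R[X]) =
        Polynomial.C (frobeniusCoord h t true (AdjoinRoot.mk _ p)) * Polynomial.X +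
          Polynomial.C (frobeniusCoord h t false (AdjoinRoot.mk _ p)) := by
      have h2 := Polynomial.natDegree_modByMonic_lt p (frobenius_monic h t) (by
        intro hc
        have := frobenius_natDegree h t
        rw [hc, Polynomial.natDegree_one] at this
        cases this)
      rw [frobenius_natDegree] at h2
      have h3 := Polynomial.eq_X_add_C_of_natDegree_le_one (Nat.le_of_lt_succ h2)
      simpa [frobeniusCoord] using h3
    have h4 : AdjoinRoot.mk (Polynomial.X ^ 2 - Polynomial.C h * Polynomial.X - Polynomial.C t) p =
        AdjoinRoot.mk _ (p %ₘ
          (Polynomial.X ^ 2 - Polynomial.C h * Polynomial.X - Polynomial.C t : R[X])) :=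
      (AdjoinRoot.mk_leftInverse (frobenius_monic h t) (AdjoinRoot.mk _ p)).symm
    rw [h1] at h4
    conv_lhs => rw [h4]
    rw [genX, Algebra.smul_def, Algebra.smul_def, map_add, map_mul, AdjoinRoot.mk_X,
      AdjoinRoot.mk_C, AdjoinRoot.mk_C, mul_one, add_comm]
    rfl

theorem frobenius_ext {a b : FrobeniusAlgebra h t}
    (hab : ∀ l, frobeniusCoord h t l a = frobeniusCoord h t l b) : a = b := by
  rw [frobeniusCoord_spec h t a, frobeniusCoord_spec h t b, hab, hab]

theorem genX_sq : genX h t * genX h t = h • genX h t + t • 1 := by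
  have h1 : AdjoinRoot.mk (Polynomial.X ^ 2 - Polynomial.C h * Polynomial.X - Polynomial.C t)
      (Polynomial.X ^ 2 - Polynomial.C h * Polynomial.X - Polynomial.C t) = 0 := AdjoinRoot.mk_self
  rw [map_sub, map_sub, map_mul, map_pow, AdjoinRoot.mk_X, AdjoinRoot.mk_C, AdjoinRoot.mk_C] at h1
  rw [genX, Algebra.smul_def, Algebra.smul_def, AdjoinRoot.algebraMap_eq]
  linear_combination h1

theorem frobeniusCoord_mapU (a : FrobeniusAlgebra h t) (l : Bool) :
    frobeniusCoord h t l (mapU h t a) =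
      if l = true then 2 * frobeniusCoord h t false a + h * frobeniusCoord h t true a
      else 2 * t * frobeniusCoord h t true a - h * frobeniusCoord h t false a := by
  rw [← frobeniusCoord_smul_add h t]
  congr 1
  conv_lhs => rw [frobeniusCoord_spec h t a]
  generalize frobeniusCoord h t false a = r
  generalize frobeniusCoord h t true a = s
  have h1 := genX_sq h t
  rw [mapU, LinearMap.mulLeft_apply]
  simp only [Algebra.smul_def, map_add, map_sub, map_mul, map_ofNat] at h1 ⊢
  linear_combination (2 * algebraMap R (FrobeniusAlgebra h t) s) * h1

end Coordinates

/-! ### The copies of `A` generated by the kernel elements -/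

section MinimalComplex

variable {R : Type u} [CommRing R] {k : ℕ} (h t : R)

/-- The variable of the `i`-th crossing, indices being taken modulo `2k+1`. -/
noncomputable abbrev cyclicX (R : Type u) [CommRing R] (k i : ℕ) :
    MvPolynomial (Fin (2 * k + 1)) R := MvPolynomial.X (Fin.ofNat (2 * k + 1) i)

theorem val_ofNat {i : ℕ} (hi : i < 2 * k + 1) : (Fin.ofNat (2 * k + 1) i).val = i :=
  Nat.mod_eq_of_lt hi

theorem cyclicX_period : cyclicX R k (2 * k + 1) = MvPolynomial.X 0 := by
  rw [cyclicX]
  congr 1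
  ext
  simp [Fin.ofNat]

theorem initVertex_ofNat {i j : ℕ} (hi : i < 2 * k + 1) :
    initVertex k j (Fin.ofNat (2 * k + 1) i) = decide (i < j) := by
  rw [initVertex, val_ofNat hi]

theorem initVertex_eq_false {j : ℕ} {i : Fin (2 * k + 1)} :
    initVertex k j i = false ↔ j ≤ i.val := by
  simp [initVertex]

theorem exists_initVertex_eq_false {j : ℕ} (hj : j < 2 * k + 1) :
    ∃ z, initVertex k j z = false :=
  ⟨⟨j, hj⟩, by simp [initVertex]⟩

/-- In particular `X_0` lies on the circle closed at `j`, which is why `algebraPoly` can use this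
one variable for all `j`. -/
theorem nextZero_initVertex {j : ℕ} (hj : j < 2 * k + 1) {i : ℕ} (hi : i ≤ j) :
    nextZero (initVertex k j) (Fin.ofNat (2 * k + 1) i) = Fin.ofNat (2 * k + 1) j := by
  induction hi using Nat.decreasingInduction with
  | of_succ i hi ih =>
    rw [nextZero_of_true (exists_initVertex_eq_false hj)
      (by rw [initVertex_ofNat (by omega)]; simpa using hi),
      add_comm (Fin.ofNat (2 * k + 1) i) 1, ← ofNat_succ, ih]
  | self =>
    exact nextZero_of_false (by rw [initVertex_ofNat hj]; simp)

/-- The element `∏ (Xᵢ - Xᵢ₊₁)`, over the crossings `i` after `j`, that generates the kernel of all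
merging maps at these crossings. -/
noncomputable def kernelPoly (R : Type u) [CommRing R] (k j : ℕ) :
    MvPolynomial (Fin (2 * k + 1)) R :=
  ∏ i ∈ Finset.Ico (j + 1) (2 * k + 1), (cyclicX R k i - cyclicX R k (i + 1))

theorem kernelPoly_eq {j : ℕ} (hj : j < 2 * k) : kernelPoly R k j =
    (cyclicX R k (j + 1) - cyclicX R k (j + 2)) * kernelPoly R k (j + 1) := by
  rw [kernelPoly, kernelPoly, Finset.prod_eq_prod_Ico_succ_bot (by omega)]

/-- The polynomial `r + s X₀` representing the element `r + s X` of `A`. -/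
noncomputable def algebraPoly (k : ℕ) :
    FrobeniusAlgebra h t →ₗ[R] MvPolynomial (Fin (2 * k + 1)) R :=
  (frobeniusCoord h t false).smulRight 1 +
    (frobeniusCoord h t true).smulRight (MvPolynomial.X 0)

theorem algebraPoly_apply (a : FrobeniusAlgebra h t) : algebraPoly h t k a =
    MvPolynomial.C (frobeniusCoord h t false a) +
      MvPolynomial.C (frobeniusCoord h t true a) * MvPolynomial.X 0 := by
  rw [algebraPoly, LinearMap.add_apply, LinearMap.smulRight_apply, LinearMap.smulRight_apply,
    MvPolynomial.smul_eq_C_mul, MvPolynomial.smul_eq_C_mul, mul_one]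

/-- The copy of `A` in the Khovanov complex at the smoothing that is oriented exactly before the
crossing `j`. -/
noncomputable def minimalChain (k j : ℕ) : FrobeniusAlgebra h t →ₗ[R] (TorusState k → R) :=
  polyChain h t (initVertex k j) ∘ₗ LinearMap.mulLeft R (kernelPoly R k j) ∘ₗ algebraPoly h t k

theorem minimalChain_apply (j : ℕ) (a : FrobeniusAlgebra h t) : minimalChain h t k j a =
    polyChain h t (initVertex k j) (kernelPoly R k j * algebraPoly h t k a) := rfl

variable {h t} in
theorem quadratic_mem (v : Fin (2 * k + 1) → Bool) (i : Fin (2 * k + 1)) :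
    (MvPolynomial.X i ^ 2 - MvPolynomial.C h * MvPolynomial.X i - MvPolynomial.C t :
      MvPolynomial (Fin (2 * k + 1)) R) ∈ circleIdeal h t v :=
  Ideal.subset_span (Or.inr ⟨i, rfl⟩)

variable {h t} in
theorem sub_mem_circleIdeal {v : Fin (2 * k + 1) → Bool} {i j : Fin (2 * k + 1)}
    (hij : nextZero v i = nextZero v j) :
    (MvPolynomial.X i - MvPolynomial.X j : MvPolynomial (Fin (2 * k + 1)) R) ∈
      circleIdeal h t v :=
  Ideal.subset_span (Or.inl ⟨i, j, hij, rfl⟩)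

/-- Moving a variable through `kernelPoly` conjugates it once for every factor. -/
theorem kernelPoly_mul_cyclicX (v : Fin (2 * k + 1) → Bool) (m : ℕ) :
    ∀ l, l + m = 2 * k → kernelPoly R k l * cyclicX R k (l + 1) - kernelPoly R k l *
      (if Even m then MvPolynomial.X 0 else MvPolynomial.C h - MvPolynomial.X 0) ∈
        circleIdeal h t v := by
  induction m with
  | zero =>
    intro l hl
    -- No factor is left to cross, and cyclically the variable is `X_0`.
    obtain rfl : l = 2 * k := by omega
    rw [cyclicX_period, if_pos Even.zero, sub_self]
    exact zero_mem _
  | succ m ih =>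
    intro l hl
    rw [kernelPoly_eq (by omega)]
    have h1 := ih (l + 1) (by omega)
    have h2 := quadratic_mem (h := h) (t := t) v (Fin.ofNat (2 * k + 1) (l + 1))
    have h3 := quadratic_mem (h := h) (t := t) v (Fin.ofNat (2 * k + 1) (l + 2))
    -- The difference of the two quadratic relations is `(X_{l+1} - X_{l+2})(X_{l+1} + X_{l+2} -
    -- h)`. Hence in front of this factor `X_{l+1}` acts as `h - X_{l+2}`, to which the induction
    -- hypothesis applies.
    have h4 := sub_mem (Ideal.mul_mem_left _ (kernelPoly R k (l + 1)) (sub_mem h2 h3))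
      (Ideal.mul_mem_left _ (cyclicX R k (l + 1) - cyclicX R k (l + 2)) h1)
    convert h4 using 1
    by_cases hm : Even m
    · rw [if_neg (by simpa [Nat.even_add_one] using hm), if_pos hm]
      ring
    · rw [if_pos (by simpa [Nat.even_add_one] using hm), if_neg hm]
      ring

theorem polyChain_congr (v : Fin (2 * k + 1) → Bool) {p q : MvPolynomial (Fin (2 * k + 1)) R}
    (hpq : p - q ∈ circleIdeal h t v) : polyChain h t v p = polyChain h t v q := by
  rw [← sub_eq_zero, ← map_sub]
  exact polyChain_eq_zero h t (fun _ => id) hpq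

theorem update_initVertex {j : ℕ} (hj : j < 2 * k + 1) :
    Function.update (initVertex k j) (Fin.ofNat (2 * k + 1) j) true = initVertex k (j + 1) := by
  funext i
  by_cases hi : i = Fin.ofNat (2 * k + 1) j
  · subst hi
    rw [Function.update_self, initVertex_ofNat hj]
    simp
  · rw [Function.update_of_ne hi, initVertex, initVertex]
    have : i.val ≠ j := by
      intro hc
      exact hi (Fin.ext (by rw [val_ofNat hj, hc]))
    congr 1
    rw [eq_iff_iff]
    omega

theorem edgeSign_initVertex {j : ℕ} (hj : j < 2 * k + 1) :
    (negativeTorusKnot k).edgeSign (initVertex k j) (Fin.ofNat (2 * k + 1) j) = (-1) ^ j := by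
  rw [LinkDiagram.edgeSign]
  congr 1
  have : (Finset.univ.filter fun y : Fin (2 * k + 1) =>
      y < Fin.ofNat (2 * k + 1) j ∧ initVertex k j y = true) =
      (Finset.univ.filter fun y : Fin (2 * k + 1) => y.val < j) := by
    ext y
    simp [initVertex, Fin.lt_def, Nat.mod_eq_of_lt hj]
  rw [this, Fin.card_filter_val_lt]
  omega

/-- The oriented smoothing at `x` puts the positions `x` and `x + 1` on one circle, so the factor
`X_x - X_{x+1}` becomes a relation. -/
theorem kernelPoly_mem_circleIdeal {j : ℕ} {x : Fin (2 * k + 1)} (hx : j < x.val) :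
    kernelPoly R k j ∈ circleIdeal h t (Function.update (initVertex k j) x true) := by
  have hx' : x = Fin.ofNat (2 * k + 1) x.val := Fin.ext (by rw [val_ofNat x.isLt])
  rw [kernelPoly, ← Finset.mul_prod_erase _ _ (Finset.mem_Ico.2 ⟨hx, x.isLt⟩)]
  refine Ideal.mul_mem_right _ _ (sub_mem_circleIdeal ?_)
  rw [← hx', ofNat_succ, ← hx', add_comm 1 x]
  refine nextZero_of_true ⟨⟨j, by omega⟩, ?_⟩ (Function.update_self ..)
  rw [Function.update_of_ne (fun hc => absurd (congrArg Fin.val hc) hx.ne), initVertex]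
  simp

/-- Only the cube edge at `j` survives, with sign `(-1)^j`. It multiplies `κ_{j+1} a` by `X_{j+1} -
X_{j+2}`, where `X_{j+1} = X_0` and `X_{j+2}` is carried through the `2k - j - 1` factors of
`κ_{j+1}`. An odd number of factors gives `X_0 - (h - X_0)`, an even number gives `0`. -/
theorem torusDiff_minimalChain {j : ℕ} (hj : j < 2 * k) (a : FrobeniusAlgebra h t) :
    torusDiff h t k (minimalChain h t k j a) =
      if Even j then minimalChain h t k (j + 1) (mapU h t a) else 0 := by
  have hj' : j < 2 * k + 1 := by omega
  rw [minimalChain_apply, torusDiff_polyChain, Finset.sum_eq_single (Fin.ofNat (2 * k + 1) j)]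
  · rw [if_pos (by rw [initVertex_ofNat hj']; simp), edgeSign_initVertex hj',
      update_initVertex hj', minimalChain_apply]
    have h1 : cyclicX R k (j + 1) - MvPolynomial.X 0 ∈ circleIdeal h t (initVertex k (j + 1)) := by
      refine sub_mem_circleIdeal ?_
      rw [nextZero_initVertex (by omega) le_rfl]
      exact (nextZero_initVertex (i := 0) (by omega) (by omega)).symm
    have h2 := kernelPoly_mul_cyclicX h t (initVertex k (j + 1)) (2 * k - (j + 1)) (j + 1)
      (by omega)
    have h3 := quadratic_mem (h := h) (t := t) (initVertex k (j + 1)) 0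
    rw [kernelPoly_eq hj]
    by_cases hje : Even j
    · have h4 : ¬Even (2 * k - (j + 1)) := by
        rw [Nat.even_sub (by omega), Nat.even_add_one]
        simp [hje]
      rw [if_neg h4] at h2
      rw [if_pos hje, hje.neg_one_pow, Int.cast_one, one_smul]
      refine polyChain_congr h t _ ?_
      -- The last relation reduces the term `2 s X_0²` that arises when `2X_0 - h` multiplies `r + s
      -- X_0`.
      have h5 := add_mem (sub_mem (Ideal.mul_mem_left _ (kernelPoly R k (j + 1) *
        algebraPoly h t k a) h1) (Ideal.mul_mem_left _ (algebraPoly h t k a) h2))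
        (Ideal.mul_mem_left _ (kernelPoly R k (j + 1) * (2 *
          MvPolynomial.C (frobeniusCoord h t true a))) h3)
      convert h5 using 1
      rw [algebraPoly_apply, algebraPoly_apply, frobeniusCoord_mapU, frobeniusCoord_mapU]
      simp only [Bool.false_eq_true, if_false, if_true, map_add, map_sub, map_mul, map_ofNat]
      ring
    · have h4 : Even (2 * k - (j + 1)) := by
        rw [Nat.even_sub (by omega), Nat.even_add_one]
        simp [hje]
      rw [if_pos h4] at h2
      rw [if_neg hje]
      rw [polyChain_eq_zero h t (fun _ => id), smul_zero]
      have h5 := sub_mem (Ideal.mul_mem_left _ (kernelPoly R k (j + 1) *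
        algebraPoly h t k a) h1) (Ideal.mul_mem_left _ (algebraPoly h t k a) h2)
      convert h5 using 1
      ring
  · intro x _ hx
    split_ifs with hv
    · have hjx : j < x.val := by
        rw [initVertex_eq_false] at hv
        refine lt_of_le_of_ne hv fun hc => hx (Fin.ext ?_)
        rw [val_ofNat hj', ← hc]
      rw [polyChain_eq_zero h t (fun _ => id)
        (Ideal.mul_mem_right _ _ (kernelPoly_mem_circleIdeal h t hjx)), smul_zero]
    · rfl
  · simp

/-! ### Critical states -/

/-- The state at the smoothing oriented exactly before `j` with label `l` on the circle closed at
`j` and label `X` on the other circles. -/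
noncomputable def criticalState {j : ℕ} (hj : j < 2 * k + 1) (l : Bool) : TorusState k :=
  stateOf (initVertex k j) (exists_initVertex_eq_false hj) fun i => if i.val = j then l else true

theorem label_criticalState {j : ℕ} (hj : j < 2 * k + 1) (l : Bool) {i : Fin (2 * k + 1)}
    (hi : j ≤ i.val) : label (criticalState hj l) i = if i.val = j then l else true :=
  label_stateOf (exists_initVertex_eq_false hj) _ (initVertex_eq_false.2 hi)

theorem mem_image_ofNat {j : ℕ} {i : Fin (2 * k + 1)} :
    i ∈ (Finset.Ico j (2 * k + 1)).image (Fin.ofNat (2 * k + 1)) ↔ j ≤ i.val := by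
  rw [Finset.mem_image]
  constructor
  · rintro ⟨m, hm, rfl⟩
    rw [Finset.mem_Ico] at hm
    rw [val_ofNat hm.2]
    exact hm.1
  · intro hi
    exact ⟨i.val, Finset.mem_Ico.2 ⟨hi, i.isLt⟩, Fin.ext (val_ofNat i.isLt)⟩

theorem injOn_ofNat (j : ℕ) :
    Set.InjOn (Fin.ofNat (2 * k + 1)) (Finset.Ico j (2 * k + 1) : Set ℕ) := by
  intro a ha b hb hab
  rw [Finset.mem_coe, Finset.mem_Ico] at ha hb
  rw [← val_ofNat ha.2, ← val_ofNat hb.2, hab]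

theorem card_image_ofNat (j : ℕ) :
    ((Finset.Ico j (2 * k + 1)).image (Fin.ofNat (2 * k + 1))).card = 2 * k + 1 - j := by
  rw [Finset.card_image_of_injOn (injOn_ofNat j), Nat.card_Ico]

theorem posX_criticalState {j : ℕ} (hj : j < 2 * k + 1) (l : Bool) :
    posX (criticalState hj l) =
      (Finset.Ico (if l = true then j else j + 1) (2 * k + 1)).image (Fin.ofNat (2 * k + 1)) := by
  ext i
  rw [mem_posX, mem_image_ofNat]
  change initVertex k j i = false ∧ _ ↔ _
  rw [initVertex_eq_false]
  constructor
  · rintro ⟨h1, h2⟩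
    rw [label_criticalState hj l h1] at h2
    cases l
    · by_cases h3 : i.val = j
      · simp [h3] at h2
      · simp; omega
    · simpa using h1
  · intro h1
    have h2 : j ≤ i.val := by split_ifs at h1 <;> omega
    refine ⟨h2, ?_⟩
    rw [label_criticalState hj l h2]
    cases l
    · rw [if_neg]
      simp at h1
      omega
    · simp

theorem homDegree_criticalState {j : ℕ} (hj : j < 2 * k + 1) (l : Bool) :
    (negativeTorusKnot k).homDegree (criticalState hj l) = -(2 * k + 1 - j) := by
  rw [homDegree_eq]
  have : (Finset.univ.filter fun i => (criticalState hj l).1 i = false) =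
      (Finset.Ico j (2 * k + 1)).image (Fin.ofNat (2 * k + 1)) := by
    ext i
    rw [mem_image_ofNat, Finset.mem_filter]
    simp only [Finset.mem_univ, true_and]
    exact initVertex_eq_false
  rw [this, card_image_ofNat]
  omega

theorem quantumDegree_criticalState {j : ℕ} (hj : j < 2 * k + 1) (l : Bool) :
    (negativeTorusKnot k).quantumDegree (criticalState hj l) =
      -(2 * k + 1) - 2 * (2 * k - j) - if l = true then 2 else 0 := by
  have hv : ∃ z, (criticalState hj l).1 z = false := exists_initVertex_eq_false hj
  have h1 := congrArg Finset.card (posX_criticalState hj l)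
  rw [posX] at h1
  rw [quantumDegree_eq hv, numX_eq hv, h1, card_image_ofNat]
  split_ifs <;> omega

/-- If no variable of the circle closed at `z` occurs, that tensor factor is `1`, which has no
`X`-coordinate. -/
theorem polyCoord_eq_zero_of_supported {s : TorusState k} {z : Fin (2 * k + 1)}
    (hz : s.1 z = false) (hl : label s z = true) {p : MvPolynomial (Fin (2 * k + 1)) R}
    (hp : p ∈ MvPolynomial.supported R {i | nextZero s.1 i ≠ z}) : polyCoord h t s p = 0 := by
  rw [MvPolynomial.mem_supported] at hp
  rw [MvPolynomial.as_sum p, map_sum]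
  refine Finset.sum_eq_zero fun m hm => ?_
  rw [polyCoord_monomial, monomialCoord, if_pos ⟨z, hz⟩, Finset.prod_eq_zero (i := z), mul_zero]
  · exact Finset.mem_filter.2 ⟨Finset.mem_univ z, hz⟩
  · have : circleExponent s.1 m z = 0 := by
      refine Finset.sum_eq_zero fun i _ => ?_
      split_ifs with hi
      · by_contra hc
        exact hp ((MvPolynomial.mem_vars_iff_mem_support i).2 ⟨m, hm, Finsupp.mem_support_iff.2 hc⟩) hi
      · rfl
    rw [this, hl]
    rfl

/-- Once the earlier factors have been replaced by their first terms, `X_{m+1}` occurs only in the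
factor `X_{m+1} - X_{m+2}`. The critical state has label `X` on the circle closed at `m + 1`, so the
term with `X_{m+2}` contributes nothing. -/
theorem polyCoord_kernelPoly_step {j : ℕ} (hj : j < 2 * k + 1) (l : Bool)
    (a : FrobeniusAlgebra h t) {m : ℕ} (hjm : j ≤ m) (hm : m < 2 * k) :
    polyCoord h t (criticalState hj l) ((∏ i ∈ Finset.Ico (j + 1) (m + 1), cyclicX R k i) *
      (kernelPoly R k m * algebraPoly h t k a)) =
    polyCoord h t (criticalState hj l) ((∏ i ∈ Finset.Ico (j + 1) (m + 2), cyclicX R k i) *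
      (kernelPoly R k (m + 1) * algebraPoly h t k a)) := by
  have hz : (criticalState hj l).1 (Fin.ofNat (2 * k + 1) (m + 1)) = false := by
    change initVertex k j _ = false
    rw [initVertex_ofNat (by omega)]
    simpa using by omega
  have hl : label (criticalState hj l) (Fin.ofNat (2 * k + 1) (m + 1)) = true := by
    have := val_ofNat (k := k) (i := m + 1) (by omega)
    rw [label_criticalState hj l (by omega), if_neg (by omega)]
  have hX0 : (0 : Fin (2 * k + 1)) ∈ {i | nextZero (criticalState hj l).1 i ≠
      Fin.ofNat (2 * k + 1) (m + 1)} := by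
    have h1 : nextZero (initVertex k j) 0 = _ := nextZero_initVertex (i := 0) hj (by omega)
    change nextZero (initVertex k j) 0 ≠ _
    rw [h1]
    intro hc
    have := congrArg Fin.val hc
    rw [val_ofNat hj, val_ofNat (by omega)] at this
    omega
  have hXi : ∀ i, j ≤ i → i ≠ m + 1 → i ≤ 2 * k + 1 → cyclicX R k i ∈
      -- The bound includes `i = 2k + 1`, which is `X_0` and lies on the circle closed at `j`, not
      -- at `m + 1`.
      MvPolynomial.supported R {i | nextZero (criticalState hj l).1 i ≠
        Fin.ofNat (2 * k + 1) (m + 1)} := by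
    intro i hji him hik
    rcases Nat.lt_or_eq_of_le hik with hik | rfl
    · refine Algebra.subset_adjoin (Set.mem_image_of_mem _ ?_)
      change nextZero (initVertex k j) _ ≠ _
      rw [nextZero_of_false (by rw [initVertex_ofNat hik]; simpa using hji)]
      intro hc
      have := congrArg Fin.val hc
      rw [val_ofNat hik, val_ofNat (by omega)] at this
      exact him this
    · rw [cyclicX_period]
      exact Algebra.subset_adjoin (Set.mem_image_of_mem _ hX0)
  have h1 : (∏ i ∈ Finset.Ico (j + 1) (m + 1), cyclicX R k i) * (cyclicX R k (m + 2) *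
      kernelPoly R k (m + 1) * algebraPoly h t k a) ∈
      MvPolynomial.supported R {i | nextZero (criticalState hj l).1 i ≠
        Fin.ofNat (2 * k + 1) (m + 1)} := by
    refine mul_mem (prod_mem fun i hi => ?_) (mul_mem (mul_mem (hXi _ (by omega) (by omega)
      (by omega)) (prod_mem fun i hi => ?_)) ?_)
    · rw [Finset.mem_Ico] at hi
      exact hXi _ (by omega) (by omega) (by omega)
    · rw [Finset.mem_Ico] at hi
      exact sub_mem (hXi _ (by omega) (by omega) (by omega))
        (hXi _ (by omega) (by omega) (by omega))
    · rw [algebraPoly_apply]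
      exact add_mem (Subalgebra.algebraMap_mem _ _) (mul_mem (Subalgebra.algebraMap_mem _ _)
        (Algebra.subset_adjoin (Set.mem_image_of_mem _ hX0)))
  have h2 := polyCoord_eq_zero_of_supported h t hz hl h1
  rw [← sub_eq_zero, ← map_sub, kernelPoly_eq hm, Finset.prod_Ico_succ_top (by omega : j + 1 ≤ m + 1)]
  rw [← neg_eq_zero, ← map_neg, ← h2]
  congr 1
  ring

/-- By the preceding step only the leading term `X_{j+1} ⋯ X_{2k}` of the kernel element is seen by
the critical states. There `1` and `X_0` give the two states with label `1` and `X` on the circle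
closed at `j`. -/
theorem polyCoord_kernelPoly {j : ℕ} (hj : j < 2 * k + 1) (l : Bool)
    (a : FrobeniusAlgebra h t) : polyCoord h t (criticalState hj l)
      (kernelPoly R k j * algebraPoly h t k a) = frobeniusCoord h t l a := by
  have h1 : ∀ m, j ≤ m → m ≤ 2 * k → polyCoord h t (criticalState hj l)
      (kernelPoly R k j * algebraPoly h t k a) = polyCoord h t (criticalState hj l)
      ((∏ i ∈ Finset.Ico (j + 1) (m + 1), cyclicX R k i) *
        (kernelPoly R k m * algebraPoly h t k a)) := by
    intro m hjm
    induction m, hjm using Nat.le_induction with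
    | base => intro _; simp
    | succ m hjm ih =>
      intro hm
      rw [ih (by omega), polyCoord_kernelPoly_step h t hj l a hjm (by omega)]
  have h2 : kernelPoly R k (2 * k) = 1 := by simp [kernelPoly]
  have h3 : ∀ i, ∏ m ∈ Finset.Ico i (2 * k + 1), cyclicX R k m =
      prodX R ((Finset.Ico i (2 * k + 1)).image (Fin.ofNat (2 * k + 1))) := by
    intro i
    rw [prodX, Finset.prod_image (injOn_ofNat i)]
  have h4 : polyCoord h t (criticalState hj l) ((∏ i ∈ Finset.Ico (j + 1) (2 * k + 1),
      cyclicX R k i) * MvPolynomial.X 0) = polyCoord h t (criticalState hj l)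
        (∏ i ∈ Finset.Ico j (2 * k + 1), cyclicX R k i) := by
    rw [Finset.prod_eq_prod_Ico_succ_bot hj, mul_comm (cyclicX R k j)]
    refine polyCoord_mul_X h t _ _ fun _ => ?_
    change nextZero (initVertex k j) _ = nextZero (initVertex k j) _
    rw [nextZero_initVertex hj le_rfl]
    exact nextZero_initVertex (i := 0) hj (by omega)
  have h5 := posX_criticalState hj false
  have h6 := posX_criticalState hj true
  rw [if_neg (by decide)] at h5
  rw [if_pos rfl] at h6
  have hne : ∀ l', (criticalState hj l' = criticalState hj l) ↔ l' = l := by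
    intro l'
    constructor
    · intro hc
      have h7 : label (criticalState hj l') ⟨j, hj⟩ = label (criticalState hj l) ⟨j, hj⟩ := by
        rw [hc]
      rw [label_criticalState hj l' (i := ⟨j, hj⟩) le_rfl,
        label_criticalState hj l (i := ⟨j, hj⟩) le_rfl, if_pos rfl, if_pos rfl] at h7
      exact h7
    · rintro rfl; rfl
  have h8 : ∀ l', polyCoord h t (criticalState hj l) (prodX R (posX (criticalState hj l'))) =
      if l' = l then 1 else 0 := by
    intro l'
    refine (polyCoord_posX_self h t (s := criticalState hj l')
      (s' := criticalState hj l) (exists_initVertex_eq_false hj) rfl).trans ?_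
    simp only [hne]
  rw [h1 (2 * k) (by omega) le_rfl, h2, one_mul, algebraPoly_apply, mul_add,
    mul_left_comm, mul_comm _ (MvPolynomial.C _), ← MvPolynomial.smul_eq_C_mul,
    ← MvPolynomial.smul_eq_C_mul, map_add, map_smul, map_smul, h4, h3, h3, ← h5, ← h6, h8, h8]
  cases l <;> simp

theorem minimalChain_criticalState {i j : ℕ} (hj : j < 2 * k + 1) (l : Bool)
    (a : FrobeniusAlgebra h t) : minimalChain h t k i a (criticalState hj l) =
      if i = j then frobeniusCoord h t l a else 0 := by
  rw [minimalChain_apply, polyChain_apply]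
  by_cases hij : i = j
  · subst hij
    have hv : (criticalState hj l).1 = initVertex k i := rfl
    rw [if_pos hv, if_pos rfl, polyCoord_kernelPoly]
  · rw [if_neg hij]
    by_cases hi : i < 2 * k + 1
    · rw [if_neg]
      intro hc
      change initVertex k j = initVertex k i at hc
      have h1 := congrFun hc (Fin.ofNat _ i)
      have h2 := congrFun hc (Fin.ofNat _ j)
      rw [initVertex_ofNat hi, initVertex_ofNat hi, decide_eq_decide] at h1
      rw [initVertex_ofNat hj, initVertex_ofNat hj, decide_eq_decide] at h2
      omega
    · rw [if_neg]
      intro hc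
      change initVertex k j = initVertex k i at hc
      have h2 := congrFun hc (Fin.ofNat _ j)
      rw [initVertex_ofNat hj, initVertex_ofNat hj, decide_eq_decide] at h2
      omega

end MinimalComplex

/-! ### Unmatched states and bidegrees of the minimal model -/

section MinimalModel

variable {R : Type u} [CommRing R] {k : ℕ} (h t : R)

/-- The copy of `A` at the oriented smoothing whose right circle is labelled `1`. -/
noncomputable def topChain (k : ℕ) : FrobeniusAlgebra h t →ₗ[R] (TorusState k → R) :=
  LinearMap.pi fun s => if (∀ z, s.1 z = true) ∧ edgeLabel s 0 true = false then
    frobeniusCoord h t (edgeLabel s 0 false) else 0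

theorem topChain_apply (a : FrobeniusAlgebra h t) (s : TorusState k) : topChain h t k a s =
    if (∀ z, s.1 z = true) ∧ edgeLabel s 0 true = false then
      frobeniusCoord h t (edgeLabel s 0 false) a else 0 := by
  rw [topChain, LinearMap.pi_apply]
  split_ifs <;> rfl

theorem torusDiff_topChain (a : FrobeniusAlgebra h t) :
    torusDiff h t k (topChain h t k a) = 0 := by
  refine torusDiff_of_top h t _ fun s ⟨z, hz⟩ => ?_
  rw [topChain_apply, if_neg]
  rintro ⟨hc, -⟩
  rw [hc z] at hz
  cases hz

/-- The unmatched state at the oriented smoothing with label `l` on the left circle. -/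
def topCritical (k : ℕ) (l : Bool) : TorusState k :=
  topState k fun b => if b = true then false else l

theorem topChain_topCritical (a : FrobeniusAlgebra h t) (l : Bool) :
    topChain h t k a (topCritical k l) = frobeniusCoord h t l a := by
  rw [topChain_apply, if_pos ⟨fun _ => rfl, rfl⟩]
  rfl

theorem topChain_criticalState {j : ℕ} (hj : j < 2 * k + 1) (l : Bool)
    (a : FrobeniusAlgebra h t) : topChain h t k a (criticalState hj l) = 0 := by
  rw [topChain_apply, if_neg]
  rintro ⟨hc, -⟩
  obtain ⟨z, hz⟩ := exists_initVertex_eq_false hj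
  have := hc z
  change initVertex k j z = true at this
  rw [hz] at this
  cases this

theorem minimalChain_of_ne {j : ℕ} {s : TorusState k} (hs : s.1 ≠ initVertex k j)
    (a : FrobeniusAlgebra h t) : minimalChain h t k j a s = 0 := by
  rw [minimalChain_apply, polyChain_apply, if_neg hs]

theorem minimalChain_topCritical {j : ℕ} (hj : j < 2 * k + 1) (l : Bool)
    (a : FrobeniusAlgebra h t) : minimalChain h t k j a (topCritical k l) = 0 := by
  refine minimalChain_of_ne h t ?_ a
  obtain ⟨z, hz⟩ := exists_initVertex_eq_false hj
  intro hc
  have := congrFun hc z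
  rw [hz] at this
  cases this

theorem homDegree_topCritical (l : Bool) :
    (negativeTorusKnot k).homDegree (topCritical k l) = 0 := by
  rw [homDegree_eq, Finset.card_eq_zero.2, Nat.cast_zero, neg_zero]
  rw [Finset.filter_eq_empty_iff]
  intro i _ hc
  cases hc

theorem quantumDegree_of_top {s : TorusState k} (hs : ∀ z, s.1 z = true)
    (hl : edgeLabel s 0 true = false) : (negativeTorusKnot k).quantumDegree s =
      -2 * k + 1 - if edgeLabel s 0 false = true then 2 else 0 := by
  rw [quantumDegree_eq_top hs, numX_eq_top hs, Finset.card_filter, Fintype.sum_bool, hl]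
  cases edgeLabel s 0 false <;> simp <;> ring

/-- A target has a one after a zero or has no zero, whereas `initVertex` has all its ones before its
zeros and has a zero. -/
theorem minimalChain_of_matched {u s : TorusState k} (hm : Matched u s) {j : ℕ}
    (hj : j < 2 * k + 1) (a : FrobeniusAlgebra h t) : minimalChain h t k j a s = 0 := by
  refine minimalChain_of_ne h t (fun hc => ?_) a
  rcases hm with ⟨i, x, hm⟩ | hm
  · have h1 := hm.isPrefix.2.1
    have h2 := hm.eq_true
    have h3 := hm.1.2.2.1
    rw [hc, initVertex_eq_false] at h1
    rw [hc, initVertex, decide_eq_true_iff] at h2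
    omega
  · obtain ⟨z, hz⟩ := exists_initVertex_eq_false hj
    have := hm.2.1 z
    rw [hc, hz] at this
    cases this

theorem topChain_of_matched {u s : TorusState k} (hm : Matched u s)
    (a : FrobeniusAlgebra h t) : topChain h t k a s = 0 := by
  rw [topChain_apply, if_neg]
  rintro ⟨h1, h2⟩
  rcases hm with ⟨i, x, hm⟩ | hm
  · have := h1 i
    rw [hm.isPrefix.2.1] at this
    cases this
  · rw [hm.2.2.1] at h2
    cases h2

theorem not_matched_criticalState {j : ℕ} (hj : j < 2 * k) (l : Bool) (w : TorusState k) :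
    ¬Matched (criticalState (Nat.lt_succ_of_lt hj) l) w := by
  rintro (⟨i, x, hm⟩ | hm)
  · have h1 : initVertex k j i = false := hm.1.2.1
    have h3 := hm.1.2.2.1
    rw [initVertex_eq_false] at h1
    have h4 := hm.2.2.1
    have h5 : j < x.val := lt_of_le_of_lt h1 h3
    rw [label_criticalState _ l h5.le, if_neg h5.ne'] at h4
    cases h4
  · have h1 := (hm.1 ⟨j, Nat.lt_succ_of_lt hj⟩).1 (initVertex_eq_false.2 le_rfl)
    have h2 : j = 2 * k := congrArg Fin.val h1
    omega

theorem not_matched_topCritical (l : Bool) (w : TorusState k) : ¬Matched (topCritical k l) w := by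
  rintro (⟨i, x, hm⟩ | hm)
  · cases hm.1.2.1
  · cases (hm.1 _).2 rfl

theorem eq_criticalState {s : TorusState k} {j : Fin (2 * k + 1)} (hv : s.1 = initVertex k j)
    (hl : ∀ y, j < y → label s y = true) : s = criticalState j.isLt (label s j) := by
  refine state_ext_zeros (hv ▸ exists_initVertex_eq_false j.isLt) hv fun i hi => ?_
  rw [hv, initVertex_eq_false] at hi
  rw [label_criticalState _ _ hi]
  split_ifs with hij
  · rw [Fin.ext hij]
  · exact hl i (lt_of_le_of_ne hi fun hc => hij (congrArg Fin.val hc.symm))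

theorem eq_topCritical {s : TorusState k} (hs : ∀ z, s.1 z = true)
    (hl : edgeLabel s 0 true = false) : s = topCritical k (edgeLabel s 0 false) := by
  refine state_ext_top hs (fun _ => rfl) fun b => ?_
  cases b
  · rfl
  · exact hl

/-- The element of `A` whose coordinates are the values of a chain at two states. -/
noncomputable def evalPair (e : Bool → TorusState k) : (TorusState k → R) →ₗ[R]
    FrobeniusAlgebra h t :=
  (LinearMap.proj (e false)).smulRight 1 + (LinearMap.proj (e true)).smulRight (genX h t)

theorem frobeniusCoord_evalPair (e : Bool → TorusState k) (x : TorusState k → R) (l : Bool) :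
    frobeniusCoord h t l (evalPair h t e x) = x (e l) := by
  have := frobeniusCoord_smul_add h t (x (e false)) (x (e true)) l
  cases l <;> exact this

/-! ### Bidegrees -/

variable (𝒢 : ℤ → AddSubgroup R) [SetLike.GradedMonoid 𝒢] {h t}

omit [SetLike.GradedMonoid 𝒢] in
theorem frobeniusCoord_mem {q : ℤ} {a : FrobeniusAlgebra h t} (ha : a ∈ frobeniusPiece 𝒢 h t q)
    (l : Bool) : frobeniusCoord h t l a ∈ 𝒢 (q + if l = true then 2 else 0) := by
  obtain ⟨r, hr, s, hs, rfl⟩ := ha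
  rw [frobeniusCoord_smul_add]
  cases l
  · simpa using hr
  · simpa using hs

omit [SetLike.GradedMonoid 𝒢] in
theorem algebraPoly_mem {q : ℤ} {a : FrobeniusAlgebra h t} (ha : a ∈ frobeniusPiece 𝒢 h t q) :
    algebraPoly h t k a ∈ polyPiece 𝒢 k q := by
  have h1 := frobeniusCoord_mem 𝒢 ha false
  have h2 := frobeniusCoord_mem 𝒢 ha true
  simp only [Bool.false_eq_true, if_false, if_true, add_zero] at h1 h2
  rw [algebraPoly_apply]
  refine add_mem (C_mem_polyPiece 𝒢 h1) ?_
  have := X_mul_mem_polyPiece 𝒢 (C_mem_polyPiece (k := k) 𝒢 h2) 0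
  rw [add_sub_cancel_right, mul_comm (MvPolynomial.X 0)] at this
  exact this

/-- Each of the `2k - j` linear factors of the kernel element lowers the quantum degree by `2`, and
`2k+1` is the common normalization of all smoothings. -/
theorem minimalChain_mem (hh : h ∈ 𝒢 (-2)) (ht : t ∈ 𝒢 (-4)) {j : ℕ} (hj : j < 2 * k + 1)
    {p q p' q' : ℤ} {a : FrobeniusAlgebra h t} (ha : a ∈ (frobeniusModule 𝒢 h t).piece p q)
    (hp : p' = p - (2 * k + 1 - j)) (hq' : q' = q - 2 * (2 * k - j) - (2 * k + 1)) :
    minimalChain h t k j a ∈ ((negativeTorusKnot k).khovanovComplex h t 𝒢).piece p' q' := by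
  by_cases hp0 : p = 0
  · subst hp0
    simp only [if_true] at ha
    refine mem_basedComplex_piece.2 fun s => ?_
    rw [minimalChain_apply, polyChain_apply]
    by_cases hs : s.1 = initVertex k j
    · have h1 : (negativeTorusKnot k).homDegree s = p' := by
        rw [hp, zero_sub, ← homDegree_criticalState hj false, homDegree_eq, homDegree_eq, hs]
        rfl
      refine ⟨fun _ => ?_, fun hc => absurd h1 hc⟩
      rw [if_pos hs]
      have h2 := polyCoord_mem 𝒢 hh ht s (prod_mul_mem_polyPiece 𝒢 (algebraPoly_mem (k := k) 𝒢 ha)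
        (Fin.ofNat (2 * k + 1)) (fun i => Fin.ofNat (2 * k + 1) (i + 1))
        (Finset.Ico (j + 1) (2 * k + 1)))
      have h3 : ((Finset.Ico (j + 1) (2 * k + 1)).card : ℤ) = 2 * k - j := by
        rw [Nat.card_Ico]
        omega
      rw [h3, ← hq'] at h2
      exact h2
    · rw [if_neg hs]
      exact ⟨fun _ => zero_mem _, fun _ => rfl⟩
  · simp only [if_neg hp0, AddSubgroup.mem_bot] at ha
    rw [ha, map_zero]
    exact zero_mem _

omit [SetLike.GradedMonoid 𝒢] in
theorem topChain_mem {p q p' q' : ℤ} {a : FrobeniusAlgebra h t}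
    (ha : a ∈ (frobeniusModule 𝒢 h t).piece p q) (hp : p' = p)
    (hq : q' = q + (-2 * k + 1)) :
    topChain h t k a ∈ ((negativeTorusKnot k).khovanovComplex h t 𝒢).piece p' q' := by
  subst hp
  by_cases hp0 : p' = 0
  · subst hp0
    simp only [if_true] at ha
    refine mem_basedComplex_piece.2 fun s => ?_
    rw [topChain_apply]
    by_cases hs : (∀ z, s.1 z = true) ∧ edgeLabel s 0 true = false
    · rw [if_pos hs]
      constructor
      · intro _
        have := frobeniusCoord_mem 𝒢 ha (edgeLabel s 0 false)
        convert this using 2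
        rw [quantumDegree_of_top hs.1 hs.2, hq]
        ring
      · intro hc
        rw [eq_topCritical hs.1 hs.2] at hc
        exact absurd (homDegree_topCritical _) hc
    · rw [if_neg hs]
      exact ⟨fun _ => zero_mem _, fun _ => rfl⟩
  · simp only [if_neg hp0, AddSubgroup.mem_bot] at ha
    rw [ha, map_zero]
    exact zero_mem _

omit [SetLike.GradedMonoid 𝒢] in
theorem evalPair_mem {e : Bool → TorusState k} {H Q : ℤ}
    (hH : ∀ l, (negativeTorusKnot k).homDegree (e l) = H)
    (hQ : ∀ l, (negativeTorusKnot k).quantumDegree (e l) = Q - if l = true then 2 else 0)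
    {p q p' q' : ℤ} {x : TorusState k → R}
    (hx : x ∈ ((negativeTorusKnot k).khovanovComplex h t 𝒢).piece p q)
    (hp : p' = p - H) (hq : q' = q - Q) :
    evalPair h t e x ∈ (frobeniusModule 𝒢 h t).piece p' q' := by
  have hx' := fun s => mem_basedComplex_piece.1 hx s
  by_cases hp0 : p = H
  · subst hp0 hp hq
    simp only [sub_self, if_true]
    have h1 := (hx' (e false)).1 (hH _)
    have h2 := (hx' (e true)).1 (hH _)
    refine ⟨_, ?_, _, ?_, rfl⟩
    · rw [hQ, if_neg (by decide), sub_zero] at h1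
      exact h1
    · rw [hQ, if_pos rfl, sub_sub_eq_add_sub, add_sub_right_comm] at h2
      exact h2
  · have h0 : evalPair h t e x = 0 := by
      refine frobenius_ext h t fun l => ?_
      rw [frobeniusCoord_evalPair, map_zero]
      exact (hx' (e l)).2 (by rw [hH]; exact fun hc => hp0 hc.symm)
    rw [h0]
    exact zero_mem _

end MinimalModel

/-- The minimal model of the Khovanov complex of the negative torus knot `T*(2, 2k+1)`. -/
noncomputable abbrev minimalComplex {R : Type u} [CommRing R] (𝒢 : ℤ → AddSubgroup R)
    (h t : R) (k : ℕ) : BigradedComplex R :=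
  (finiteSum fun i : Finset.Icc 1 k =>
    (twoTerm (frobeniusModule 𝒢 h t) ((frobeniusModule 𝒢 h t).shift 1 2) (mapU h t)).shift
      (-2 * (i : ℤ) - 1) (-2 * (k : ℤ) - 4 * (i : ℤ) - 1)).sum
    ((frobeniusModule 𝒢 h t).shift 0 (-2 * (k : ℤ) + 1)).toComplex

/-! ### The homotopy equivalence -/

section Equivalence

variable {R : Type u} [CommRing R] {k : ℕ}

theorem even_index_lt (i : Finset.Icc 1 k) : 2 * k - 2 * (i : ℕ) < 2 * k := by
  have := Finset.mem_Icc.1 i.2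
  omega

theorem odd_index_lt (i : Finset.Icc 1 k) : 2 * k + 1 - 2 * (i : ℕ) < 2 * k := by
  have := Finset.mem_Icc.1 i.2
  omega

variable (h t : R)

/-- The inclusion of the minimal model. -/
noncomputable def minimalIncl (k : ℕ) :
    (((i : Finset.Icc 1 k) → FrobeniusAlgebra h t × FrobeniusAlgebra h t) ×
      FrobeniusAlgebra h t) →ₗ[R] (TorusState k → R) :=
  LinearMap.coprod (∑ i : Finset.Icc 1 k,
    LinearMap.coprod (minimalChain h t k (2 * k - 2 * (i : ℕ)))
      (minimalChain h t k (2 * k + 1 - 2 * (i : ℕ))) ∘ₗ LinearMap.proj i) (topChain h t k)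

/-- The projection to the minimal model. -/
noncomputable def minimalProj (k : ℕ) : (TorusState k → R) →ₗ[R]
    (((i : Finset.Icc 1 k) → FrobeniusAlgebra h t × FrobeniusAlgebra h t) ×
      FrobeniusAlgebra h t) :=
  LinearMap.prod (LinearMap.pi fun i => LinearMap.prod
    (evalPair h t (criticalState (Nat.lt_succ_of_lt (even_index_lt i))))
    (evalPair h t (criticalState (Nat.lt_succ_of_lt (odd_index_lt i)))))
    (evalPair h t (topCritical k))

theorem minimalIncl_apply (x : ((i : Finset.Icc 1 k) → FrobeniusAlgebra h t ×
    FrobeniusAlgebra h t) × FrobeniusAlgebra h t) : minimalIncl h t k x =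
      (∑ i : Finset.Icc 1 k, (minimalChain h t k (2 * k - 2 * (i : ℕ)) (x.1 i).1 +
        minimalChain h t k (2 * k + 1 - 2 * (i : ℕ)) (x.1 i).2)) + topChain h t k x.2 := by
  rw [minimalIncl, LinearMap.coprod_apply, LinearMap.sum_apply]
  rfl

/-- The indices `2k - 2i` and `2k + 1 - 2i` are pairwise distinct, so each unmatched state sees a
single summand, and sees there a coordinate in the basis `1, X`. -/
theorem minimalProj_minimalIncl (x : ((i : Finset.Icc 1 k) → FrobeniusAlgebra h t ×
    FrobeniusAlgebra h t) × FrobeniusAlgebra h t) :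
    minimalProj h t k (minimalIncl h t k x) = x := by
  have hval : ∀ s : TorusState k, minimalIncl h t k x s =
      (∑ i : Finset.Icc 1 k, (minimalChain h t k (2 * k - 2 * (i : ℕ)) (x.1 i).1 s +
        minimalChain h t k (2 * k + 1 - 2 * (i : ℕ)) (x.1 i).2 s)) + topChain h t k x.2 s := by
    intro s
    rw [minimalIncl_apply, Pi.add_apply, Finset.sum_apply]
    rfl
  refine Prod.ext (funext fun i => Prod.ext ?_ ?_) ?_
  · refine frobenius_ext h t fun l => ?_
    refine (frobeniusCoord_evalPair h t _ _ l).trans ?_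
    rw [hval, topChain_criticalState, add_zero, Finset.sum_eq_single i]
    · have := Finset.mem_Icc.1 i.2
      rw [minimalChain_criticalState, minimalChain_criticalState, if_pos rfl, if_neg (by omega),
        add_zero]
    · intro b _ hb
      have h1 := Finset.mem_Icc.1 i.2
      have h2 := Finset.mem_Icc.1 b.2
      have h3 : (b : ℕ) ≠ i := fun hc => hb (Subtype.ext hc)
      rw [minimalChain_criticalState, minimalChain_criticalState, if_neg (by omega),
        if_neg (by omega), add_zero]
    · simp
  · refine frobenius_ext h t fun l => ?_
    refine (frobeniusCoord_evalPair h t _ _ l).trans ?_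
    rw [hval, topChain_criticalState, add_zero, Finset.sum_eq_single i]
    · have := Finset.mem_Icc.1 i.2
      rw [minimalChain_criticalState, minimalChain_criticalState, if_pos rfl, if_neg (by omega),
        zero_add]
    · intro b _ hb
      have h1 := Finset.mem_Icc.1 i.2
      have h2 := Finset.mem_Icc.1 b.2
      have h3 : (b : ℕ) ≠ i := fun hc => hb (Subtype.ext hc)
      rw [minimalChain_criticalState, minimalChain_criticalState, if_neg (by omega),
        if_neg (by omega), add_zero]
    · simp
  · refine frobenius_ext h t fun l => ?_
    refine (frobeniusCoord_evalPair h t _ _ l).trans ?_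
    rw [hval, topChain_topCritical, Finset.sum_eq_zero, zero_add]
    intro i _
    rw [minimalChain_topCritical _ _ (Nat.lt_succ_of_lt (even_index_lt i)),
      minimalChain_topCritical _ _ (Nat.lt_succ_of_lt (odd_index_lt i)), add_zero]

variable (𝒢 : ℤ → AddSubgroup R)

/-- The first index of each pair is even and its chain maps by `U` to the second; the second is odd
and its chain is a cycle. -/
theorem minimalIncl_d (x : (minimalComplex 𝒢 h t k).carrier) :
    minimalIncl h t k ((minimalComplex 𝒢 h t k).d x) =
      torusDiff h t k (minimalIncl h t k x) := by
  rw [minimalIncl_apply, minimalIncl_apply, map_add, torusDiff_topChain, map_sum]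
  congr 1
  · refine Finset.sum_congr rfl fun i _ => ?_
    have hi := Finset.mem_Icc.1 i.2
    have h1 : 2 * k - 2 * (i : ℕ) + 1 = 2 * k + 1 - 2 * (i : ℕ) := by omega
    rw [map_add, torusDiff_minimalChain h t (even_index_lt i),
      torusDiff_minimalChain h t (odd_index_lt i), if_pos, if_neg, h1, add_zero]
    · change minimalChain h t k (2 * k - 2 * (i : ℕ)) 0 + minimalChain h t k
        (2 * k + 1 - 2 * (i : ℕ)) (mapU h t (x.1 i).1) = _
      rw [map_zero, zero_add]
    · rw [← h1, Nat.even_add_one, not_not, Nat.even_sub (by omega)]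
      simp
    · rw [Nat.even_sub (by omega)]
      simp
  · exact map_zero _

variable {h t}

theorem minimalIncl_hasBidegree [SetLike.GradedMonoid 𝒢] (hh : h ∈ 𝒢 (-2)) (ht : t ∈ 𝒢 (-4)) :
    HasBidegree (minimalComplex 𝒢 h t k).toBigradedModule
      ((negativeTorusKnot k).khovanovComplex h t 𝒢).toBigradedModule (minimalIncl h t k) 0 0 := by
  rintro p q ⟨y, c⟩ hx
  obtain ⟨hy, hc⟩ := hx
  rw [add_zero, add_zero, minimalIncl_apply]
  refine add_mem (sum_mem fun i _ => ?_) (topChain_mem 𝒢 (p := p - 0)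
    (q := q - (-2 * (k : ℤ) + 1)) hc (by ring) (by ring))
  have hi := Finset.mem_Icc.1 i.2
  obtain ⟨h1, h2⟩ := hy i (Set.mem_univ i)
  refine add_mem (minimalChain_mem 𝒢 hh ht (Nat.lt_succ_of_lt (even_index_lt i)) h1 ?_ ?_)
    (minimalChain_mem 𝒢 hh ht (Nat.lt_succ_of_lt (odd_index_lt i)) h2 ?_ ?_) <;> omega

theorem minimalProj_hasBidegree :
    HasBidegree ((negativeTorusKnot k).khovanovComplex h t 𝒢).toBigradedModule
      (minimalComplex 𝒢 h t k).toBigradedModule (minimalProj h t k) 0 0 := by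
  intro p q x hx
  rw [add_zero, add_zero]
  refine ⟨fun i _ => ⟨?_, ?_⟩, ?_⟩
  · have hi := Finset.mem_Icc.1 i.2
    exact evalPair_mem 𝒢 (homDegree_criticalState _) (quantumDegree_criticalState _) hx
      (by omega) (by omega)
  · have hi := Finset.mem_Icc.1 i.2
    exact evalPair_mem 𝒢 (homDegree_criticalState _) (quantumDegree_criticalState _) hx
      (by omega) (by omega)
  · exact evalPair_mem 𝒢 homDegree_topCritical
      (fun l => quantumDegree_of_top (s := topCritical k l) (fun _ => rfl) rfl) hx
      (by ring) (by ring)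

theorem minimalProj_eq_zero_iff (y : TorusState k → R) : minimalProj h t k y = 0 ↔
    (∀ (j : ℕ) (hj : j < 2 * k) (l : Bool), y (criticalState (Nat.lt_succ_of_lt hj) l) = 0) ∧
      ∀ l, y (topCritical k l) = 0 := by
  have hpair : ∀ e : Bool → TorusState k, evalPair h t e y = 0 ↔ ∀ l, y (e l) = 0 := by
    intro e
    constructor
    · intro he l
      rw [← frobeniusCoord_evalPair h t e y l, he, map_zero]
    · intro he
      refine frobenius_ext h t fun l => ?_
      rw [frobeniusCoord_evalPair, he, map_zero]
  constructor
  · intro hy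
    have h1 : ∀ i, evalPair h t _ y = 0 ∧ evalPair h t _ y = 0 := fun i : Finset.Icc 1 k =>
      Prod.ext_iff.1 (congrFun (congrArg Prod.fst hy) i)
    have h2 : evalPair h t _ y = 0 := congrArg Prod.snd hy
    refine ⟨fun j hj l => ?_, (hpair _).1 h2⟩
    -- The index `j = 2m` or `j = 2m + 1` belongs to the summand `i = k - m`, as its first or second
    -- term; `j < 2k` ensures `i ≥ 1`.
    rcases Nat.even_or_odd' j with ⟨m, rfl | rfl⟩
    · have h3 := (hpair _).1 (h1 ⟨k - m, Finset.mem_Icc.2 ⟨by omega, by omega⟩⟩).1 l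
      convert h3 using 3
      simp only
      omega
    · have h3 := (hpair _).1 (h1 ⟨k - m, Finset.mem_Icc.2 ⟨by omega, by omega⟩⟩).2 l
      convert h3 using 3
      simp only
      omega
  · rintro ⟨h1, h2⟩
    exact Prod.ext (funext fun i => Prod.ext
      ((hpair _).2 (h1 _ (even_index_lt i))) ((hpair _).2 (h1 _ (odd_index_lt i))))
      ((hpair _).2 h2)

theorem khovanovComplex_homotopyEquivalent [SetLike.GradedMonoid 𝒢] (hh : h ∈ 𝒢 (-2)) (ht : t ∈ 𝒢 (-4)) :
    HomotopyEquivalent ((negativeTorusKnot k).khovanovComplex h t 𝒢)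
      (minimalComplex 𝒢 h t k) := by
  refine homotopyEquivalent_of_matching (M := Matched (k := k)) 𝒢 (negativeTorusKnot k).homDegree
    (negativeTorusKnot k).quantumDegree (c := (negativeTorusKnot k).diffCoeff h t)
    (khovanovComplex_isComplex 𝒢 hh ht) (fun _ _ _ => Matched.unique_right)
    (fun _ _ _ => Matched.unique_left) (fun _ _ _ => Matched.not_matched)
    (fun _ _ hm => hm.diffCoeff_eq_or h t) (fun _ _ hm => ⟨hm.homDegree_eq, hm.quantumDegree_eq⟩)
    (fun s => vertexRank s.1) (fun _ _ _ _ hm hm' hne hc => hm.vertexRank_lt h t hm' hne hc)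
    (minimalIncl h t k) (minimalProj h t k) (minimalIncl_hasBidegree 𝒢 hh ht)
    (minimalProj_hasBidegree 𝒢) (minimalIncl_d h t 𝒢) (minimalProj_minimalIncl h t) ?_ ?_ ?_
  · intro x u s hm
    rw [minimalIncl_apply, Pi.add_apply, Finset.sum_apply, topChain_of_matched h t hm, add_zero]
    refine Finset.sum_eq_zero fun i _ => ?_
    rw [Pi.add_apply, minimalChain_of_matched h t hm (Nat.lt_succ_of_lt (even_index_lt i)),
      minimalChain_of_matched h t hm (Nat.lt_succ_of_lt (odd_index_lt i)), add_zero]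
  · intro y hy
    exact (minimalProj_eq_zero_iff y).2 ⟨fun j hj l => hy _ (not_matched_criticalState hj l),
      fun l => hy _ (not_matched_topCritical l)⟩
  · intro y hV hπ s hs
    obtain ⟨h1, h2⟩ := (minimalProj_eq_zero_iff y).1 hπ
    -- A state that is not a source is a target, where `y` vanishes by assumption, or one of the
    -- critical states, whose values are the coordinates of the projection.
    rcases unmatched_cases s with ⟨w, hw⟩ | ⟨u, hu⟩ | ⟨j, hj, hv, hl⟩ | ⟨htop, hl⟩
    · exact absurd hw (hs w)
    · exact hV u s hu
    · rw [eq_criticalState hv hl]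
      exact h1 j hj _
    · rw [eq_topCritical htop hl]
      exact h2 _

end Equivalence

end Khovanov

theorem corollary3p3 {R : Type u} [CommRing R] (𝒢 : ℤ → AddSubgroup R) [SetLike.GradedMonoid 𝒢]
    (h t : R) (hh : h ∈ 𝒢 (-2)) (ht : t ∈ 𝒢 (-4)) (k : ℕ) (hk : 0 < k) :
    Khovanov.HomotopyEquivalent
      ((Khovanov.negativeTorusKnot k).khovanovComplex h t 𝒢)
      ((Khovanov.finiteSum fun i : Finset.Icc 1 k =>
          (Khovanov.twoTerm
              (Khovanov.frobeniusModule 𝒢 h t)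
              ((Khovanov.frobeniusModule 𝒢 h t).shift 1 2)
              (Khovanov.mapU h t)).shift
            (-2 * (i : ℤ) - 1) (-2 * (k : ℤ) - 4 * (i : ℤ) - 1)).sum
        ((Khovanov.frobeniusModule 𝒢 h t).shift 0 (-2 * (k : ℤ) + 1)).toComplex) :=
  Khovanov.khovanovComplex_homotopyEquivalent 𝒢 hh ht
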